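/- **Setting.** Fix integers $k_1,k_2\ge 1$ (the true numbers of factors), $h_0\ge 1$, reals $0<\eta_1<\eta_2<1$ and $\delta_1,\delta_2\in[0,1]$; put $\delta_{\max}=\max(\delta_1,\delta_2)$. Let $({\bf x}_{t,1},{\bf x}_{t,2})_{t\in\mathbb Z}$ be a random process with ${\bf x}_{t,i}\in\mathbb R^{k_i}$. Consider sample sizes $n$, dimensions $p$ and break dates $r_0=\gamma_0 n$ running along an arbitrary sequence with $n,p\to\infty$; the $p\times k_i$ loading matrices ${\bf A}_i$, the $p$-dimensional noise $(\boldsymbol\varepsilon_t)$ and $r_0$ may change along the sequence. The observations are ${\bf y}_t={\bf A}_1{\bf x}_{t,1}+\boldsymbol\varepsilon_t$ for $t\le r_0$ and ${\bf y}_t={\bf A}_2{\bf x}_{t,2}+\boldsymbol\varepsilon_t$ for $t>r_0$. For $\gamma\in[0,1]$ let $I_{t,1}(\gamma)$, $I_{t,2}(\gamma)$ be the indicators of $1\le t\le\lfloor\gamma n\rfloor$ and $\lfloor\gamma n\rfloor<t\le n$, and $$\boldsymbol\Sigma_{x,i}(h,\gamma)=\tfrac1n\sum_{t=1}^n {\rm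 E}[{\bf x}_{t,i}{\bf x}_{t+h,i}'I_{t,i}(\gamma)I_{t+h,i}(\gamma)],\quad \boldsymbol\Sigma_{y,i}(h,\gamma)=\tfrac1n\sum_{t=1}^n {\rm E}[{\bf y}_t{\bf y}_{t+h}'I_{t,i}(\gamma)I_{t+h,i}(\gamma)],$$ $${\bf M}_i(\gamma)=\sum_{h=1}^{h_0}\boldsymbol\Sigma_{y,i}(h,\gamma)\boldsymbol\Sigma_{y,i}(h,\gamma)';$$ $\hat{\boldsymbol\Sigma}_{y,i}(h,\gamma)$ and $\hat{\bf M}_i(\gamma)$ are the same expressions without the expectation. Let ${\bf Q}_i$ be the matrix of orthonormal eigenvectors of ${\bf M}_i(\gamma_0)$ for its $k_i$ largest eigenvalues, and $\hat{\bf Q}_i(\gamma)$, $\hat{\bf B}_i(\gamma)$ the matrices whose columns are orthonormal eigenvectors of $\hat{\bf M}_i(\gamma)$ for its $k_i$ largest, respectively $p-k_i$ smallest, eigenvalues (any choice is allowed where they are not unique). Let $\hat\gamma$ be a minimizer of $$\hat G(\gamma)=\sum_{i=1}^2\big\|\hat{\bf B}_i(\eta_i)'\hat{\bf M}_i(\gamma)\hat{\bf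 B}_i(\eta_i)\big\|_2\quad\text{over}\quad \gamma\in\{0,\tfrac1n,\dots,1\}\cap(\eta_1,\eta_2).$$ $\|\cdot\|_2$ is the spectral norm, $\|{\bf H}\|_{\min}$ the square root of the smallest nonzero eigenvalue of ${\bf H}'{\bf H}$, $\mathcal M({\bf H})$ the column space. For subspaces of dimensions $q_1,q_2\geq 1$ with orthonormal bases in the columns of ${\bf O}_1,{\bf O}_2$, $\mathcal D=\{1-{\rm tr}({\bf O}_1{\bf O}_1'{\bf O}_2{\bf O}_2')/\min(q_1,q_2)\}^{1/2}$. Finally, for $i=1,2$, $\boldsymbol\Gamma_{x,i}(h,c_1,c_2)=(\lfloor c_2n\rfloor-\lfloor c_1n\rfloor)^{-1}\sum_{\lfloor c_1n\rfloor<t\le\lfloor c_2n\rfloor}{\rm E}({\bf x}_{t,i}{\bf x}_{t+h,i}')$. **Assumptions.** There are constants $\zeta>2$ and $\sigma_x,\sigma_\varepsilon,d,u,u_0>0$ such that (5–8 for all experiments sufficiently far along the sequence): 1. the strong ($\alpha$-)mixing coefficients of $({\bf x}_{t,1},{\bf x}_{t,2})_{t\in\mathbb Z}$ satisfy $\sum_{t\ge1}\alpha(t)^{1-2/\zeta}<\infty$;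 2. ${\rm E}|x_{t,i,j}|^{4\zeta}<\sigma_x^{4\zeta}$ for all $i$, $j\le k_i$, $t\ge1$; 3. conditionally on the whole process $({\bf x}_{s,1},{\bf x}_{s,2})_{s\in\mathbb Z}$ and on $(\boldsymbol\varepsilon_s)_{s<t}$, the square-integrable vector $\boldsymbol\varepsilon_t$ has mean zero and coordinate variances at most $\sigma_\varepsilon^2$ (for instance, the $\boldsymbol\varepsilon_t$ are independent, centred, with variances at most $\sigma_\varepsilon^2$, and independent of the factors); 4. $\|{\bf A}_i\|_2^2\asymp\|{\bf A}_i\|_{\min}^2\asymp p^{1-\delta_i}$ for $i=1,2$; 5. $\gamma_0\in(\eta_1,\eta_2)$, and for all $i$ and $\gamma\in[\eta_1,\eta_2]$ there is $h\in\{1,\dots,h_0\}$ such that $\boldsymbol\Sigma_{x,i}(h,\gamma)$ is of full rank with $\|\boldsymbol\Sigma_{x,i}(h,\gamma)\|_{\min}\ge u$; 6. ${\bf M}_i(\gamma)$ has at least $k_i$ distinct positive eigenvalues for all $i$ and $\gamma\in[\eta_1,\eta_2]$; 7. $\mathcal D\{\mathcal M({\bf Q}_1),\mathcal M({\bf Q}_2)\}>d$;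 8. for every $\gamma\in(\eta_1,\gamma_0)$ with $\lfloor\gamma n\rfloor<r_0-h_0$ there is $h\in\{1,\dots,h_0\}$ such that $\boldsymbol\Gamma_{x,1}(h,\gamma,\gamma_0-h/n)$ is of full rank with smallest singular value at least $u_0$, and for every $\gamma\in(\gamma_0,\eta_2)$ with $\lfloor\gamma n\rfloor>r_0$ there is $h\in\{1,\dots,h_0\}$ such that $\boldsymbol\Gamma_{x,2}(h,\gamma_0,\gamma)$ is of full rank with smallest singular value at least $u_0$. **Theorem.** If $p^{\delta_{\max}}n^{-1/2}\to0$, then for $i=1,2$ $$\mathcal D\{\mathcal M[\hat{\bf Q}_i(\hat\gamma)],\mathcal M({\bf Q}_i)\}=O_p(p^{\delta_i}n^{-1/2}),$$ and the same rate holds for the estimator that uses the true break, $\mathcal D\{\mathcal M[\hat{\bf Q}_i(\gamma_0)],\mathcal M({\bf Q}_i)\}=O_p(p^{\delta_i}n^{-1/2})$. -/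

import Mathlib

open MeasureTheory ProbabilityTheory Filter Topology Asymptotics
open scoped Matrix

noncomputable section

namespace CPFactor

/-! ### Matrices and linear spaces -/

/-- The spectral norm `‖H‖₂` of a rectangular real matrix (operator norm between Euclidean spaces). -/
def l2norm {ι κ : Type*} [Fintype ι] [Fintype κ] [DecidableEq ι] [DecidableEq κ]
    (H : Matrix ι κ ℝ) : ℝ :=
  ‖(Matrix.toEuclideanLin H).toContinuousLinearMap‖

/-- `‖H‖_min`: the square root of the smallest nonzero eigenvalue of `H'H`. -/
def minNorm {ι κ : Type*} [Fintype ι] [Fintype κ] [DecidableEq κ]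
    (H : Matrix ι κ ℝ) : ℝ :=
  Real.sqrt (sInf {l : ℝ | l ≠ 0 ∧ Module.End.HasEigenvalue (Matrix.toLin' (Hᵀ * H)) l})

/-- The column space `M(H)`, as a subspace of Euclidean space. -/
def colSpace {ι κ : Type*} (H : Matrix ι κ ℝ) : Submodule ℝ (EuclideanSpace ℝ ι) :=
  Submodule.span ℝ (Set.range fun j : κ => WithLp.toLp 2 (fun a : ι => H a j))

/-- The distance `{1 - tr(O₁O₁'O₂O₂') / min(q₁,q₂)}^{1/2}` between linear spaces of dimensions
`q₁, q₂`, where `OᵢOᵢ'` is the orthogonal projection onto the `i`-th space. -/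
def spaceDist {ι : Type*} [Fintype ι] (S T : Submodule ℝ (EuclideanSpace ℝ ι)) : ℝ :=
  Real.sqrt (1 -
    LinearMap.trace ℝ (EuclideanSpace ℝ ι)
        (S.starProjection.toLinearMap ∘ₗ T.starProjection.toLinearMap) /
      (min (Module.finrank ℝ S) (Module.finrank ℝ T) : ℕ))

/-- The columns of `V` are orthonormal eigenvectors of `M`, the `j`-th one belonging to the `j`-th
largest eigenvalue (with multiplicity). -/
def IsEigenSystem {p : ℕ} (M V : Matrix (Fin p) (Fin p) ℝ) : Prop :=
  ∃ l : Fin p → ℝ, Antitone l ∧ Vᵀ * V = 1 ∧ M * V = V * Matrix.diagonal l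

/-- The first `k` columns of `V`. -/
def firstCols {p : ℕ} (k : ℕ) (V : Matrix (Fin p) (Fin p) ℝ) :
    Matrix (Fin p) {j : Fin p // (j : ℕ) < k} ℝ :=
  V.submatrix id Subtype.val

/-- The columns of `V` from the `(k+1)`-st on. -/
def lastCols {p : ℕ} (k : ℕ) (V : Matrix (Fin p) (Fin p) ℝ) :
    Matrix (Fin p) {j : Fin p // k ≤ (j : ℕ)} ℝ :=
  V.submatrix id Subtype.val

/-! ### The model. Regime `0` is before the break, regime `1` after it. -/

section Model

variable {Ω : Type*} {k : Fin 2 → ℕ} {p : ℕ}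

/-- The observations: `y_t = A₁ x_{t,1} + ε_t` for `t ≤ r₀` and `y_t = A₂ x_{t,2} + ε_t` for
`t > r₀`. -/
def obs (A : ∀ i, Matrix (Fin p) (Fin (k i)) ℝ) (x : ∀ i, ℤ → Ω → Fin (k i) → ℝ)
    (ε : ℤ → Ω → Fin p → ℝ) (r₀ : ℕ) (t : ℤ) (ω : Ω) : Fin p → ℝ :=
  if t ≤ (r₀ : ℤ) then A 0 *ᵥ x 0 t ω + ε t ω else A 1 *ᵥ x 1 t ω + ε t ω

/-- The time points of regime `i` according to the tentative break `γ`: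
`1 ≤ t ≤ ⌊γ n⌋` for the first regime, `⌊γ n⌋ < t ≤ n` for the second. -/
def regime (n : ℕ) (γ : ℝ) (i : Fin 2) : Finset ℤ :=
  if i = 0 then Finset.Icc 1 ⌊γ * n⌋ else Finset.Ioc ⌊γ * n⌋ n

/-- `n⁻¹ ∑_{t=1}^n E[z_t z_{t+h}' I_{t,i}(γ) I_{t+h,i}(γ)]`. -/
def popCross [MeasurableSpace Ω] {ι : Type*} (μ : Measure Ω) (n : ℕ) (z : ℤ → Ω → ι → ℝ)
    (i : Fin 2) (h : ℕ) (γ : ℝ) : Matrix ι ι ℝ :=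
  Matrix.of fun a b => (n : ℝ)⁻¹ * ∑ t ∈ Finset.Icc (1 : ℤ) n,
    if t ∈ regime n γ i ∧ t + h ∈ regime n γ i then ∫ ω, z t ω a * z (t + h) ω b ∂μ else 0

/-- `n⁻¹ ∑_{t=1}^n z_t z_{t+h}' I_{t,i}(γ) I_{t+h,i}(γ)` for one realisation `z`. -/
def sampleCross {ι : Type*} (n : ℕ) (z : ℤ → ι → ℝ) (i : Fin 2) (h : ℕ) (γ : ℝ) :
    Matrix ι ι ℝ :=
  Matrix.of fun a b => (n : ℝ)⁻¹ * ∑ t ∈ Finset.Icc (1 : ℤ) n,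
    if t ∈ regime n γ i ∧ t + h ∈ regime n γ i then z t a * z (t + h) b else 0

/-- `M_i(γ) = ∑_{h=1}^{h₀} Σ_{y,i}(h,γ) Σ_{y,i}(h,γ)'`. -/
def popM [MeasurableSpace Ω] (μ : Measure Ω) (n h₀ : ℕ) (y : ℤ → Ω → Fin p → ℝ) (i : Fin 2)
    (γ : ℝ) : Matrix (Fin p) (Fin p) ℝ :=
  ∑ h ∈ Finset.Icc 1 h₀, popCross μ n y i h γ * (popCross μ n y i h γ)ᵀ

/-- The sample version of `M_i(γ)`. -/
def sampleM (n h₀ : ℕ) (y : ℤ → Fin p → ℝ) (i : Fin 2) (γ : ℝ) : Matrix (Fin p) (Fin p) ℝ :=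
  ∑ h ∈ Finset.Icc 1 h₀, sampleCross n y i h γ * (sampleCross n y i h γ)ᵀ

/-- The averaged moment matrix `(⌊c₂ n⌋ - ⌊c₁ n⌋)⁻¹ ∑_{⌊c₁ n⌋ < t ≤ ⌊c₂ n⌋} E(z_t z_{t+h}')`. -/
def avgCross [MeasurableSpace Ω] {ι : Type*} (μ : Measure Ω) (n : ℕ) (z : ℤ → Ω → ι → ℝ)
    (h : ℕ) (c₁ c₂ : ℝ) : Matrix ι ι ℝ :=
  Matrix.of fun a b => ((⌊c₂ * n⌋ - ⌊c₁ * n⌋ : ℤ) : ℝ)⁻¹ *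
    ∑ t ∈ Finset.Ioc ⌊c₁ * n⌋ ⌊c₂ * n⌋, ∫ ω, z t ω a * z (t + h) ω b ∂μ

/-! ### The change point estimator -/

/-- The objective `∑_i ‖B̂_i' M̂_i(γ) B̂_i‖₂`, where `B̂_i` consists of the columns of `V i` after the
first `k i`. -/
def Ghat (n h₀ : ℕ) (k : Fin 2 → ℕ) (y : ℤ → Fin p → ℝ)
    (V : Fin 2 → Matrix (Fin p) (Fin p) ℝ) (γ : ℝ) : ℝ :=
  ∑ i, l2norm ((lastCols (k i) (V i))ᵀ * sampleM n h₀ y i γ * lastCols (k i) (V i))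

/-- The candidate break fractions `{0, 1/n, …, 1} ∩ (η₁, η₂)`. -/
def grid (n : ℕ) (η : Fin 2 → ℝ) : Set ℝ :=
  {γ | (∃ j : ℕ, j ≤ n ∧ γ = (j : ℝ) / n) ∧ γ ∈ Set.Ioo (η 0) (η 1)}

/-- `γ` minimises the objective over the candidates. -/
def IsBreakEstimate (n h₀ : ℕ) (k : Fin 2 → ℕ) (η : Fin 2 → ℝ) (y : ℤ → Fin p → ℝ)
    (V : Fin 2 → Matrix (Fin p) (Fin p) ℝ) (γ : ℝ) : Prop :=
  γ ∈ grid n η ∧ ∀ γ' ∈ grid n η, Ghat n h₀ k y V γ ≤ Ghat n h₀ k y V γ'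

/-! ### Mixing and noise -/

/-- The σ-field generated by `(x_{t,1}, x_{t,2})`, `t ∈ T`. -/
@[reducible] def sigmaX (x : ∀ i, ℤ → Ω → Fin (k i) → ℝ) (T : Set ℤ) : MeasurableSpace Ω :=
  ⨆ t ∈ T, ⨆ i, MeasurableSpace.comap (x i t) inferInstance

/-- The strong mixing coefficient `α(t)` of the factor process. -/
def alphaMix [MeasurableSpace Ω] (μ : Measure Ω) (x : ∀ i, ℤ → Ω → Fin (k i) → ℝ) (t : ℕ) : ℝ :=
  sSup {r : ℝ | ∃ (j : ℤ) (E F : Set Ω),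
    MeasurableSet[sigmaX x (Set.Iic j)] E ∧ MeasurableSet[sigmaX x (Set.Ici (j + t))] F ∧
      r = |μ.real (E ∩ F) - μ.real E * μ.real F|}

/-- The σ-field generated by the whole factor process and the noise before time `t`. -/
@[reducible] def noisePast (x : ∀ i, ℤ → Ω → Fin (k i) → ℝ) (ε : ℤ → Ω → Fin p → ℝ) (t : ℤ) :
    MeasurableSpace Ω :=
  sigmaX x Set.univ ⊔ ⨆ s ∈ Set.Iio t, MeasurableSpace.comap (ε s) inferInstance

/-- `(ε_t)` is white noise, uncorrelated with the factors, in the conditional sense: given the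
factor process and the past noise, `ε_t` has mean zero and variances at most `σ²`.
This holds in particular if the `ε_t` are independent with mean zero and variances at most `σ²`,
and independent of the factor process. -/
structure IsWhiteNoise [MeasurableSpace Ω] (μ : Measure Ω) (x : ∀ i, ℤ → Ω → Fin (k i) → ℝ)
    (ε : ℤ → Ω → Fin p → ℝ) (σ : ℝ) : Prop where
  measurable : ∀ t, Measurable (ε t)
  memLp : ∀ t a, MemLp (fun ω => ε t ω a) 2 μ
  mean : ∀ t a, μ[fun ω => ε t ω a | noisePast x ε t] =ᵐ[μ] 0
  variance : ∀ t a, μ[fun ω => ε t ω a ^ 2 | noisePast x ε t] ≤ᵐ[μ] fun _ => σ ^ 2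

end Model

/-- `X_m = O_p(a_m)`. -/
def IsBigOP {Ω : Type*} [MeasurableSpace Ω] (μ : Measure Ω) (X : ℕ → Ω → ℝ) (a : ℕ → ℝ) : Prop :=
  ∀ e : ℝ, 0 < e → ∃ C : ℝ, ∀ᶠ m in atTop, μ {ω | C * a m < |X m ω|} ≤ ENNReal.ofReal e

end CPFactor

end

/-! Write q_i = p^(1-δ_i) for the order of the squared singular values of A_i, and e = p/√n. At a
tentative break the lag-h sample autocovariance of regime i has the form S_h = A_i T_h A_i' + A_j
C_h A_j' + E_h, where j is the other regime, T_h and C_h are lagged sample moments of the factors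
over the correctly and the wrongly attributed times, and E_h = O(e) in operator norm collects the
noise and the few products that straddle the break (`FactorApprox`). The fluctuation of T_h and C_h
is not an error: A_i T_h A_i' has its range in the column space of A_i whatever T_h is. All that
matters is that some T_h is boundedly invertible, and that some C_h is bounded below by (cN - K)/n,
where N counts the wrongly attributed times.

Rate for a given break. If the contamination is O(e), then S_h' is O(e) on the kernel of A_i', which
has codimension at most k_i. By the min-max principle all eigenvalues of ∑ S_h S_h' after the first
k_i are O(e²), so S_h'w = O(e)|w| for every trailing direction w. Solving for A_i T_h' A_i'w gives
|A_i'w| = O(e/√q_i)|w|, and the sine of the angle between the estimated and the true loading space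
is O(e/q_i) = O(p^(δ_i) n^(-1/2)). No gap between the eigenvalues is needed
(`vnorm_transpose_le_on_trailing`, `spaceDist_le`). The same argument with error zero identifies the
space of Q_i with that of A_i.

Estimated break. The projections in the objective are computed at η_i, where regime i is
uncontaminated, so they nearly annihilate A_i and the objective at the true break is O(e²). At the
minimiser it is no larger, so the autocovariances there are also O(e) on these trailing directions.
The loading spaces are apart and the trailing space nearly is the orthogonal complement of that of
A_i (this is where p^(δ_max) n^(-1/2) → 0 enters), so some trailing w has |A_j'w| of order √q_j |w|.
Isolating A_j C_h' A_j'w yields N q_j = O(n e) (`exists_contamination_bound`). This says that the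
contamination is O(e), so the first argument applies at the estimated break without loss of rate.

Probability. Both ingredients must hold uniformly over the break. The noise is handled in Frobenius
norm by Doob's inequality (`exists_noise_bound`). The partial sums of factor products stay within κN
+ C of their means simultaneously for all N, with a fixed small slope κ and a tight constant C; this
follows from a covariance inequality under mixing and Chebyshev's inequality along the squares
(`covariance_le_rpow`, `exists_maximal_bound`). The slope is absorbed by the nonsingularity
constants. -/

noncomputable section

namespace CPFactor


/-! ### Euclidean norms of coordinate vectors -/

section VNorm

variable {ι κ : Type*} [Fintype ι] [Fintype κ]

/-- The Euclidean norm of a coordinate vector. -/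
def vnorm (v : ι → ℝ) : ℝ := ‖WithLp.toLp 2 v‖

lemma vnorm_nonneg (v : ι → ℝ) : 0 ≤ vnorm v := norm_nonneg _

lemma vnorm_sq (v : ι → ℝ) : vnorm v ^ 2 = v ⬝ᵥ v := by
  rw [vnorm, EuclideanSpace.norm_sq_eq]
  simp [dotProduct, sq]

lemma vnorm_sq_eq_sum (v : ι → ℝ) : vnorm v ^ 2 = ∑ i, v i ^ 2 := by
  rw [vnorm_sq]
  simp [dotProduct, sq]

lemma vnorm_add_le (v w : ι → ℝ) : vnorm (v + w) ≤ vnorm v + vnorm w := by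
  simpa [vnorm] using norm_add_le (WithLp.toLp 2 v) (WithLp.toLp 2 w)

lemma vnorm_sub_le (v w : ι → ℝ) : vnorm (v - w) ≤ vnorm v + vnorm w := by
  simpa [vnorm] using norm_sub_le (WithLp.toLp 2 v) (WithLp.toLp 2 w)

lemma vnorm_smul (c : ℝ) (v : ι → ℝ) : vnorm (c • v) = |c| * vnorm v := by
  simp [vnorm, norm_smul]

lemma vnorm_eq_zero {v : ι → ℝ} : vnorm v = 0 ↔ v = 0 := by
  simp [vnorm]

lemma vnorm_pos {v : ι → ℝ} (hv : v ≠ 0) : 0 < vnorm v :=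
  (vnorm_nonneg v).lt_of_ne' (mt vnorm_eq_zero.1 hv)

@[simp] lemma vnorm_zero : vnorm (0 : ι → ℝ) = 0 := by simp [vnorm]

lemma inner_toLp (v w : ι → ℝ) :
    inner ℝ (WithLp.toLp 2 v : EuclideanSpace ℝ ι) (WithLp.toLp 2 w) = v ⬝ᵥ w := by
  simp [PiLp.inner_apply, dotProduct, mul_comm]

lemma abs_dotProduct_le (v w : ι → ℝ) : |v ⬝ᵥ w| ≤ vnorm v * vnorm w := by
  rw [← inner_toLp]
  exact abs_real_inner_le_norm _ _

lemma dotProduct_le (v w : ι → ℝ) : v ⬝ᵥ w ≤ vnorm v * vnorm w :=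
  (le_abs_self _).trans (abs_dotProduct_le v w)

lemma mulVec_dotProduct (H : Matrix ι κ ℝ) (v : κ → ℝ) (w : ι → ℝ) :
    (H *ᵥ v) ⬝ᵥ w = v ⬝ᵥ (Hᵀ *ᵥ w) := by
  rw [dotProduct_comm, Matrix.dotProduct_mulVec, dotProduct_comm, Matrix.mulVec_transpose]

/-- An operator norm bound passes to the transpose. -/
lemma vnorm_transpose_mulVec_le {H : Matrix ι κ ℝ} {L : ℝ} (hL : 0 ≤ L)
    (hH : ∀ v, vnorm (H *ᵥ v) ≤ L * vnorm v) (w : ι → ℝ) :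
    vnorm (Hᵀ *ᵥ w) ≤ L * vnorm w := by
  rcases (vnorm_nonneg (Hᵀ *ᵥ w)).eq_or_lt with h | h
  · rw [← h]; exact mul_nonneg hL (vnorm_nonneg _)
  · have h1 : vnorm (Hᵀ *ᵥ w) ^ 2 ≤ L * vnorm (Hᵀ *ᵥ w) * vnorm w := by
      rw [vnorm_sq, ← mulVec_dotProduct]
      exact (dotProduct_le _ _).trans (mul_le_mul_of_nonneg_right (hH _) (vnorm_nonneg _))
    nlinarith

/-- A lower bound of a square matrix passes to the transpose. -/
lemma le_vnorm_transpose_mulVec [DecidableEq ι] {S : Matrix ι ι ℝ} {c : ℝ} (hc : 0 < c)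
    (hS : ∀ v, c * vnorm v ≤ vnorm (S *ᵥ v)) (w : ι → ℝ) :
    c * vnorm w ≤ vnorm (Sᵀ *ᵥ w) := by
  have hinj : Function.Injective (Matrix.toLin' S) := by
    rw [← LinearMap.ker_eq_bot, LinearMap.ker_eq_bot']
    intro v hv
    have := hS v
    rw [← Matrix.toLin'_apply, hv, vnorm_zero] at this
    have h0 : vnorm v ≤ 0 := by
      by_contra h; push Not at h; nlinarith
    exact vnorm_eq_zero.1 (le_antisymm h0 (vnorm_nonneg _))
  obtain ⟨v, rfl⟩ := LinearMap.injective_iff_surjective.1 hinj w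
  rw [Matrix.toLin'_apply]
  rcases (vnorm_nonneg (S *ᵥ v)).eq_or_lt with h | h
  · rw [← h, mul_zero]; exact vnorm_nonneg _
  · have h1 : vnorm (S *ᵥ v) ^ 2 ≤ vnorm v * vnorm (Sᵀ *ᵥ (S *ᵥ v)) := by
      rw [vnorm_sq, mulVec_dotProduct]; exact dotProduct_le _ _
    have h2 := hS v
    have h3 := vnorm_nonneg (Sᵀ *ᵥ (S *ᵥ v))
    have h4 : vnorm (S *ᵥ v) * (c * vnorm (S *ᵥ v)) ≤
        vnorm (S *ᵥ v) * vnorm (Sᵀ *ᵥ (S *ᵥ v)) := by nlinarith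
    exact le_of_mul_le_mul_left h4 h

/-- The spectral norm is at most the Frobenius norm. -/
lemma vnorm_mulVec_le_of_sum_sq {H : Matrix ι κ ℝ} {b : ℝ} (hb : 0 ≤ b)
    (hH : ∑ i, ∑ j, H i j ^ 2 ≤ b ^ 2) (v : κ → ℝ) : vnorm (H *ᵥ v) ≤ b * vnorm v := by
  refine le_of_sq_le_sq ?_ (mul_nonneg hb (vnorm_nonneg _))
  rw [vnorm_sq_eq_sum, mul_pow]
  calc ∑ i, (H *ᵥ v) i ^ 2 ≤ ∑ i, (∑ j, H i j ^ 2) * vnorm v ^ 2 := by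
        refine Finset.sum_le_sum fun i _ => ?_
        rw [vnorm_sq_eq_sum]
        exact Finset.sum_mul_sq_le_sq_mul_sq _ _ _
    _ = (∑ i, ∑ j, H i j ^ 2) * vnorm v ^ 2 := by rw [Finset.sum_mul]
    _ ≤ b ^ 2 * vnorm v ^ 2 := mul_le_mul_of_nonneg_right hH (sq_nonneg _)

/-- Entrywise bounds give operator norm bounds. -/
lemma vnorm_mulVec_le_of_abs_le {H : Matrix ι κ ℝ} {b : ℝ} (hb : 0 ≤ b)
    (hH : ∀ i j, |H i j| ≤ b) (v : κ → ℝ) :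
    vnorm (H *ᵥ v) ≤ (Fintype.card ι * Fintype.card κ) * b * vnorm v := by
  refine vnorm_mulVec_le_of_sum_sq (by positivity) ?_ v
  have h1 : ∑ i, ∑ j, H i j ^ 2 ≤ ∑ _i : ι, ∑ _j : κ, b ^ 2 :=
    Finset.sum_le_sum fun i _ => Finset.sum_le_sum fun j _ =>
      sq_le_sq' (abs_le.1 (hH i j)).1 (abs_le.1 (hH i j)).2
  refine h1.trans ?_
  simp only [Finset.sum_const, Finset.card_univ, nsmul_eq_mul]
  rw [mul_pow, ← mul_assoc]
  refine mul_le_mul_of_nonneg_right ?_ (sq_nonneg _)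
  have : ((Fintype.card ι * Fintype.card κ : ℕ) : ℝ) ≤ ((Fintype.card ι * Fintype.card κ : ℕ) : ℝ) ^ 2 := by
    exact_mod_cast Nat.le_self_pow two_ne_zero _
  exact_mod_cast this

lemma vnorm_mulVec_le_l2norm [DecidableEq ι] [DecidableEq κ] (H : Matrix ι κ ℝ) (v : κ → ℝ) :
    vnorm (H *ᵥ v) ≤ l2norm H * vnorm v := by
  simpa [vnorm, l2norm] using
    (Matrix.toEuclideanLin H).toContinuousLinearMap.le_opNorm (WithLp.toLp 2 v)

lemma l2norm_nonneg [DecidableEq ι] [DecidableEq κ] (H : Matrix ι κ ℝ) : 0 ≤ l2norm H :=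
  norm_nonneg _

lemma l2norm_le [DecidableEq ι] [DecidableEq κ] {H : Matrix ι κ ℝ} {b : ℝ} (hb : 0 ≤ b)
    (h : ∀ v, vnorm (H *ᵥ v) ≤ b * vnorm v) : l2norm H ≤ b := by
  refine ContinuousLinearMap.opNorm_le_bound _ hb fun v => ?_
  exact h v.ofLp

lemma minNorm_nonneg [DecidableEq κ] (H : Matrix ι κ ℝ) : 0 ≤ minNorm H := Real.sqrt_nonneg _

/-- For a matrix with trivial kernel, `‖H‖_min` bounds `H` from below. -/
lemma minNorm_mul_vnorm_le [DecidableEq κ] {H : Matrix ι κ ℝ}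
    (hinj : ∀ v, H *ᵥ v = 0 → v = 0) (v : κ → ℝ) : minNorm H * vnorm v ≤ vnorm (H *ᵥ v) := by
  set E : Set ℝ := {l : ℝ | l ≠ 0 ∧ Module.End.HasEigenvalue (Matrix.toLin' (Hᵀ * H)) l} with hE
  have hquad : ∀ v, v ⬝ᵥ ((Hᵀ * H) *ᵥ v) = vnorm (H *ᵥ v) ^ 2 := fun v => by
    rw [vnorm_sq, mulVec_dotProduct, Matrix.mulVec_mulVec]
  have heig : ∀ l, Module.End.HasEigenvalue (Matrix.toLin' (Hᵀ * H)) l → 0 < l := by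
    intro l hl
    obtain ⟨u, hu⟩ := hl.exists_hasEigenvector
    have h1 := hu.apply_eq_smul
    rw [Matrix.toLin'_apply] at h1
    have h2 := hquad u
    rw [h1, dotProduct_smul, ← vnorm_sq, smul_eq_mul] at h2
    have h3 : 0 < vnorm u := vnorm_pos hu.2
    have h4 : 0 < vnorm (H *ᵥ u) := vnorm_pos (mt (hinj u) hu.2)
    by_contra h; push Not at h
    nlinarith [sq_nonneg (vnorm u), pow_pos h4 2]
  have hbdd : BddBelow E := ⟨0, fun l hl => (heig l hl.2).le⟩
  -- Since `H` has trivial kernel, every eigenvalue of `Hᵀ * H` is nonzero, hence lies in `E` and is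
  -- at least its infimum. Subtracting the infimum therefore leaves a positive semidefinite matrix.
  have hherm : (Hᵀ * H - (sInf E) • (1 : Matrix κ κ ℝ)).IsHermitian := by
    refine Matrix.IsHermitian.sub ?_ ?_
    · simpa using Matrix.isHermitian_conjTranspose_mul_self H
    · exact Matrix.IsHermitian.ext fun i j => by simp [Matrix.one_apply, eq_comm]
  have hpsd : (Hᵀ * H - (sInf E) • (1 : Matrix κ κ ℝ)).PosSemidef := by
    rw [hherm.posSemidef_iff_eigenvalues_nonneg]
    intro i
    have hvec := hherm.mulVec_eigenvectorBasis i
    set u := (hherm.eigenvectorBasis i).ofLp with hu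
    have hu0 : u ≠ 0 := by
      intro h0
      have : ‖hherm.eigenvectorBasis i‖ = 1 := hherm.eigenvectorBasis.orthonormal.1 i
      have h' : hherm.eigenvectorBasis i = 0 := by ext j; exact congrFun h0 j
      simp [h'] at this
    have h1 : (Hᵀ * H) *ᵥ u = (hherm.eigenvalues i + sInf E) • u := by
      rw [Matrix.sub_mulVec, Matrix.smul_mulVec, Matrix.one_mulVec, sub_eq_iff_eq_add] at hvec
      rw [hvec, add_smul]
    have h2 : Module.End.HasEigenvalue (Matrix.toLin' (Hᵀ * H)) (hherm.eigenvalues i + sInf E) :=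
      Module.End.hasEigenvalue_of_hasEigenvector
        (Module.End.hasEigenvector_iff.2 ⟨Module.End.mem_eigenspace_iff.2 (by
          rw [Matrix.toLin'_apply, h1]), hu0⟩)
    have h3 : sInf E ≤ hherm.eigenvalues i + sInf E := csInf_le hbdd ⟨(heig _ h2).ne', h2⟩
    simpa using h3
  have h0 : 0 ≤ sInf E := Real.sInf_nonneg fun l hl => (heig l hl.2).le
  refine le_of_sq_le_sq ?_ (vnorm_nonneg _)
  have h1 := hpsd.dotProduct_mulVec_nonneg v
  rw [Matrix.sub_mulVec, dotProduct_sub, star_trivial, hquad, Matrix.smul_mulVec,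
    Matrix.one_mulVec, dotProduct_smul, ← vnorm_sq, smul_eq_mul] at h1
  rw [mul_pow, minNorm, Real.sq_sqrt h0]
  linarith

/-- A square matrix of full rank is bounded from below by `‖S‖_min`. -/
lemma minNorm_mul_vnorm_le_of_rank {k : ℕ} {S : Matrix (Fin k) (Fin k) ℝ} (hS : S.rank = k)
    (v : Fin k → ℝ) : minNorm S * vnorm v ≤ vnorm (S *ᵥ v) := by
  refine minNorm_mul_vnorm_le ?_ v
  have h1 : Module.finrank ℝ (LinearMap.range S.mulVecLin) = k := hS
  have h2 := LinearMap.finrank_range_add_finrank_ker S.mulVecLin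
  rw [h1, Module.finrank_fin_fun] at h2
  have h3 : LinearMap.ker S.mulVecLin = ⊥ := Submodule.finrank_eq_zero.1 (by omega)
  intro w hw
  exact LinearMap.ker_eq_bot'.1 h3 w hw

end VNorm


/-! ### Trailing eigenvectors of a perturbed low-rank matrix -/

section Spectral

variable {p k h₀ : ℕ} {M V : Matrix (Fin p) (Fin p) ℝ}

lemma firstCols_transpose_mulVec_apply (w : Fin p → ℝ) (j : {j : Fin p // (j : ℕ) < k}) :
    ((firstCols k V)ᵀ *ᵥ w) j = (Vᵀ *ᵥ w) j := rfl

lemma vnorm_mulVec_of_orthogonal (hV : Vᵀ * V = 1) (c : Fin p → ℝ) :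
    vnorm (V *ᵥ c) = vnorm c := by
  have h : vnorm (V *ᵥ c) ^ 2 = vnorm c ^ 2 := by
    rw [vnorm_sq, mulVec_dotProduct, Matrix.mulVec_mulVec, hV, Matrix.one_mulVec, vnorm_sq]
  exact (pow_left_inj₀ (vnorm_nonneg _) (vnorm_nonneg _) two_ne_zero).1 h

lemma quadForm_eigen {l : Fin p → ℝ} (hV : Vᵀ * V = 1) (hMV : M * V = V * Matrix.diagonal l)
    (c : Fin p → ℝ) : (V *ᵥ c) ⬝ᵥ (M *ᵥ (V *ᵥ c)) = ∑ j, l j * c j ^ 2 := by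
  rw [Matrix.mulVec_mulVec, hMV, ← Matrix.mulVec_mulVec, mulVec_dotProduct, Matrix.mulVec_mulVec,
    hV, Matrix.one_mulVec]
  refine Finset.sum_congr rfl fun j _ => ?_
  rw [Matrix.mulVec_diagonal]; ring

lemma quadForm_sum (S : ℕ → Matrix (Fin p) (Fin p) ℝ) (w : Fin p → ℝ) :
    w ⬝ᵥ ((∑ h ∈ Finset.Icc 1 h₀, S h * (S h)ᵀ) *ᵥ w) =
      ∑ h ∈ Finset.Icc 1 h₀, vnorm ((S h)ᵀ *ᵥ w) ^ 2 := by
  rw [Matrix.sum_mulVec, dotProduct_sum]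
  refine Finset.sum_congr rfl fun h _ => ?_
  rw [← Matrix.mulVec_mulVec, dotProduct_comm, mulVec_dotProduct, vnorm_sq]

/-- If the factors of `∑ S_h S_h'` are small on the kernel of `A'`, where `A` has `k` columns, then
they are small on the span of all but the `k` leading eigenvectors. -/
lemma vnorm_le_on_trailing (hV : IsEigenSystem M V) {S : ℕ → Matrix (Fin p) (Fin p) ℝ}
    (hM : M = ∑ h ∈ Finset.Icc 1 h₀, S h * (S h)ᵀ) (A : Matrix (Fin p) (Fin k) ℝ) {e : ℝ}
    (he0 : 0 ≤ e)
    (he : ∀ h ∈ Finset.Icc 1 h₀, ∀ v, Aᵀ *ᵥ v = 0 → vnorm ((S h)ᵀ *ᵥ v) ≤ e * vnorm v)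
    {w : Fin p → ℝ} (hw : (firstCols k V)ᵀ *ᵥ w = 0) {h : ℕ} (hh : h ∈ Finset.Icc 1 h₀) :
    vnorm ((S h)ᵀ *ᵥ w) ≤ h₀ * e * vnorm w := by
  obtain ⟨l, hl, hVV, hMV⟩ := hV
  set c := Vᵀ *ᵥ w with hc
  have hwc : w = V *ᵥ c := by
    rw [hc, Matrix.mulVec_mulVec, mul_eq_one_comm.1 hVV, Matrix.one_mulVec]
  have hck : ∀ j : Fin p, (j : ℕ) < k → c j = 0 := fun j hj => by
    have := congrFun hw ⟨j, hj⟩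
    rwa [firstCols_transpose_mulVec_apply] at this
  have hwn : vnorm w = vnorm c := by rw [hwc, vnorm_mulVec_of_orthogonal hVV]
  have hquad : ∀ v, v ⬝ᵥ (M *ᵥ v) = ∑ h ∈ Finset.Icc 1 h₀, vnorm ((S h)ᵀ *ᵥ v) ^ 2 := by
    intro v; rw [hM, quadForm_sum]
  rcases le_or_gt p k with hpk | hpk
  · have : c = 0 := funext fun j => hck j (j.2.trans_le hpk)
    have hw0 : w = 0 := by rw [hwc, this, Matrix.mulVec_zero]
    simp [hw0]
  have hlk : l ⟨k, hpk⟩ ≤ h₀ * e ^ 2 := by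
    -- a nonzero combination of the first `k + 1` eigenvectors in the kernel of `A'`
    let emb : Fin (k + 1) → Fin p := fun j => ⟨j, by omega⟩
    let B : Matrix (Fin k) (Fin (k + 1)) ℝ := (Aᵀ * V).submatrix id emb
    have hker : LinearMap.ker (Matrix.mulVecLin B) ≠ ⊥ :=
      LinearMap.ker_ne_bot_of_finrank_lt (by simp)
    obtain ⟨z, hz, hz0⟩ := (Submodule.ne_bot_iff _).1 hker
    have hz' : B *ᵥ z = 0 := hz
    -- The kernel vector `z` is padded with zeros to a coefficient vector for the full eigenbasis.
    obtain ⟨b, hbz, hbn⟩ : ∃ b : Fin p → ℝ, (∀ j, b (emb j) = z j) ∧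
        ∀ j : Fin p, ¬ (j : ℕ) < k + 1 → b j = 0 :=
      ⟨fun j => if hj : (j : ℕ) < k + 1 then z ⟨j, hj⟩ else 0, fun j => dif_pos j.2,
        fun j hj => dif_neg hj⟩
    have hsum : ∀ f : Fin p → ℝ, ∑ j, f j * b j = ∑ j : Fin (k + 1), f (emb j) * z j := by
      intro f
      have hinj : Function.Injective emb := fun i j hij => by
        have := congrArg Fin.val hij; exact Fin.ext this
      rw [← Finset.sum_subset (Finset.subset_univ (Finset.univ.map ⟨emb, hinj⟩))]
      · rw [Finset.sum_map]
        refine Finset.sum_congr rfl fun j _ => ?_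
        simp [hbz]
      · intro j _ hj
        have : ¬ (j : ℕ) < k + 1 := fun h' => hj (by
          rw [Finset.mem_map]; exact ⟨⟨j, h'⟩, Finset.mem_univ _, rfl⟩)
        simp [hbn j this]
    have hb0 : b ≠ 0 := by
      intro h0
      refine hz0 (funext fun j => ?_)
      have := congrFun h0 (emb j)
      simpa [hbz] using this
    have hAb : Aᵀ *ᵥ (V *ᵥ b) = 0 := by
      rw [Matrix.mulVec_mulVec]
      funext i
      have := congrFun hz' i
      simp only [Matrix.mulVec, dotProduct] at this ⊢
      rw [hsum]; exact this
    have h1 := quadForm_eigen hVV hMV b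
    rw [hquad] at h1
    have h2 : ∑ h ∈ Finset.Icc 1 h₀, vnorm ((S h)ᵀ *ᵥ (V *ᵥ b)) ^ 2 ≤
        ∑ h ∈ Finset.Icc 1 h₀, (e * vnorm b) ^ 2 := by
      refine Finset.sum_le_sum fun h hh => pow_le_pow_left₀ (vnorm_nonneg _) ?_ 2
      rw [← vnorm_mulVec_of_orthogonal hVV b]
      exact he h hh _ hAb
    have h3 : l ⟨k, hpk⟩ * vnorm b ^ 2 ≤ ∑ j, l j * b j ^ 2 := by
      rw [vnorm_sq_eq_sum, Finset.mul_sum]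
      refine Finset.sum_le_sum fun j _ => ?_
      by_cases hj : (j : ℕ) < k + 1
      · exact mul_le_mul_of_nonneg_right (hl (by simp [Fin.le_def]; omega)) (sq_nonneg _)
      · simp [hbn j hj]
    rw [Finset.sum_const, Nat.card_Icc, nsmul_eq_mul, Nat.add_sub_cancel] at h2
    have h4 : 0 < vnorm b ^ 2 := pow_pos (vnorm_pos hb0) 2
    have h5 : l ⟨k, hpk⟩ * vnorm b ^ 2 ≤ h₀ * e ^ 2 * vnorm b ^ 2 := by linarith
    exact le_of_mul_le_mul_right h5 h4
  have h1 := quadForm_eigen hVV hMV c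
  rw [← hwc, hquad] at h1
  have h2 : ∑ j, l j * c j ^ 2 ≤ h₀ * e ^ 2 * vnorm c ^ 2 := by
    rw [vnorm_sq_eq_sum, Finset.mul_sum]
    refine Finset.sum_le_sum fun j _ => ?_
    by_cases hj : (j : ℕ) < k
    · simp [hck j hj]
    · exact mul_le_mul_of_nonneg_right ((hl (by simp [Fin.le_def]; omega)).trans hlk)
        (sq_nonneg _)
  have h3 : vnorm ((S h)ᵀ *ᵥ w) ^ 2 ≤ ∑ h ∈ Finset.Icc 1 h₀, vnorm ((S h)ᵀ *ᵥ w) ^ 2 :=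
    Finset.single_le_sum (f := fun h => vnorm ((S h)ᵀ *ᵥ w) ^ 2) (fun _ _ => sq_nonneg _) hh
  refine le_of_sq_le_sq ?_ (by have := vnorm_nonneg w; positivity)
  -- The eigenvalue bound gives the factor `√h₀`. The lag `h` witnesses `h₀ ≥ 1`, so `√h₀ ≤ h₀`.
  have h4 : (1 : ℝ) ≤ h₀ := by
    have := Finset.mem_Icc.1 hh
    exact_mod_cast this.1.trans this.2
  calc vnorm ((S h)ᵀ *ᵥ w) ^ 2 ≤ h₀ * e ^ 2 * vnorm w ^ 2 := by rw [hwn]; linarith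
    _ ≤ (h₀ * e * vnorm w) ^ 2 := by
      have : 0 ≤ (h₀ : ℝ) * ((h₀ : ℝ) - 1) * (e * vnorm w) ^ 2 :=
        mul_nonneg (mul_nonneg (by linarith) (by linarith)) (sq_nonneg _)
      nlinarith

/-- The trailing eigenvectors of `∑ S_h S_h'` are nearly orthogonal to the columns of `A` if
`S_h` is close to `A T_h A'`. -/
lemma vnorm_transpose_le_on_trailing (hV : IsEigenSystem M V)
    {S : ℕ → Matrix (Fin p) (Fin p) ℝ} (hM : M = ∑ h ∈ Finset.Icc 1 h₀, S h * (S h)ᵀ)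
    {A : Matrix (Fin p) (Fin k) ℝ} {T : ℕ → Matrix (Fin k) (Fin k) ℝ} {a c e : ℝ}
    (ha : 0 ≤ a) (he0 : 0 ≤ e)
    (hA : ∀ v, a * vnorm v ≤ vnorm (A *ᵥ v))
    (hT : ∃ h ∈ Finset.Icc 1 h₀, ∀ v, c * vnorm v ≤ vnorm ((T h)ᵀ *ᵥ v))
    (he : ∀ h ∈ Finset.Icc 1 h₀, ∀ v, vnorm ((S h - A * T h * Aᵀ)ᵀ *ᵥ v) ≤ e * vnorm v)
    {w : Fin p → ℝ} (hw : (firstCols k V)ᵀ *ᵥ w = 0) :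
    a * c * vnorm (Aᵀ *ᵥ w) ≤ (h₀ + 1) * e * vnorm w := by
  have hdec : ∀ h v, (S h)ᵀ *ᵥ v = A *ᵥ ((T h)ᵀ *ᵥ (Aᵀ *ᵥ v)) + (S h - A * T h * Aᵀ)ᵀ *ᵥ v := by
    intro h v
    rw [Matrix.transpose_sub, Matrix.sub_mulVec, Matrix.transpose_mul, Matrix.transpose_mul,
      Matrix.transpose_transpose, ← Matrix.mulVec_mulVec, ← Matrix.mulVec_mulVec]
    abel
  obtain ⟨h, hh, hTh⟩ := hT
  have h1 := vnorm_le_on_trailing hV hM A he0 (fun h hh v hv => by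
    rw [hdec, hv, Matrix.mulVec_zero, Matrix.mulVec_zero, zero_add]; exact he h hh v) hw hh
  have h2 : A *ᵥ ((T h)ᵀ *ᵥ (Aᵀ *ᵥ w)) = (S h)ᵀ *ᵥ w - (S h - A * T h * Aᵀ)ᵀ *ᵥ w := by
    rw [hdec h w]; abel
  have h3 := hA ((T h)ᵀ *ᵥ (Aᵀ *ᵥ w))
  rw [h2] at h3
  calc a * c * vnorm (Aᵀ *ᵥ w) = a * (c * vnorm (Aᵀ *ᵥ w)) := mul_assoc _ _ _
    _ ≤ a * vnorm ((T h)ᵀ *ᵥ (Aᵀ *ᵥ w)) := mul_le_mul_of_nonneg_left (hTh _) ha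
    _ ≤ vnorm ((S h)ᵀ *ᵥ w) + vnorm ((S h - A * T h * Aᵀ)ᵀ *ᵥ w) := h3.trans (vnorm_sub_le _ _)
    _ ≤ h₀ * e * vnorm w + e * vnorm w := add_le_add h1 (he h hh w)
    _ = (h₀ + 1) * e * vnorm w := by ring

end Spectral


/-! ### The distance between subspaces -/

section SpaceDist

variable {ι : Type*} [Fintype ι]

local notation "⟪" x ", " y "⟫" => inner ℝ x y

/-- Cyclicity moves the projection onto `T` to the front, so the trace can be computed in an
orthonormal basis of `T`; each diagonal entry is a squared norm because the projection onto `S` is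
self-adjoint and idempotent. -/
lemma trace_starProjection_comp {κ : Type*} [Fintype κ] (S T : Submodule ℝ (EuclideanSpace ℝ ι))
    (t : OrthonormalBasis κ ℝ T) :
    LinearMap.trace ℝ (EuclideanSpace ℝ ι)
        (S.starProjection.toLinearMap ∘ₗ T.starProjection.toLinearMap) =
      ∑ l, ‖S.starProjection (t l)‖ ^ 2 := by
  have h1 : S.starProjection.toLinearMap ∘ₗ T.starProjection.toLinearMap =
      (S.starProjection.toLinearMap ∘ₗ T.subtype) ∘ₗ T.orthogonalProjectionOnto.toLinearMap := by
    ext v; simp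
  rw [h1, LinearMap.trace_comp_comm', LinearMap.trace_eq_sum_inner _ t]
  refine Finset.sum_congr rfl fun l _ => ?_
  simp only [LinearMap.comp_apply, Submodule.subtype_apply, ContinuousLinearMap.coe_coe]
  rw [Submodule.inner_orthogonalProjectionOnto_eq_of_mem_left, ← real_inner_self_eq_norm_sq,
    Submodule.inner_starProjection_left_eq_right,
    Submodule.starProjection_eq_self_iff.2 (Submodule.starProjection_apply_mem _ _)]

lemma norm_sq_starProjection_add (S : Submodule ℝ (EuclideanSpace ℝ ι))
    (x : EuclideanSpace ℝ ι) :
    ‖S.starProjection x‖ ^ 2 + ‖x - S.starProjection x‖ ^ 2 = ‖x‖ ^ 2 := by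
  have h : ⟪S.starProjection x, x - S.starProjection x⟫ = 0 :=
    Submodule.inner_right_of_mem_orthogonal (Submodule.starProjection_apply_mem _ _)
      (S.sub_starProjection_mem_orthogonal x)
  have := norm_add_sq_real (S.starProjection x) (x - S.starProjection x)
  rw [h, add_sub_cancel] at this
  linarith

lemma inner_sub_starProjection (S : Submodule ℝ (EuclideanSpace ℝ ι))
    (x : EuclideanSpace ℝ ι) :
    ⟪x, x - S.starProjection x⟫ = ‖x - S.starProjection x‖ ^ 2 := by
  have h : ⟪S.starProjection x, x - S.starProjection x⟫ = 0 :=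
    Submodule.inner_right_of_mem_orthogonal (Submodule.starProjection_apply_mem _ _)
      (S.sub_starProjection_mem_orthogonal x)
  rw [← real_inner_self_eq_norm_sq, inner_sub_left _ _ (x - S.starProjection x), h, sub_zero]

/-- If `T` is nearly orthogonal to `Sᗮ`, its vectors are close to `S`. -/
lemma norm_sub_starProjection_le {S T : Submodule ℝ (EuclideanSpace ℝ ι)} {ϵ : ℝ}
    (hϵ : 0 ≤ ϵ) (h : ∀ t ∈ T, ∀ w ∈ Sᗮ, ⟪t, w⟫ ≤ ϵ * ‖t‖ * ‖w‖) {t : EuclideanSpace ℝ ι}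
    (ht : t ∈ T) : ‖t - S.starProjection t‖ ≤ ϵ * ‖t‖ := by
  have h1 := h t ht _ (S.sub_starProjection_mem_orthogonal t)
  rw [inner_sub_starProjection] at h1
  rcases (norm_nonneg (t - S.starProjection t)).eq_or_lt with h0 | h0
  · rw [← h0]; positivity
  · nlinarith

/-- A unit vector of `T` has a residual of norm at most `ϵ` from `S`, so by Pythagoras its
projection keeps at least `1 - ϵ ^ 2`. This is summed over an orthonormal basis of `T`. -/
lemma trace_starProjection_comp_ge {S T : Submodule ℝ (EuclideanSpace ℝ ι)} {ϵ : ℝ}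
    (hϵ : 0 ≤ ϵ) (h : ∀ t ∈ T, ∀ w ∈ Sᗮ, ⟪t, w⟫ ≤ ϵ * ‖t‖ * ‖w‖) :
    Module.finrank ℝ T * (1 - ϵ ^ 2) ≤ LinearMap.trace ℝ (EuclideanSpace ℝ ι)
        (S.starProjection.toLinearMap ∘ₗ T.starProjection.toLinearMap) := by
  set t := stdOrthonormalBasis ℝ T
  rw [trace_starProjection_comp S T t]
  have : ∀ l, 1 - ϵ ^ 2 ≤ ‖S.starProjection (t l)‖ ^ 2 := fun l => by
    have hn : ‖(t l : EuclideanSpace ℝ ι)‖ = 1 := t.orthonormal.1 l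
    have h1 := norm_sub_starProjection_le hϵ h (t l).2
    have h2 := norm_sq_starProjection_add S (t l : EuclideanSpace ℝ ι)
    rw [hn] at h1 h2
    nlinarith [norm_nonneg ((t l : EuclideanSpace ℝ ι) - S.starProjection (t l))]
  calc (Module.finrank ℝ T : ℝ) * (1 - ϵ ^ 2) = ∑ _l : Fin (Module.finrank ℝ T), (1 - ϵ ^ 2) := by
        rw [Finset.sum_const, Finset.card_univ, Fintype.card_fin, nsmul_eq_mul]
    _ ≤ _ := Finset.sum_le_sum fun l _ => this l

lemma trace_starProjection_comm (S T : Submodule ℝ (EuclideanSpace ℝ ι)) :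
    LinearMap.trace ℝ (EuclideanSpace ℝ ι)
        (S.starProjection.toLinearMap ∘ₗ T.starProjection.toLinearMap) =
      LinearMap.trace ℝ (EuclideanSpace ℝ ι)
        (T.starProjection.toLinearMap ∘ₗ S.starProjection.toLinearMap) :=
  LinearMap.trace_comp_comm' _ _

lemma spaceDist_comm (S T : Submodule ℝ (EuclideanSpace ℝ ι)) : spaceDist S T = spaceDist T S := by
  rw [spaceDist, spaceDist, trace_starProjection_comm, min_comm]

lemma spaceDist_nonneg (S T : Submodule ℝ (EuclideanSpace ℝ ι)) : 0 ≤ spaceDist S T :=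
  Real.sqrt_nonneg _

/-- The distance of two spaces of the same dimension is at most the sine of their angle. -/
lemma spaceDist_le {S T : Submodule ℝ (EuclideanSpace ℝ ι)} {k : ℕ} (hk : 0 < k)
    (hS : Module.finrank ℝ S = k) (hT : Module.finrank ℝ T = k) {ϵ : ℝ} (hϵ : 0 ≤ ϵ)
    (h : ∀ t ∈ T, ∀ w ∈ Sᗮ, ⟪t, w⟫ ≤ ϵ * ‖t‖ * ‖w‖) : spaceDist S T ≤ ϵ := by
  have h1 := trace_starProjection_comp_ge hϵ h
  rw [spaceDist, hS, hT, min_self, Real.sqrt_le_left hϵ]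
  rw [hT] at h1
  have hk' : (0 : ℝ) < k := by exact_mod_cast hk
  have : 1 - ϵ ^ 2 ≤ LinearMap.trace ℝ (EuclideanSpace ℝ ι)
        (S.starProjection.toLinearMap ∘ₗ T.starProjection.toLinearMap) / k := by
    rw [le_div_iff₀ hk']; linarith
  linarith

/-- If `U` and `T` are apart and `S` is close to `T`, some direction in `Sᗮ` has a sizeable
component in `U`. -/
lemma exists_orthogonal_of_lt_spaceDist {S T U : Submodule ℝ (EuclideanSpace ℝ ι)} {d ϵ : ℝ}
    (hd : 0 < d) (hϵ : 0 ≤ ϵ) (hST : Module.finrank ℝ S = Module.finrank ℝ T)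
    (hT : 0 < Module.finrank ℝ T) (hU : 0 < Module.finrank ℝ U)
    (h : ∀ t ∈ T, ∀ w ∈ Sᗮ, ⟪t, w⟫ ≤ ϵ * ‖t‖ * ‖w‖)
    (hdist : d < spaceDist U T) (hsmall : (Module.finrank ℝ T + 1) * ϵ ≤ d / 2) :
    ∃ q ∈ U, ∃ w ∈ Sᗮ, ‖q‖ = 1 ∧ w ≠ 0 ∧ d / 2 * ‖w‖ ≤ ⟪q, w⟫ := by
  set u := stdOrthonormalBasis ℝ U
  have hmin : (0 : ℝ) < (min (Module.finrank ℝ U) (Module.finrank ℝ T) : ℕ) := by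
    exact_mod_cast lt_min hU hT
  rw [spaceDist, trace_starProjection_comm, trace_starProjection_comp T U u,
    Real.lt_sqrt hd.le] at hdist
  -- Averaging: were all squared projections at least `1 - d ^ 2`, the trace divided by the smaller
  -- dimension would be too. For `d ≥ 1` that argument says nothing, but nonnegativity of the trace
  -- already contradicts the distance bound.
  obtain ⟨l, hl⟩ : ∃ l, ‖T.starProjection (u l)‖ ^ 2 < 1 - d ^ 2 := by
    by_contra hcon
    push Not at hcon
    rcases le_total (1 - d ^ 2) 0 with h0 | h0
    · have : 0 ≤ (∑ l, ‖T.starProjection (u l)‖ ^ 2) /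
          (min (Module.finrank ℝ U) (Module.finrank ℝ T) : ℕ) := by positivity
      linarith
    · have h1 : (Module.finrank ℝ U : ℝ) * (1 - d ^ 2) ≤ ∑ l, ‖T.starProjection (u l)‖ ^ 2 := by
        calc (Module.finrank ℝ U : ℝ) * (1 - d ^ 2)
            = ∑ _l : Fin (Module.finrank ℝ U), (1 - d ^ 2) := by
              rw [Finset.sum_const, Finset.card_univ, Fintype.card_fin, nsmul_eq_mul]
          _ ≤ _ := Finset.sum_le_sum fun l _ => hcon l
      have h2 : ((min (Module.finrank ℝ U) (Module.finrank ℝ T) : ℕ) : ℝ) ≤ Module.finrank ℝ U := by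
        exact_mod_cast min_le_left _ _
      have h3 : 1 - d ^ 2 ≤ (∑ l, ‖T.starProjection (u l)‖ ^ 2) /
          (min (Module.finrank ℝ U) (Module.finrank ℝ T) : ℕ) := by
        rw [le_div_iff₀ hmin]; nlinarith
      linarith
  set q : EuclideanSpace ℝ ι := (u l : EuclideanSpace ℝ ι) with hq
  have hqn : ‖q‖ = 1 := u.orthonormal.1 l
  set r := q - T.starProjection q with hr
  have hr2 := norm_sq_starProjection_add T q
  rw [← hr, hqn] at hr2
  have hrd : d < ‖r‖ := lt_of_pow_lt_pow_left₀ 2 (norm_nonneg _) (by linarith)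
  have hr1 : ‖r‖ ≤ 1 := by
    refine le_of_sq_le_sq ?_ zero_le_one
    nlinarith [sq_nonneg ‖T.starProjection q‖]
  have hTq : ‖T.starProjection q‖ ≤ 1 := by
    refine le_of_sq_le_sq ?_ zero_le_one
    nlinarith [sq_nonneg ‖r‖]
  -- `S` has only a small component orthogonal to `T`
  set f := stdOrthonormalBasis ℝ S
  have hk1 : (1 : ℝ) ≤ Module.finrank ℝ T := by exact_mod_cast hT
  have hSr : ‖S.starProjection r‖ ≤ Module.finrank ℝ T * ϵ := by
    have h1 : ‖S.starProjection r‖ ^ 2 = ∑ l, ⟪(f l : EuclideanSpace ℝ ι), r⟫ ^ 2 := by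
      rw [Submodule.starProjection_apply, Submodule.norm_coe, ← f.sum_sq_norm_inner_right]
      refine Finset.sum_congr rfl fun l _ => ?_
      rw [Real.norm_eq_abs, sq_abs, Submodule.inner_orthogonalProjectionOnto_eq_of_mem_left]
    have h2 : ∀ l, ⟪(f l : EuclideanSpace ℝ ι), r⟫ ^ 2 ≤
        1 - ‖T.starProjection (f l)‖ ^ 2 := fun l => by
      have hn : ‖(f l : EuclideanSpace ℝ ι)‖ = 1 := f.orthonormal.1 l
      have h3 := norm_sq_starProjection_add T (f l : EuclideanSpace ℝ ι)
      rw [hn] at h3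
      have h4 : ⟪T.starProjection (f l : EuclideanSpace ℝ ι), r⟫ = 0 :=
        Submodule.inner_right_of_mem_orthogonal (Submodule.starProjection_apply_mem _ _)
          (T.sub_starProjection_mem_orthogonal q)
      have h5 : ⟪(f l : EuclideanSpace ℝ ι), r⟫ =
          ⟪(f l : EuclideanSpace ℝ ι) - T.starProjection (f l), r⟫ := by
        rw [inner_sub_left, h4, sub_zero]
      have h6 := abs_real_inner_le_norm ((f l : EuclideanSpace ℝ ι) - T.starProjection (f l)) r
      rw [← h5] at h6
      have h7 : |⟪(f l : EuclideanSpace ℝ ι), r⟫| ≤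
          ‖(f l : EuclideanSpace ℝ ι) - T.starProjection (f l)‖ :=
        h6.trans (mul_le_of_le_one_right (norm_nonneg _) hr1)
      rw [← sq_abs]
      nlinarith [abs_nonneg ⟪(f l : EuclideanSpace ℝ ι), r⟫]
    -- The hypothesis says that `T` is close to `S`. Equality of dimensions makes this symmetric:
    -- the same trace bounds the total residual of a basis of `S` from `T`.
    have h3 := trace_starProjection_comp_ge hϵ h
    rw [trace_starProjection_comm, trace_starProjection_comp T S f] at h3
    have h4 : ‖S.starProjection r‖ ^ 2 ≤ Module.finrank ℝ T * ϵ ^ 2 := by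
      calc ‖S.starProjection r‖ ^ 2 ≤ ∑ l, (1 - ‖T.starProjection (f l)‖ ^ 2) := by
            rw [h1]; exact Finset.sum_le_sum fun l _ => h2 l
        _ = Module.finrank ℝ T - ∑ l, ‖T.starProjection (f l)‖ ^ 2 := by
            rw [Finset.sum_sub_distrib]; simp [hST]
        _ ≤ _ := by linarith
    refine le_of_sq_le_sq ?_ (by positivity)
    nlinarith [mul_nonneg (sub_nonneg.2 hk1) (mul_nonneg (zero_le_one.trans hk1) (sq_nonneg ϵ))]
  set w := q - S.starProjection q with hw
  -- Here `r` minus its projection onto `S` equals `w` up to the residual of a vector of `T`, which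
  -- has norm at most `ϵ`. So `‖w‖` falls short of `‖r‖ > d` by at most `(dim T + 1) * ϵ`.
  have hwdec : r = S.starProjection r + (w - (T.starProjection q -
      S.starProjection (T.starProjection q))) := by
    rw [hw, hr, map_sub]; abel
  have hTw : ‖T.starProjection q - S.starProjection (T.starProjection q)‖ ≤ ϵ :=
    (norm_sub_starProjection_le hϵ h (Submodule.starProjection_apply_mem _ _)).trans
      (mul_le_of_le_one_right hϵ hTq)
  have hrw : ‖r‖ ≤ ‖S.starProjection r‖ + (‖w‖ + ‖T.starProjection q -
      S.starProjection (T.starProjection q)‖) := by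
    conv_lhs => rw [hwdec]
    exact (norm_add_le _ _).trans (add_le_add_right (norm_sub_le _ _) _)
  have hwd : d / 2 ≤ ‖w‖ := by linarith
  refine ⟨q, (u l).2, w, S.sub_starProjection_mem_orthogonal q, hqn, ?_, ?_⟩
  · intro h0; rw [h0, norm_zero] at hwd; linarith
  · rw [hw, inner_sub_starProjection, ← hw, sq]
    exact mul_le_mul_of_nonneg_right hwd (norm_nonneg _)

/-! ### Column spaces -/

lemma mem_colSpace {ν κ : Type*} [Fintype κ] {H : Matrix ν κ ℝ} {x : EuclideanSpace ℝ ν} :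
    x ∈ colSpace H ↔ ∃ z, WithLp.toLp 2 (H *ᵥ z) = x := by
  rw [colSpace, Submodule.mem_span_range_iff_exists_fun]
  refine exists_congr fun z => ?_
  have : ∑ j, z j • (WithLp.toLp 2 fun a => H a j : EuclideanSpace ℝ ν) =
      WithLp.toLp 2 (H *ᵥ z) := by
    ext a; simp [Matrix.mulVec, dotProduct, mul_comm]
  rw [this]

lemma mem_colSpace_orthogonal {κ : Type*} [Fintype κ] {H : Matrix ι κ ℝ}
    {x : EuclideanSpace ℝ ι} : x ∈ (colSpace H)ᗮ ↔ Hᵀ *ᵥ x.ofLp = 0 := by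
  have key : ∀ z, ⟪(WithLp.toLp 2 (H *ᵥ z) : EuclideanSpace ℝ ι), x⟫ = z ⬝ᵥ (Hᵀ *ᵥ x.ofLp) := by
    intro z
    rw [← mulVec_dotProduct, ← inner_toLp]
  rw [Submodule.mem_orthogonal]
  constructor
  · intro h
    have := h _ (mem_colSpace.2 ⟨Hᵀ *ᵥ x.ofLp, rfl⟩)
    rw [key] at this
    exact dotProduct_self_eq_zero.1 this
  · rintro h u hu
    obtain ⟨z, rfl⟩ := mem_colSpace.1 hu
    rw [key, h, dotProduct_zero]

lemma finrank_colSpace {ν κ : Type*} [Fintype κ] {H : Matrix ν κ ℝ}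
    (hinj : ∀ v, H *ᵥ v = 0 → v = 0) : Module.finrank ℝ (colSpace H) = Fintype.card κ := by
  rw [colSpace, finrank_span_eq_card]
  rw [Fintype.linearIndependent_iff]
  intro g hg
  have : H *ᵥ g = 0 := by
    funext a
    have := congrArg (fun x : EuclideanSpace ℝ ν => x a) hg
    simpa [Matrix.mulVec, dotProduct, mul_comm] using this
  exact fun i => congrFun (hinj g this) i

lemma finrank_colSpace_firstCols {p k : ℕ} {V : Matrix (Fin p) (Fin p) ℝ} (hV : Vᵀ * V = 1)
    (hk : k ≤ p) : Module.finrank ℝ (colSpace (firstCols k V)) = k := by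
  rw [finrank_colSpace]
  · rw [Fintype.card_subtype, Fin.card_filter_val_lt, min_eq_right hk]
  · intro v hv
    have h1 : (firstCols k V)ᵀ * firstCols k V = 1 := by
      rw [firstCols, Matrix.transpose_submatrix, ← Matrix.submatrix_mul _ _ _ _ _ Function.bijective_id, hV]
      exact Matrix.submatrix_one _ Subtype.val_injective
    rw [← Matrix.one_mulVec v, ← h1, ← Matrix.mulVec_mulVec, hv, Matrix.mulVec_zero]

end SpaceDist


/-! ### Estimated loading spaces -/

section Loading

variable {p k h₀ : ℕ} {M V : Matrix (Fin p) (Fin p) ℝ}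

lemma IsEigenSystem.orthogonal (hV : IsEigenSystem M V) : Vᵀ * V = 1 := by
  obtain ⟨_, _, h, _⟩ := hV; exact h

/-- The inner product of `A z` with `w` equals that of `z` with `Aᵀ w`, and the lower bound on `A`
turns the norm of `z` into that of `A z`. This is the bridge from matrix estimates to angles between
subspaces. -/
lemma inner_le_of_vnorm_transpose_le {A : Matrix (Fin p) (Fin k) ℝ} {a ϵ : ℝ} (hϵ : 0 ≤ ϵ)
    (hA : ∀ v, a * vnorm v ≤ vnorm (A *ᵥ v))
    (h : ∀ w, (firstCols k V)ᵀ *ᵥ w = 0 → vnorm (Aᵀ *ᵥ w) ≤ ϵ * a * vnorm w) :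
    ∀ t ∈ colSpace A, ∀ w ∈ (colSpace (firstCols k V))ᗮ, inner ℝ t w ≤ ϵ * ‖t‖ * ‖w‖ := by
  intro t ht w hw
  obtain ⟨z, rfl⟩ := mem_colSpace.1 ht
  have h1 := h _ (mem_colSpace_orthogonal.1 hw)
  have h2 : inner ℝ (WithLp.toLp 2 (A *ᵥ z) : EuclideanSpace ℝ (Fin p)) w =
      z ⬝ᵥ (Aᵀ *ᵥ w.ofLp) := by rw [← mulVec_dotProduct, ← inner_toLp]
  rw [h2]
  calc z ⬝ᵥ (Aᵀ *ᵥ w.ofLp) ≤ vnorm z * vnorm (Aᵀ *ᵥ w.ofLp) := dotProduct_le _ _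
    _ ≤ vnorm z * (ϵ * a * vnorm w.ofLp) := mul_le_mul_of_nonneg_left h1 (vnorm_nonneg _)
    _ = ϵ * (a * vnorm z) * vnorm w.ofLp := by ring
    _ ≤ ϵ * vnorm (A *ᵥ z) * vnorm w.ofLp :=
      mul_le_mul_of_nonneg_right (mul_le_mul_of_nonneg_left (hA z) hϵ) (vnorm_nonneg _)

lemma injective_of_le_vnorm {A : Matrix (Fin p) (Fin k) ℝ} {a : ℝ} (ha : 0 < a)
    (hA : ∀ v, a * vnorm v ≤ vnorm (A *ᵥ v)) : ∀ v, A *ᵥ v = 0 → v = 0 := by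
  intro v hv
  have := hA v
  rw [hv, vnorm_zero] at this
  by_contra h0
  have := vnorm_pos h0
  nlinarith

lemma le_of_injective {A : Matrix (Fin p) (Fin k) ℝ} (hA : ∀ v, A *ᵥ v = 0 → v = 0) : k ≤ p := by
  have h1 := finrank_colSpace hA
  have h2 := Submodule.finrank_le (colSpace A)
  simpa [h1] using h2

lemma finrank_colSpace_of_le {A : Matrix (Fin p) (Fin k) ℝ} {a : ℝ} (ha : 0 < a)
    (hA : ∀ v, a * vnorm v ≤ vnorm (A *ᵥ v)) : Module.finrank ℝ (colSpace A) = k := by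
  rw [finrank_colSpace (injective_of_le_vnorm ha hA), Fintype.card_fin]

lemma spaceDist_firstCols_le (hk : 0 < k) (hV : IsEigenSystem M V)
    {A : Matrix (Fin p) (Fin k) ℝ} {a ϵ : ℝ} (ha : 0 < a) (hϵ : 0 ≤ ϵ)
    (hA : ∀ v, a * vnorm v ≤ vnorm (A *ᵥ v))
    (h : ∀ w, (firstCols k V)ᵀ *ᵥ w = 0 → vnorm (Aᵀ *ᵥ w) ≤ ϵ * a * vnorm w) :
    spaceDist (colSpace (firstCols k V)) (colSpace A) ≤ ϵ :=
  spaceDist_le hk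
    (finrank_colSpace_firstCols hV.orthogonal (le_of_injective (injective_of_le_vnorm ha hA)))
    (finrank_colSpace_of_le ha hA) hϵ (inner_le_of_vnorm_transpose_le hϵ hA h)

/-- The error-free case: one orthogonal complement is contained in the other, and the dimensions
agree. -/
lemma colSpace_firstCols_eq (hV : IsEigenSystem M V)
    {A : Matrix (Fin p) (Fin k) ℝ} {a : ℝ} (ha : 0 < a)
    (hA : ∀ v, a * vnorm v ≤ vnorm (A *ᵥ v))
    (h : ∀ w, (firstCols k V)ᵀ *ᵥ w = 0 → Aᵀ *ᵥ w = 0) :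
    colSpace (firstCols k V) = colSpace A := by
  symm
  refine Submodule.eq_of_le_of_finrank_eq ?_ ?_
  · have : (colSpace (firstCols k V))ᗮ ≤ (colSpace A)ᗮ := fun w hw =>
      mem_colSpace_orthogonal.2 (h _ (mem_colSpace_orthogonal.1 hw))
    exact (Submodule.orthogonal_le_orthogonal_iff).1 this
  · rw [finrank_colSpace_of_le ha hA,
      finrank_colSpace_firstCols hV.orthogonal (le_of_injective (injective_of_le_vnorm ha hA))]

/-- Supplies the direction that detects contamination: as a trailing direction it is nearly
invisible to `A`, while the loadings `A'` of the other regime act on it with full strength. -/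
lemma exists_trailing_of_lt_spaceDist {k' : ℕ} (hk : 0 < k) (hk' : 0 < k') (hV : IsEigenSystem M V)
    {A : Matrix (Fin p) (Fin k) ℝ} {A' : Matrix (Fin p) (Fin k') ℝ} {a a' d ϵ : ℝ}
    (ha : 0 < a) (ha' : 0 < a') (hd : 0 < d) (hϵ : 0 ≤ ϵ)
    (hA : ∀ v, a * vnorm v ≤ vnorm (A *ᵥ v)) (hA' : ∀ v, a' * vnorm v ≤ vnorm (A' *ᵥ v))
    (h : ∀ w, (firstCols k V)ᵀ *ᵥ w = 0 → vnorm (Aᵀ *ᵥ w) ≤ ϵ * a * vnorm w)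
    (hdist : d < spaceDist (colSpace A') (colSpace A)) (hsmall : (k + 1) * ϵ ≤ d / 2) :
    ∃ w, (firstCols k V)ᵀ *ᵥ w = 0 ∧ w ≠ 0 ∧ a' * (d / 2) * vnorm w ≤ vnorm (A'ᵀ *ᵥ w) := by
  obtain ⟨q, hq, w, hw, hq1, hw0, hqw⟩ := exists_orthogonal_of_lt_spaceDist hd hϵ
    (S := colSpace (firstCols k V)) (T := colSpace A) (U := colSpace A')
    (by rw [finrank_colSpace_of_le ha hA, finrank_colSpace_firstCols hV.orthogonal
      (le_of_injective (injective_of_le_vnorm ha hA))])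
    (by rwa [finrank_colSpace_of_le ha hA]) (by rwa [finrank_colSpace_of_le ha' hA'])
    (inner_le_of_vnorm_transpose_le hϵ hA h) hdist (by rwa [finrank_colSpace_of_le ha hA])
  obtain ⟨z, rfl⟩ := mem_colSpace.1 hq
  refine ⟨w.ofLp, mem_colSpace_orthogonal.1 hw, fun h0 => hw0 (by ext i; exact congrFun h0 i), ?_⟩
  have h2 : inner ℝ (WithLp.toLp 2 (A' *ᵥ z) : EuclideanSpace ℝ (Fin p)) w =
      z ⬝ᵥ (A'ᵀ *ᵥ w.ofLp) := by rw [← mulVec_dotProduct, ← inner_toLp]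
  rw [h2] at hqw
  have h3 : a' * vnorm z ≤ 1 := (hA' z).trans_eq hq1
  calc a' * (d / 2) * vnorm w.ofLp = a' * (d / 2 * ‖w‖) := by rw [mul_assoc]; rfl
    _ ≤ a' * (vnorm z * vnorm (A'ᵀ *ᵥ w.ofLp)) :=
      mul_le_mul_of_nonneg_left (hqw.trans (dotProduct_le _ _)) ha'.le
    _ = (a' * vnorm z) * vnorm (A'ᵀ *ᵥ w.ofLp) := by ring
    _ ≤ vnorm (A'ᵀ *ᵥ w.ofLp) := mul_le_of_le_one_left (vnorm_nonneg _) h3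

/-! ### The objective function -/

lemma lastCols_transpose_mul_self (hV : Vᵀ * V = 1) : (lastCols k V)ᵀ * lastCols k V = 1 := by
  rw [lastCols, Matrix.transpose_submatrix, ← Matrix.submatrix_mul _ _ _ _ _ Function.bijective_id,
    hV]
  exact Matrix.submatrix_one _ Subtype.val_injective

lemma firstCols_transpose_mul_lastCols (hV : Vᵀ * V = 1) :
    (firstCols k V)ᵀ * lastCols k V = 0 := by
  rw [lastCols, firstCols, Matrix.transpose_submatrix,
    ← Matrix.submatrix_mul _ _ _ _ _ Function.bijective_id, hV]
  ext i j
  have : (i : Fin p) ≠ j := fun h => by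
    have h1 := i.2; have h2 := j.2; rw [h] at h1; omega
  simp [this]

lemma vnorm_lastCols_mulVec (hV : Vᵀ * V = 1) (z : {j : Fin p // k ≤ (j : ℕ)} → ℝ) :
    vnorm (lastCols k V *ᵥ z) = vnorm z := by
  have h : vnorm (lastCols k V *ᵥ z) ^ 2 = vnorm z ^ 2 := by
    rw [vnorm_sq, mulVec_dotProduct, Matrix.mulVec_mulVec, lastCols_transpose_mul_self hV,
      Matrix.one_mulVec, vnorm_sq]
  exact (pow_left_inj₀ (vnorm_nonneg _) (vnorm_nonneg _) two_ne_zero).1 h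

lemma exists_lastCols_mulVec (hV : Vᵀ * V = 1) {w : Fin p → ℝ}
    (hw : (firstCols k V)ᵀ *ᵥ w = 0) : ∃ z, lastCols k V *ᵥ z = w := by
  refine ⟨fun j => (Vᵀ *ᵥ w) j, ?_⟩
  have hwV : V *ᵥ (Vᵀ *ᵥ w) = w := by
    rw [Matrix.mulVec_mulVec, mul_eq_one_comm.1 hV, Matrix.one_mulVec]
  conv_rhs => rw [← hwV]
  funext i
  change ∑ j : {j : Fin p // k ≤ (j : ℕ)}, V i j * (Vᵀ *ᵥ w) j = ∑ j, V i j * (Vᵀ *ᵥ w) j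
  rw [← Fintype.sum_subtype_add_sum_subtype (fun j : Fin p => k ≤ (j : ℕ)), left_eq_add]
  refine Finset.sum_eq_zero fun j _ => ?_
  have h1 := congrFun hw ⟨j, not_le.1 j.2⟩
  rw [firstCols_transpose_mulVec_apply] at h1
  rw [h1, Pi.zero_apply, mul_zero]

/-- The compressed matrix represents the form `∑ ⟨S_h' B y, S_h' B z⟩`, so Cauchy–Schwarz bounds it,
and testing with its own image gives the norm. It bounds the objective at the true break from above.
-/
lemma l2norm_trailing_le (hV : Vᵀ * V = 1) {S : ℕ → Matrix (Fin p) (Fin p) ℝ} {b : ℝ}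
    (hS : ∀ h ∈ Finset.Icc 1 h₀, ∀ w, (firstCols k V)ᵀ *ᵥ w = 0 →
      vnorm ((S h)ᵀ *ᵥ w) ≤ b * vnorm w) :
    l2norm ((lastCols k V)ᵀ * (∑ h ∈ Finset.Icc 1 h₀, S h * (S h)ᵀ) * lastCols k V) ≤
      h₀ * b ^ 2 := by
  refine l2norm_le (by positivity) fun z => ?_
  set B := lastCols k V
  set N := Bᵀ * (∑ h ∈ Finset.Icc 1 h₀, S h * (S h)ᵀ) * B
  have hB : ∀ y, (firstCols k V)ᵀ *ᵥ (B *ᵥ y) = 0 := fun y => by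
    rw [Matrix.mulVec_mulVec, firstCols_transpose_mul_lastCols hV, Matrix.zero_mulVec]
  have hform : ∀ y, y ⬝ᵥ (N *ᵥ z) =
      ∑ h ∈ Finset.Icc 1 h₀, ((S h)ᵀ *ᵥ (B *ᵥ y)) ⬝ᵥ ((S h)ᵀ *ᵥ (B *ᵥ z)) := fun y => by
    rw [← Matrix.mulVec_mulVec, ← Matrix.mulVec_mulVec, ← mulVec_dotProduct, Matrix.sum_mulVec,
      dotProduct_sum]
    refine Finset.sum_congr rfl fun h _ => ?_
    rw [← Matrix.mulVec_mulVec, dotProduct_comm, mulVec_dotProduct (S h), dotProduct_comm]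
  have hle : ∀ y, y ⬝ᵥ (N *ᵥ z) ≤ h₀ * b ^ 2 * vnorm z * vnorm y := fun y => by
    rw [hform]
    calc ∑ h ∈ Finset.Icc 1 h₀, ((S h)ᵀ *ᵥ (B *ᵥ y)) ⬝ᵥ ((S h)ᵀ *ᵥ (B *ᵥ z))
        ≤ ∑ _h ∈ Finset.Icc 1 h₀, (b * vnorm y) * (b * vnorm z) := by
          refine Finset.sum_le_sum fun h hh => (dotProduct_le _ _).trans ?_
          have h1 := hS h hh _ (hB y)
          have h2 := hS h hh _ (hB z)
          rw [vnorm_lastCols_mulVec hV] at h1 h2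
          exact mul_le_mul h1 h2 (vnorm_nonneg _) ((vnorm_nonneg _).trans h1)
      _ = h₀ * b ^ 2 * vnorm z * vnorm y := by
          rw [Finset.sum_const, Nat.card_Icc, nsmul_eq_mul, Nat.add_sub_cancel]; ring
  have h1 := hle (N *ᵥ z)
  rw [← vnorm_sq] at h1
  rcases (vnorm_nonneg (N *ᵥ z)).eq_or_lt with h0 | h0
  · rw [← h0]; have := vnorm_nonneg z; positivity
  · nlinarith

/-- Each term of the quadratic form is nonnegative and the whole form is at most the spectral norm.
A small objective thus makes every single autocovariance small on trailing directions. -/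
lemma vnorm_sq_le_l2norm_trailing (hV : Vᵀ * V = 1) (S : ℕ → Matrix (Fin p) (Fin p) ℝ)
    {w : Fin p → ℝ} (hw : (firstCols k V)ᵀ *ᵥ w = 0) {h : ℕ} (hh : h ∈ Finset.Icc 1 h₀) :
    vnorm ((S h)ᵀ *ᵥ w) ^ 2 ≤
      l2norm ((lastCols k V)ᵀ * (∑ h ∈ Finset.Icc 1 h₀, S h * (S h)ᵀ) * lastCols k V) *
        vnorm w ^ 2 := by
  obtain ⟨z, rfl⟩ := exists_lastCols_mulVec hV hw
  set B := lastCols k V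
  set N := Bᵀ * (∑ h ∈ Finset.Icc 1 h₀, S h * (S h)ᵀ) * B
  have h1 : z ⬝ᵥ (N *ᵥ z) = ∑ h ∈ Finset.Icc 1 h₀, vnorm ((S h)ᵀ *ᵥ (B *ᵥ z)) ^ 2 := by
    rw [← quadForm_sum, ← Matrix.mulVec_mulVec, ← Matrix.mulVec_mulVec, ← mulVec_dotProduct]
  have h2 := dotProduct_le z (N *ᵥ z)
  have h3 := vnorm_mulVec_le_l2norm N z
  have h4 : vnorm ((S h)ᵀ *ᵥ (B *ᵥ z)) ^ 2 ≤
      ∑ h ∈ Finset.Icc 1 h₀, vnorm ((S h)ᵀ *ᵥ (B *ᵥ z)) ^ 2 :=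
    Finset.single_le_sum (f := fun h => vnorm ((S h)ᵀ *ᵥ (B *ᵥ z)) ^ 2)
      (fun _ _ => sq_nonneg _) hh
  rw [vnorm_lastCols_mulVec hV]
  calc vnorm ((S h)ᵀ *ᵥ (B *ᵥ z)) ^ 2 ≤ vnorm z * vnorm (N *ᵥ z) := by linarith
    _ ≤ vnorm z * (l2norm N * vnorm z) := mul_le_mul_of_nonneg_left h3 (vnorm_nonneg _)
    _ = l2norm N * vnorm z ^ 2 := by ring

end Loading


/-! ### Perturbed factor structures -/

section Perturbation

/-- `A` has singular values of the order `√q`, bounded by `a` from below and by `L` from above. -/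
structure LoadingBounds {p k : ℕ} (A : Matrix (Fin p) (Fin k) ℝ) (a L K q : ℝ) : Prop where
  pos : 0 < a
  nonneg : 0 ≤ L
  lower : ∀ v, a * vnorm v ≤ vnorm (A *ᵥ v)
  upper : ∀ v, vnorm (A *ᵥ v) ≤ L * vnorm v
  le_lower : q ≤ K * a ^ 2
  upper_le : L ^ 2 ≤ K * q

/-- Up to errors of order `e`, the matrices `S_h` equal `A T_h A' + A' C_h A''`, where some `T_h` is
nonsingular and the contamination `C_h` has the order `N / n`. -/
def FactorApprox {p k k' : ℕ} (h₀ : ℕ) (A : Matrix (Fin p) (Fin k) ℝ)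
    (A' : Matrix (Fin p) (Fin k') ℝ) (K c e n N : ℝ) (S : ℕ → Matrix (Fin p) (Fin p) ℝ) : Prop :=
  ∃ (T : ℕ → Matrix (Fin k) (Fin k) ℝ) (C : ℕ → Matrix (Fin k') (Fin k') ℝ),
    (∀ h ∈ Finset.Icc 1 h₀, ∀ v,
      vnorm ((S h - A * T h * Aᵀ - A' * C h * A'ᵀ)ᵀ *ᵥ v) ≤ K * e * vnorm v) ∧
    (∃ h ∈ Finset.Icc 1 h₀, ∀ v, c * vnorm v ≤ vnorm ((T h)ᵀ *ᵥ v)) ∧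
    (∀ h ∈ Finset.Icc 1 h₀, ∀ v, vnorm ((T h)ᵀ *ᵥ v) ≤ K * vnorm v) ∧
    (∀ h ∈ Finset.Icc 1 h₀, ∀ v, vnorm ((C h)ᵀ *ᵥ v) ≤ K * ((N + 1) / n) * vnorm v) ∧
    (∃ h ∈ Finset.Icc 1 h₀, ∀ v, (c * N - K) / n * vnorm v ≤ vnorm ((C h)ᵀ *ᵥ v))

variable {p k k' h₀ : ℕ} {A : Matrix (Fin p) (Fin k) ℝ} {A' : Matrix (Fin p) (Fin k') ℝ}
  {a L q a' L' q' K c e n N X : ℝ} {S : ℕ → Matrix (Fin p) (Fin p) ℝ}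

/-- Both bounds refer to the same scale: `L ^ 2 ≤ K * q ≤ K ^ 2 * a ^ 2`. -/
lemma LoadingBounds.upper_le_lower (hA : LoadingBounds A a L K q) (hK : 1 ≤ K) : L ≤ K * a := by
  have h1 := hA.le_lower
  have h2 := hA.upper_le
  refine le_of_sq_le_sq ?_ (mul_nonneg (by linarith) hA.pos.le)
  nlinarith

lemma transpose_triple_mulVec (A : Matrix (Fin p) (Fin k) ℝ) (T : Matrix (Fin k) (Fin k) ℝ)
    (v : Fin p → ℝ) : (A * T * Aᵀ)ᵀ *ᵥ v = A *ᵥ (Tᵀ *ᵥ (Aᵀ *ᵥ v)) := by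
  rw [Matrix.transpose_mul, Matrix.transpose_mul, Matrix.transpose_transpose,
    ← Matrix.mulVec_mulVec, ← Matrix.mulVec_mulVec]

/-- A moderate contamination is absorbed in the error term. -/
lemma vnorm_sub_le_of_contamination (hK : 1 ≤ K) (hn : 0 < n) (hN : 0 ≤ N)
    (hA' : LoadingBounds A' a' L' K q') (hq : q' ≤ n * e) (hX : N * q' ≤ X * (n * e))
    {T : Matrix (Fin k) (Fin k) ℝ} {C : Matrix (Fin k') (Fin k') ℝ} {S : Matrix (Fin p) (Fin p) ℝ}
    (hS : ∀ v, vnorm ((S - A * T * Aᵀ - A' * C * A'ᵀ)ᵀ *ᵥ v) ≤ K * e * vnorm v)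
    (hC : ∀ v, vnorm (Cᵀ *ᵥ v) ≤ K * ((N + 1) / n) * vnorm v) (v : Fin p → ℝ) :
    vnorm ((S - A * T * Aᵀ)ᵀ *ᵥ v) ≤ (K + K ^ 2 * (X + 1)) * e * vnorm v := by
  have h1 : (S - A * T * Aᵀ)ᵀ *ᵥ v =
      (S - A * T * Aᵀ - A' * C * A'ᵀ)ᵀ *ᵥ v + A' *ᵥ (Cᵀ *ᵥ (A'ᵀ *ᵥ v)) := by
    rw [← transpose_triple_mulVec, ← Matrix.add_mulVec, ← Matrix.transpose_add, sub_add_cancel]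
  have h2 : vnorm (A' *ᵥ (Cᵀ *ᵥ (A'ᵀ *ᵥ v))) ≤ K ^ 2 * (X + 1) * e * vnorm v := by
    have hv := vnorm_nonneg v
    have hN' : 0 ≤ (N + 1) / n := by positivity
    calc vnorm (A' *ᵥ (Cᵀ *ᵥ (A'ᵀ *ᵥ v)))
        ≤ L' * (K * ((N + 1) / n) * (L' * vnorm v)) := by
          refine (hA'.upper _).trans (mul_le_mul_of_nonneg_left ?_ hA'.nonneg)
          refine (hC _).trans (mul_le_mul_of_nonneg_left ?_ (by positivity))
          exact vnorm_transpose_mulVec_le hA'.nonneg hA'.upper v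
      _ = L' ^ 2 * (K * ((N + 1) / n) * vnorm v) := by ring
      _ ≤ K * q' * (K * ((N + 1) / n) * vnorm v) :=
          mul_le_mul_of_nonneg_right hA'.upper_le (by positivity)
      _ = K ^ 2 * ((N * q' + q') / n) * vnorm v := by ring
      _ ≤ K ^ 2 * ((X + 1) * e) * vnorm v := by
          refine mul_le_mul_of_nonneg_right (mul_le_mul_of_nonneg_left ?_ (by positivity)) hv
          rw [div_le_iff₀ hn]; linarith
      _ = K ^ 2 * (X + 1) * e * vnorm v := by ring
  rw [h1]
  calc _ ≤ K * e * vnorm v + K ^ 2 * (X + 1) * e * vnorm v :=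
        (vnorm_add_le _ _).trans (add_le_add (hS v) h2)
    _ = _ := by ring

/-- Contamination of order `e` only enlarges the error constant from `K` to `K + K ^ 2 * (X + 1)`,
so the estimate for a perturbed low-rank matrix applies as if there were none. -/
lemma FactorApprox.vnorm_transpose_le {V M : Matrix (Fin p) (Fin p) ℝ}
    (hS : FactorApprox h₀ A A' K c e n N S) (hV : IsEigenSystem M V)
    (hM : M = ∑ h ∈ Finset.Icc 1 h₀, S h * (S h)ᵀ)
    (hK : 1 ≤ K) (he : 0 ≤ e) (hn : 0 < n) (hN : 0 ≤ N) (hX0 : 0 ≤ X)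
    (hA : LoadingBounds A a L K q) (hA' : LoadingBounds A' a' L' K q') (hq : q' ≤ n * e)
    (hX : N * q' ≤ X * (n * e)) {w : Fin p → ℝ} (hw : (firstCols k V)ᵀ *ᵥ w = 0) :
    a * c * vnorm (Aᵀ *ᵥ w) ≤ (h₀ + 1) * (K + K ^ 2 * (X + 1)) * e * vnorm w := by
  obtain ⟨T, C, h1, h2, -, h4, -⟩ := hS
  have := vnorm_transpose_le_on_trailing hV hM hA.pos.le (by positivity) hA.lower h2
    (fun h hh v => vnorm_sub_le_of_contamination hK hn hN hA' hq hX (h1 h hh) (h4 h hh) v) hw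
  rwa [← mul_assoc] at this

/-- The trailing eigenvectors at a tentative break with little contamination are nearly orthogonal
to the loading space, in relative terms. -/
lemma FactorApprox.vnorm_transpose_le' {V M : Matrix (Fin p) (Fin p) ℝ}
    (hS : FactorApprox h₀ A A' K c e n N S) (hV : IsEigenSystem M V)
    (hM : M = ∑ h ∈ Finset.Icc 1 h₀, S h * (S h)ᵀ)
    (hK : 1 ≤ K) (hc : 0 < c) (he : 0 ≤ e) (hn : 0 < n) (hN : 0 ≤ N) (hX0 : 0 ≤ X) (hq0 : 0 < q)
    (hA : LoadingBounds A a L K q) (hA' : LoadingBounds A' a' L' K q') (hq : q' ≤ n * e)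
    (hX : N * q' ≤ X * (n * e)) (w : Fin p → ℝ) (hw : (firstCols k V)ᵀ *ᵥ w = 0) :
    vnorm (Aᵀ *ᵥ w) ≤
      ((h₀ + 1) * (K + K ^ 2 * (X + 1)) * K / c * (e / q)) * a * vnorm w := by
  have h1 := hS.vnorm_transpose_le hV hM hK he hn hN hX0 hA hA' hq hX hw
  have ha := hA.pos
  have hv := vnorm_nonneg w
  have h2 : vnorm (Aᵀ *ᵥ w) ≤ (h₀ + 1) * (K + K ^ 2 * (X + 1)) * e * vnorm w / (a * c) := by
    rw [le_div_iff₀ (by positivity)]; linarith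
  refine h2.trans ?_
  rw [div_le_iff₀ (by positivity)]
  have h3 : 1 ≤ K * a ^ 2 / q := by rw [le_div_iff₀ hq0]; linarith [hA.le_lower]
  calc (h₀ + 1) * (K + K ^ 2 * (X + 1)) * e * vnorm w
      ≤ (h₀ + 1) * (K + K ^ 2 * (X + 1)) * e * vnorm w * (K * a ^ 2 / q) :=
        le_mul_of_one_le_right (by positivity) h3
    _ = _ := by field_simp

/-- The rate for the estimated loading space. -/
lemma FactorApprox.spaceDist_le {V M : Matrix (Fin p) (Fin p) ℝ}
    (hS : FactorApprox h₀ A A' K c e n N S) (hV : IsEigenSystem M V)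
    (hM : M = ∑ h ∈ Finset.Icc 1 h₀, S h * (S h)ᵀ) (hk : 0 < k)
    (hK : 1 ≤ K) (hc : 0 < c) (he : 0 ≤ e) (hn : 0 < n) (hN : 0 ≤ N) (hX0 : 0 ≤ X) (hq0 : 0 < q)
    (hA : LoadingBounds A a L K q) (hA' : LoadingBounds A' a' L' K q') (hq : q' ≤ n * e)
    (hX : N * q' ≤ X * (n * e)) :
    spaceDist (colSpace (firstCols k V)) (colSpace A) ≤
      (h₀ + 1) * (K + K ^ 2 * (X + 1)) * K / c * (e / q) :=
  spaceDist_firstCols_le hk hV hA.pos (by positivity) hA.lower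
    (hS.vnorm_transpose_le' hV hM hK hc he hn hN hX0 hq0 hA hA' hq hX)

/-- The trailing eigenvectors at one tentative break without contamination annihilate the
autocovariances at another one. -/
lemma FactorApprox.vnorm_le_of_trailing {W : Fin p → ℝ} {B : ℝ}
    (hS : FactorApprox h₀ A A' K c e n 0 S)
    (hK : 1 ≤ K) (hc : 0 < c) (hn : 0 < n)
    (hA : LoadingBounds A a L K q) (hA' : LoadingBounds A' a' L' K q') (hq : q' ≤ n * e)
    (hW : a * c * vnorm (Aᵀ *ᵥ W) ≤ B * e * vnorm W) {h : ℕ} (hh : h ∈ Finset.Icc 1 h₀) :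
    vnorm ((S h)ᵀ *ᵥ W) ≤ (K ^ 2 / c * B + (K + K ^ 2)) * e * vnorm W := by
  obtain ⟨T, C, h1, -, h3, h4, -⟩ := hS
  have h5 := vnorm_sub_le_of_contamination (X := 0) hK hn le_rfl hA' hq (by simp) (h1 h hh)
    (h4 h hh) W
  have h6 : (S h)ᵀ *ᵥ W = A *ᵥ ((T h)ᵀ *ᵥ (Aᵀ *ᵥ W)) + (S h - A * T h * Aᵀ)ᵀ *ᵥ W := by
    rw [← transpose_triple_mulVec, ← Matrix.add_mulVec, ← Matrix.transpose_add, add_sub_cancel]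
  have h7 : vnorm (A *ᵥ ((T h)ᵀ *ᵥ (Aᵀ *ᵥ W))) ≤ K ^ 2 / c * B * e * vnorm W := by
    calc vnorm (A *ᵥ ((T h)ᵀ *ᵥ (Aᵀ *ᵥ W))) ≤ L * vnorm ((T h)ᵀ *ᵥ (Aᵀ *ᵥ W)) := hA.upper _
      _ ≤ L * (K * vnorm (Aᵀ *ᵥ W)) := mul_le_mul_of_nonneg_left (h3 h hh _) hA.nonneg
      _ ≤ K * a * (K * vnorm (Aᵀ *ᵥ W)) :=
        mul_le_mul_of_nonneg_right (hA.upper_le_lower hK)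
          (mul_nonneg (by linarith) (vnorm_nonneg _))
      _ = K ^ 2 / c * (a * c * vnorm (Aᵀ *ᵥ W)) := by field_simp
      _ ≤ K ^ 2 / c * (B * e * vnorm W) := mul_le_mul_of_nonneg_left hW (by positivity)
      _ = _ := by ring
  rw [h6]
  calc _ ≤ K ^ 2 / c * B * e * vnorm W + (K + K ^ 2 * (0 + 1)) * e * vnorm W :=
        (vnorm_add_le _ _).trans (add_le_add h7 h5)
    _ = _ := by ring

/-- If trailing directions nearly annihilate the autocovariances and one of them has a sizeable
component in the loading space of the other regime, then there is little contamination. -/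
lemma FactorApprox.contamination_le {w : Fin p → ℝ} {B B' d : ℝ}
    (hS : FactorApprox h₀ A A' K c e n N S)
    (hK : 1 ≤ K) (hc : 0 < c) (hd : 0 < d) (he : 0 < e) (hn : 0 < n)
    (hB : 0 ≤ B) (hB' : 0 ≤ B') (hq0 : 0 < q')
    (hA : LoadingBounds A a L K q) (hA' : LoadingBounds A' a' L' K q') (hq : q' ≤ n * e)
    (hw0 : w ≠ 0) (hw : a * c * vnorm (Aᵀ *ᵥ w) ≤ B * e * vnorm w)
    (hSw : ∀ h ∈ Finset.Icc 1 h₀, vnorm ((S h)ᵀ *ᵥ w) ≤ B' * e * vnorm w)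
    (hwA : a' * (d / 2) * vnorm w ≤ vnorm (A'ᵀ *ᵥ w)) :
    N * q' ≤ ((2 * K * (B' + K ^ 2 / c * B + K) / d + K) / c) * (n * e) := by
  obtain ⟨T, C, h1, -, h3, -, h, hh, hC⟩ := hS
  have hw1 := vnorm_pos hw0
  have h6 : A' *ᵥ ((C h)ᵀ *ᵥ (A'ᵀ *ᵥ w)) = (S h)ᵀ *ᵥ w - A *ᵥ ((T h)ᵀ *ᵥ (Aᵀ *ᵥ w)) -
      (S h - A * T h * Aᵀ - A' * C h * A'ᵀ)ᵀ *ᵥ w := by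
    rw [← transpose_triple_mulVec, ← transpose_triple_mulVec, ← Matrix.sub_mulVec,
      ← Matrix.sub_mulVec, ← Matrix.transpose_sub, ← Matrix.transpose_sub, sub_sub_cancel]
  have h7 : vnorm (A *ᵥ ((T h)ᵀ *ᵥ (Aᵀ *ᵥ w))) ≤ K ^ 2 / c * B * e * vnorm w := by
    calc vnorm (A *ᵥ ((T h)ᵀ *ᵥ (Aᵀ *ᵥ w))) ≤ L * vnorm ((T h)ᵀ *ᵥ (Aᵀ *ᵥ w)) := hA.upper _
      _ ≤ L * (K * vnorm (Aᵀ *ᵥ w)) := mul_le_mul_of_nonneg_left (h3 h hh _) hA.nonneg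
      _ ≤ K * a * (K * vnorm (Aᵀ *ᵥ w)) :=
        mul_le_mul_of_nonneg_right (hA.upper_le_lower hK)
          (mul_nonneg (by linarith) (vnorm_nonneg _))
      _ = K ^ 2 / c * (a * c * vnorm (Aᵀ *ᵥ w)) := by field_simp
      _ ≤ K ^ 2 / c * (B * e * vnorm w) := mul_le_mul_of_nonneg_left hw (by positivity)
      _ = _ := by ring
  have h8 : vnorm (A' *ᵥ ((C h)ᵀ *ᵥ (A'ᵀ *ᵥ w))) ≤
      (B' + K ^ 2 / c * B + K) * e * vnorm w := by
    rw [h6]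
    calc _ ≤ B' * e * vnorm w + K ^ 2 / c * B * e * vnorm w + K * e * vnorm w :=
          (vnorm_sub_le _ _).trans (add_le_add ((vnorm_sub_le _ _).trans
            (add_le_add (hSw h hh) h7)) (h1 h hh w))
      _ = _ := by ring
  have hY : 0 ≤ 2 * K * (B' + K ^ 2 / c * B + K) / d := by positivity
  rw [div_mul_eq_mul_div, le_div_iff₀ hc]
  -- If `c * N ≤ K` there are only boundedly many wrong times, harmless because `q' ≤ n * e`.
  -- Otherwise the lower bound on the contamination is positive and can be multiplied through.
  rcases le_or_gt (c * N - K) 0 with hneg | hpos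
  · have : c * N * q' ≤ K * (n * e) :=
      mul_le_mul (by linarith) hq hq0.le (by linarith)
    have h9 : 0 ≤ 2 * K * (B' + K ^ 2 / c * B + K) / d * (n * e) := by positivity
    linarith
  · have h9 : a' * ((c * N - K) / n * (a' * (d / 2) * vnorm w)) ≤
        (B' + K ^ 2 / c * B + K) * e * vnorm w := by
      refine le_trans ?_ h8
      refine le_trans ?_ (hA'.lower _)
      refine mul_le_mul_of_nonneg_left ?_ hA'.pos.le
      exact (mul_le_mul_of_nonneg_left hwA (div_pos hpos hn).le).trans (hC _)
    have h10 : a' ^ 2 * ((c * N - K) / n * (d / 2)) ≤ (B' + K ^ 2 / c * B + K) * e := by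
      refine le_of_mul_le_mul_right ?_ hw1
      calc _ = a' * ((c * N - K) / n * (a' * (d / 2) * vnorm w)) := by ring
        _ ≤ _ := h9
    have h11 : q' * ((c * N - K) / n * (d / 2)) ≤ K * ((B' + K ^ 2 / c * B + K) * e) := by
      calc q' * ((c * N - K) / n * (d / 2)) ≤ K * a' ^ 2 * ((c * N - K) / n * (d / 2)) :=
            mul_le_mul_of_nonneg_right hA'.le_lower
              (mul_nonneg (div_pos hpos hn).le (by positivity))
        _ = K * (a' ^ 2 * ((c * N - K) / n * (d / 2))) := by ring
        _ ≤ _ := mul_le_mul_of_nonneg_left h10 (by linarith)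
    have h12 : q' * (c * N - K) ≤ 2 * K * (B' + K ^ 2 / c * B + K) / d * (n * e) := by
      have : q' * ((c * N - K) / n * (d / 2)) = q' * (c * N - K) * (d / (2 * n)) := by
        field_simp
      rw [this] at h11
      have h13 : 0 < d / (2 * n) := by positivity
      refine le_of_mul_le_mul_right (h11.trans_eq ?_) h13
      field_simp
    nlinarith [mul_le_mul_of_nonneg_left hq (zero_le_one.trans hK)]

/-- A minimiser of the objective function has little contamination. -/
lemma exists_contamination_bound (h₀ : ℕ) {k : Fin 2 → ℕ} (hk : ∀ i, 0 < k i) {K c d : ℝ}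
    (hK : 1 ≤ K) (hc : 0 < c) (hd : 0 < d) :
    ∃ X : ℝ, 0 ≤ X ∧ ∃ r : ℝ, 0 < r ∧ ∀ {p : ℕ} {A : ∀ i, Matrix (Fin p) (Fin (k i)) ℝ}
      {a L q : Fin 2 → ℝ} {e n : ℝ} {R S₀ S : Fin 2 → ℕ → Matrix (Fin p) (Fin p) ℝ}
      {V : Fin 2 → Matrix (Fin p) (Fin p) ℝ} {N : Fin 2 → ℝ},
      0 < e → 0 < n → (∀ i, 0 ≤ N i) → (∀ i, 0 < q i) →
      (∀ i, LoadingBounds (A i) (a i) (L i) K (q i)) → (∀ i, q i ≤ n * e) → (∀ i, e ≤ r * q i) →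
      (∀ i, IsEigenSystem (∑ h ∈ Finset.Icc 1 h₀, R i h * (R i h)ᵀ) (V i)) →
      (∀ i j, i ≠ j → FactorApprox h₀ (A i) (A j) K c e n 0 (R i)) →
      (∀ i j, i ≠ j → FactorApprox h₀ (A i) (A j) K c e n 0 (S₀ i)) →
      (∀ i j, i ≠ j → FactorApprox h₀ (A i) (A j) K c e n (N i) (S i)) →
      d < spaceDist (colSpace (A 0)) (colSpace (A 1)) →
      ∑ i, l2norm ((lastCols (k i) (V i))ᵀ * (∑ h ∈ Finset.Icc 1 h₀, S i h * (S i h)ᵀ) *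
          lastCols (k i) (V i)) ≤
        ∑ i, l2norm ((lastCols (k i) (V i))ᵀ * (∑ h ∈ Finset.Icc 1 h₀, S₀ i h * (S₀ i h)ᵀ) *
          lastCols (k i) (V i)) →
      ∀ i j, i ≠ j → N i * q j ≤ X * (n * e) := by
  -- `B` measures how far the trailing directions at the uncontaminated break are from annihilating
  -- the loadings, `B₁` the resulting size of the autocovariances at the true break, and `B'` their
  -- size at the minimiser.
  set B : ℝ := (h₀ + 1) * (K + K ^ 2) with hB
  set B₁ : ℝ := K ^ 2 / c * B + (K + K ^ 2) with hB₁
  set B' : ℝ := (2 * h₀ + 1) * B₁ with hB'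
  have hB0 : 0 ≤ B := by positivity
  have hB₁0 : 0 ≤ B₁ := by positivity
  have hB'0 : 0 ≤ B' := by positivity
  -- The trailing space has angle error at most `B * K / c * (e / q i)`. With `e ≤ d / 2 / Y * q i`,
  -- even `k i + 1` times this error is at most `d / 2`, as required for finding the detecting
  -- direction.
  set Y : ℝ := (k 0 + k 1 + 1) * (B * K / c) with hY
  have hY0 : 0 < Y := by have : 0 < B := by positivity
                         positivity
  refine ⟨(2 * K * (B' + K ^ 2 / c * B + K) / d + K) / c, by positivity, d / 2 / Y,
    by positivity, ?_⟩
  intro p A a L q e n R S₀ S V N he hn hN hq hA hqn her hV hR hS₀ hS hdist hG i j hij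
  have htrail : ∀ i w, (firstCols (k i) (V i))ᵀ *ᵥ w = 0 →
      a i * c * vnorm ((A i)ᵀ *ᵥ w) ≤ B * e * vnorm w := by
    intro i w hw
    obtain ⟨j, hj⟩ : ∃ j, i ≠ j := ⟨i + 1, by fin_cases i <;> simp⟩
    have := (hR i j hj).vnorm_transpose_le (X := 0) (hV i) rfl hK he.le hn le_rfl le_rfl (hA i)
      (hA j) (hqn j) (by simp) hw
    simpa [hB] using this
  have hsmall₀ : ∀ i, ∀ h ∈ Finset.Icc 1 h₀, ∀ w, (firstCols (k i) (V i))ᵀ *ᵥ w = 0 →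
      vnorm ((S₀ i h)ᵀ *ᵥ w) ≤ B₁ * e * vnorm w := by
    intro i h hh w hw
    obtain ⟨j, hj⟩ : ∃ j, i ≠ j := ⟨i + 1, by fin_cases i <;> simp⟩
    exact (hS₀ i j hj).vnorm_le_of_trailing hK hc hn (hA i) (hA j) (hqn j) (htrail i w hw) hh
  have hG₀ : ∑ i, l2norm ((lastCols (k i) (V i))ᵀ *
      (∑ h ∈ Finset.Icc 1 h₀, S₀ i h * (S₀ i h)ᵀ) * lastCols (k i) (V i)) ≤
      2 * h₀ * (B₁ * e) ^ 2 := by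
    rw [Fin.sum_univ_two]
    have h0 := l2norm_trailing_le (hV 0).orthogonal (hsmall₀ 0)
    have h1 := l2norm_trailing_le (hV 1).orthogonal (hsmall₀ 1)
    linarith
  -- Both summands of the objective are nonnegative, so each one at the minimiser is bounded by the
  -- whole objective at the true break.
  have hSw : ∀ w, (firstCols (k i) (V i))ᵀ *ᵥ w = 0 → ∀ h ∈ Finset.Icc 1 h₀,
      vnorm ((S i h)ᵀ *ᵥ w) ≤ B' * e * vnorm w := by
    intro w hw h hh
    have h1 := vnorm_sq_le_l2norm_trailing (hV i).orthogonal (S i) hw hh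
    have h2 := Finset.single_le_sum (f := fun i => l2norm ((lastCols (k i) (V i))ᵀ *
      (∑ h ∈ Finset.Icc 1 h₀, S i h * (S i h)ᵀ) * lastCols (k i) (V i)))
      (fun i _ => l2norm_nonneg _) (Finset.mem_univ i)
    refine le_of_sq_le_sq ?_ (mul_nonneg (by positivity) (vnorm_nonneg _))
    calc vnorm ((S i h)ᵀ *ᵥ w) ^ 2 ≤ 2 * h₀ * (B₁ * e) ^ 2 * vnorm w ^ 2 :=
          h1.trans (mul_le_mul_of_nonneg_right ((h2.trans hG).trans hG₀) (sq_nonneg _))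
      _ ≤ (2 * h₀ + 1) ^ 2 * (B₁ * e) ^ 2 * vnorm w ^ 2 := by
          refine mul_le_mul_of_nonneg_right (mul_le_mul_of_nonneg_right ?_ (sq_nonneg _))
            (sq_nonneg _)
          have : (0 : ℝ) ≤ h₀ := Nat.cast_nonneg _
          nlinarith
      _ = (B' * e * vnorm w) ^ 2 := by rw [hB']; ring
  have hdist' : d < spaceDist (colSpace (A j)) (colSpace (A i)) := by
    fin_cases i <;> fin_cases j <;> simp at hij ⊢
    · rw [spaceDist_comm]; exact hdist
    · exact hdist
  have hrel : ∀ w, (firstCols (k i) (V i))ᵀ *ᵥ w = 0 →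
      vnorm ((A i)ᵀ *ᵥ w) ≤ (B * K / c * (e / q i)) * a i * vnorm w := by
    intro w hw
    have := (hR i j hij).vnorm_transpose_le' (X := 0) (hV i) rfl hK hc he.le hn le_rfl le_rfl (hq i)
      (hA i) (hA j) (hqn j) (by simp) w hw
    simpa [hB] using this
  have hsm : (k i + 1) * (B * K / c * (e / q i)) ≤ d / 2 := by
    have h1 : e / q i ≤ d / 2 / Y := by rw [div_le_iff₀ (hq i)]; exact her i
    have h2 : ((k i : ℝ) + 1) ≤ k 0 + k 1 + 1 := by
      fin_cases i <;> simp
    calc (k i + 1) * (B * K / c * (e / q i)) ≤ (k 0 + k 1 + 1) * (B * K / c * (e / q i)) :=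
          mul_le_mul_of_nonneg_right h2 (by have := hq i; positivity)
      _ = Y * (e / q i) := by rw [hY]; ring
      _ ≤ Y * (d / 2 / Y) := mul_le_mul_of_nonneg_left h1 hY0.le
      _ = d / 2 := by field_simp
  obtain ⟨w, hw, hw0, hwA⟩ := exists_trailing_of_lt_spaceDist (hk i) (hk j) (hV i) (hA i).pos
    (hA j).pos hd (by have := hq i; positivity) (hA i).lower (hA j).lower hrel hdist' hsm
  exact (hS i j hij).contamination_le hK hc hd he hn hB0 hB'0 (hq j) (hA i) (hA j) (hqn j)
    hw0 (htrail i w hw) (hSw w hw) hwA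

end Perturbation


/-! ### A covariance inequality for strongly mixing σ-fields -/

section Covariance

variable {Ω : Type*} {𝓕 𝓖 mΩ : MeasurableSpace Ω} {μ : Measure Ω} [IsProbabilityMeasure μ]

/-- With `D` the centred conditional expectation of `Y`, the covariance is the integral of `X * D`,
at most `M` times the integral of `|D|`. As `D` has mean zero, that integral is twice the one over
`{D ≥ 0}`. This replaces one variable by an indicator. -/
lemma exists_set_covariance_le (h𝓕 : 𝓕 ≤ mΩ) {X Y : Ω → ℝ} {M : ℝ}
    (hX : Measurable[𝓕] X) (hXM : ∀ ω, |X ω| ≤ M) (hY : Integrable Y μ) :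
    ∃ E, MeasurableSet[𝓕] E ∧ |∫ ω, X ω * Y ω ∂μ - (∫ ω, X ω ∂μ) * ∫ ω, Y ω ∂μ| ≤
      2 * M * |∫ ω in E, Y ω ∂μ - μ.real E * ∫ ω, Y ω ∂μ| := by
  set c := ∫ ω, Y ω ∂μ
  set D : Ω → ℝ := fun ω => (μ[Y|𝓕]) ω - c
  have hD : Integrable D μ := integrable_condExp.sub (integrable_const _)
  have hXm : AEStronglyMeasurable X μ := (hX.mono h𝓕 le_rfl).aestronglyMeasurable
  have hbd : ∀ᵐ ω ∂μ, ‖X ω‖ ≤ M := Eventually.of_forall hXM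
  have hXY : Integrable (X * Y) μ := hY.bdd_mul hXm hbd
  have hXi : Integrable X μ := Integrable.of_bound hXm M hbd
  have hXD : Integrable (fun ω => X ω * D ω) μ := hD.bdd_mul hXm hbd
  have h1 : ∫ ω, X ω * Y ω ∂μ - (∫ ω, X ω ∂μ) * c = ∫ ω, X ω * D ω ∂μ := by
    have h2 : ∫ ω, X ω * Y ω ∂μ = ∫ ω, X ω * (μ[Y|𝓕]) ω ∂μ := by
      rw [← integral_condExp h𝓕]
      exact integral_congr_ae (condExp_mul_of_stronglyMeasurable_left hX.stronglyMeasurable hXY hY)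
    have h3 : Integrable (fun ω => X ω * (μ[Y|𝓕]) ω) μ := integrable_condExp.bdd_mul hXm hbd
    rw [h2, ← integral_mul_const, ← integral_sub h3 (hXi.mul_const c)]
    exact integral_congr_ae (Eventually.of_forall fun ω => by simp only [D]; ring)
  have hDm : Measurable[𝓕] D := stronglyMeasurable_condExp.measurable.sub_const c
  set E : Set Ω := {ω | 0 ≤ D ω}
  have hE : MeasurableSet[𝓕] E := measurableSet_le measurable_const hDm
  refine ⟨E, hE, ?_⟩
  have hED : ∫ ω in E, D ω ∂μ = ∫ ω in E, Y ω ∂μ - μ.real E * c := by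
    rw [integral_sub integrable_condExp.integrableOn (integrable_const _).integrableOn,
      setIntegral_condExp h𝓕 hY hE, setIntegral_const, smul_eq_mul]
  have hD0 : ∫ ω, D ω ∂μ = 0 := by
    rw [integral_sub integrable_condExp (integrable_const _), integral_condExp h𝓕]
    simp [c]
  have hsplit := integral_add_compl (h𝓕 _ hE) hD
  have habs : ∫ ω, |D ω| ∂μ = 2 * ∫ ω in E, D ω ∂μ := by
    rw [← integral_add_compl (h𝓕 _ hE) hD.abs]
    have h2 : ∫ ω in E, |D ω| ∂μ = ∫ ω in E, D ω ∂μ :=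
      setIntegral_congr_fun (h𝓕 _ hE) fun ω hω => abs_of_nonneg hω
    have h3 : ∫ ω in Eᶜ, |D ω| ∂μ = - ∫ ω in Eᶜ, D ω ∂μ := by
      rw [← integral_neg]
      exact setIntegral_congr_fun (h𝓕 _ hE).compl fun ω hω => abs_of_neg (not_le.1 hω)
    rw [h2, h3]; linarith
  have hM : 0 ≤ M := by
    obtain ⟨ω⟩ : Nonempty Ω := μ.nonempty_of_neZero
    exact (abs_nonneg _).trans (hXM ω)
  rw [h1, ← hED]
  calc |∫ ω, X ω * D ω ∂μ| ≤ ∫ ω, |X ω * D ω| ∂μ := abs_integral_le_integral_abs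
    _ ≤ ∫ ω, M * |D ω| ∂μ := by
        refine integral_mono hXD.abs (hD.abs.const_mul M) fun ω => ?_
        simp only [abs_mul]
        exact mul_le_mul_of_nonneg_right (hXM ω) (abs_nonneg _)
    _ = 2 * M * ∫ ω in E, D ω ∂μ := by rw [integral_const_mul, habs]; ring
    _ ≤ 2 * M * |∫ ω in E, D ω ∂μ| := mul_le_mul_of_nonneg_left (le_abs_self _) (by linarith)

/-- The reduction to an indicator is applied twice, first to `X` and then to `Y` against the
indicator just obtained. What remains is the covariance of two events. -/
lemma covariance_le_of_bounded (h𝓕 : 𝓕 ≤ mΩ) (h𝓖 : 𝓖 ≤ mΩ) {α : ℝ}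
    (hα : ∀ E F, MeasurableSet[𝓕] E → MeasurableSet[𝓖] F →
      |μ.real (E ∩ F) - μ.real E * μ.real F| ≤ α) {X Y : Ω → ℝ} {M : ℝ}
    (hX : Measurable[𝓕] X) (hXM : ∀ ω, |X ω| ≤ M) (hY : Measurable[𝓖] Y) (hYM : ∀ ω, |Y ω| ≤ M) :
    |∫ ω, X ω * Y ω ∂μ - (∫ ω, X ω ∂μ) * ∫ ω, Y ω ∂μ| ≤ 4 * M ^ 2 * α := by
  have hM : 0 ≤ M := by
    obtain ⟨ω⟩ : Nonempty Ω := μ.nonempty_of_neZero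
    exact (abs_nonneg _).trans (hXM ω)
  have hYi : Integrable Y μ := Integrable.of_bound (hY.mono h𝓖 le_rfl).aestronglyMeasurable M
    (Eventually.of_forall hYM)
  obtain ⟨E, hE, h1⟩ := exists_set_covariance_le h𝓕 hX hXM hYi
  have hIi : Integrable (E.indicator fun _ => (1 : ℝ)) μ := (integrable_const 1).indicator (h𝓕 _ hE)
  obtain ⟨F, hF, h2⟩ := exists_set_covariance_le h𝓖 hY hYM hIi
  have h3 : ∫ ω, E.indicator (fun _ => (1 : ℝ)) ω ∂μ = μ.real E := by
    rw [integral_indicator (h𝓕 _ hE)]; simp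
  have h4 : ∫ ω in F, E.indicator (fun _ => (1 : ℝ)) ω ∂μ = μ.real (E ∩ F) := by
    rw [setIntegral_indicator (h𝓕 _ hE)]; simp [Set.inter_comm]
  have h5 : ∫ ω, Y ω * E.indicator (fun _ => (1 : ℝ)) ω ∂μ = ∫ ω in E, Y ω ∂μ := by
    rw [← integral_indicator (h𝓕 _ hE)]
    refine integral_congr_ae (Eventually.of_forall fun ω => ?_)
    by_cases hω : ω ∈ E <;> simp [hω]
  rw [h3, h4, h5] at h2
  have h6 := hα E F hE hF
  calc _ ≤ 2 * M * |∫ ω in E, Y ω ∂μ - μ.real E * ∫ ω, Y ω ∂μ| := h1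
    _ ≤ 2 * M * (2 * M * |μ.real (E ∩ F) - μ.real F * μ.real E|) := by
        rw [mul_comm (μ.real E)]
        exact mul_le_mul_of_nonneg_left h2 (by linarith)
    _ ≤ 2 * M * (2 * M * α) := by
        rw [mul_comm (μ.real F)]
        exact mul_le_mul_of_nonneg_left (mul_le_mul_of_nonneg_left h6 (by linarith)) (by linarith)
    _ = 4 * M ^ 2 * α := by ring

/-- Truncation at the levels `±M`. -/
def trunc (M x : ℝ) : ℝ := max (-M) (min x M)

lemma measurable_trunc (M : ℝ) : Measurable (trunc M) := by unfold trunc; fun_prop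

lemma abs_trunc_le {M : ℝ} (hM : 0 ≤ M) (x : ℝ) : |trunc M x| ≤ M :=
  abs_le.2 ⟨le_max_left _ _, max_le (by linarith) (min_le_right _ _)⟩

lemma abs_trunc_le_abs {M : ℝ} (hM : 0 ≤ M) (x : ℝ) : |trunc M x| ≤ |x| := by
  unfold trunc
  refine abs_le.2 ⟨?_, max_le ?_ ((min_le_left _ _).trans (le_abs_self x))⟩
  · rcases le_total x M with h | h
    · rw [min_eq_left h]; exact (neg_abs_le x).trans (le_max_right _ _)
    · rw [min_eq_right h]; exact le_max_of_le_right (by linarith [abs_nonneg x])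
  · linarith [abs_nonneg x]

/-- The difference vanishes unless `|x| > M`, and there `|x|` is traded for a higher power at the
price of a negative power of `M`. -/
lemma abs_sub_trunc_le {M ζ : ℝ} (hM : 0 < M) (hζ : 1 ≤ ζ) (x : ℝ) :
    |x - trunc M x| ≤ M ^ (-(ζ - 1)) * |x| ^ ζ := by
  rcases le_or_gt |x| M with h | h
  · have h' := abs_le.1 h
    rw [trunc, min_eq_left h'.2, max_eq_right h'.1, sub_self, abs_zero]
    positivity
  · have hx : 0 < |x| := hM.trans h
    have h1 : |x - trunc M x| ≤ |x| := by
      unfold trunc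
      rcases lt_abs.1 h with h2 | h2
      · rw [min_eq_right h2.le, max_eq_right (by linarith), abs_of_pos (by linarith : 0 < x - M)]
        linarith [le_abs_self x]
      · rw [min_eq_left (by linarith), max_eq_left (by linarith), abs_of_neg (by linarith)]
        linarith [neg_le_abs x]
    calc |x - trunc M x| ≤ |x| := h1
      _ = |x| ^ (-(ζ - 1)) * |x| ^ ζ := by
        rw [← Real.rpow_add hx]; simp
      _ ≤ M ^ (-(ζ - 1)) * |x| ^ ζ := by
        refine mul_le_mul_of_nonneg_right ?_ (by positivity)
        exact Real.rpow_le_rpow_of_nonpos hM h.le (by linarith)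

lemma rpow_le_one_add_rpow {x a b : ℝ} (hx : 0 ≤ x) (ha : 0 ≤ a) (hab : a ≤ b) :
    x ^ a ≤ 1 + x ^ b := by
  rcases le_total x 1 with h | h
  · exact (Real.rpow_le_one hx h ha).trans (by linarith [Real.rpow_nonneg hx b])
  · linarith [Real.rpow_le_rpow_of_exponent_le h hab]

/-- The covariance is split into that of the two truncated variables, controlled by mixing, and two
covariances containing a truncation remainder, controlled by the moments. The level `M` is left free
for optimisation. -/
lemma covariance_le_truncation (h𝓕 : 𝓕 ≤ mΩ) (h𝓖 : 𝓖 ≤ mΩ) {α : ℝ}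
    (hα : ∀ E F, MeasurableSet[𝓕] E → MeasurableSet[𝓖] F →
      |μ.real (E ∩ F) - μ.real E * μ.real F| ≤ α) {X Y : Ω → ℝ} {ζ κ M : ℝ} (hζ : 1 ≤ ζ)
    (hX : Measurable[𝓕] X) (hY : Measurable[𝓖] Y)
    (hXi : Integrable (fun ω => |X ω| ^ (2 * ζ)) μ) (hXκ : ∫ ω, |X ω| ^ (2 * ζ) ∂μ ≤ κ)
    (hYi : Integrable (fun ω => |Y ω| ^ (2 * ζ)) μ) (hYκ : ∫ ω, |Y ω| ^ (2 * ζ) ∂μ ≤ κ)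
    (hM : 0 < M) :
    |∫ ω, X ω * Y ω ∂μ - (∫ ω, X ω ∂μ) * ∫ ω, Y ω ∂μ| ≤
      4 * M ^ 2 * α + 4 * (1 + κ) ^ 2 * M ^ (-(ζ - 1)) := by
  set ψ := M ^ (-(ζ - 1)) with hψ
  have hψ0 : 0 ≤ ψ := by positivity
  have hsq : ∀ x : ℝ, (|x| ^ ζ) ^ 2 = |x| ^ (2 * ζ) := fun x => by
    rw [← Real.rpow_natCast, ← Real.rpow_mul (abs_nonneg x)]; norm_num [mul_comm]
  have hXm := hX.mono h𝓕 le_rfl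
  have hYm := hY.mono h𝓖 le_rfl
  have hκ : 0 ≤ κ := (integral_nonneg fun ω => by positivity).trans hXκ
  -- integrability of a product dominated by the moments
  have key : ∀ {X Y U V : Ω → ℝ}, Measurable X → Measurable Y → Measurable U → Measurable V →
      Integrable (fun ω => |X ω| ^ (2 * ζ)) μ → ∫ ω, |X ω| ^ (2 * ζ) ∂μ ≤ κ →
      Integrable (fun ω => |Y ω| ^ (2 * ζ)) μ → ∫ ω, |Y ω| ^ (2 * ζ) ∂μ ≤ κ →
      (∀ ω, |U ω| ≤ ψ * |X ω| ^ ζ) → (∀ ω, |V ω| ≤ |Y ω|) →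
      |∫ ω, U ω * V ω ∂μ - (∫ ω, U ω ∂μ) * ∫ ω, V ω ∂μ| ≤ 2 * (1 + κ) ^ 2 * ψ := by
    intro X Y U V hX hY hU hV hXi hXκ hYi hYκ hUX hVY
    have hdX : Integrable (fun ω => ψ * (1 + |X ω| ^ (2 * ζ))) μ :=
      ((integrable_const 1).add hXi).const_mul ψ
    have hdY : Integrable (fun ω => 1 + |Y ω| ^ (2 * ζ)) μ := (integrable_const 1).add hYi
    have hdXY : Integrable (fun ω => ψ * (1 + |X ω| ^ (2 * ζ) + |Y ω| ^ (2 * ζ))) μ :=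
      (((integrable_const 1).add hXi).add hYi).const_mul ψ
    have e1 : |∫ ω, U ω ∂μ| ≤ ψ * (1 + κ) := by
      refine abs_integral_le_integral_abs.trans ((integral_mono_of_nonneg
        (Eventually.of_forall fun ω => abs_nonneg _) hdX (Eventually.of_forall fun ω => ?_)).trans ?_)
      · exact (hUX ω).trans (mul_le_mul_of_nonneg_left
          (rpow_le_one_add_rpow (abs_nonneg _) (by linarith) (by linarith)) hψ0)
      · rw [integral_const_mul, integral_add (integrable_const 1) hXi]
        simp only [integral_const, probReal_univ, smul_eq_mul, mul_one]
        exact mul_le_mul_of_nonneg_left (by linarith) hψ0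
    have e2 : |∫ ω, V ω ∂μ| ≤ 1 + κ := by
      refine abs_integral_le_integral_abs.trans ((integral_mono_of_nonneg
        (Eventually.of_forall fun ω => abs_nonneg _) hdY (Eventually.of_forall fun ω => ?_)).trans ?_)
      · have := rpow_le_one_add_rpow (abs_nonneg (Y ω)) zero_le_one (by linarith : 1 ≤ 2 * ζ)
        rw [Real.rpow_one] at this
        exact (hVY ω).trans this
      · rw [integral_add (integrable_const 1) hYi]
        simp only [integral_const, probReal_univ, smul_eq_mul, mul_one]
        linarith
    have e3 : |∫ ω, U ω * V ω ∂μ| ≤ ψ * (1 + κ + κ) := by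
      refine abs_integral_le_integral_abs.trans ((integral_mono_of_nonneg
        (Eventually.of_forall fun ω => abs_nonneg _) hdXY
          (Eventually.of_forall fun ω => ?_)).trans ?_)
      · simp only [abs_mul]
        have h1 : |U ω| * |V ω| ≤ ψ * |X ω| ^ ζ * |Y ω| :=
          mul_le_mul (hUX ω) (hVY ω) (abs_nonneg _) (by positivity)
        have h2 := rpow_le_one_add_rpow (abs_nonneg (Y ω)) zero_le_two (by linarith : 2 ≤ 2 * ζ)
        rw [Real.rpow_two] at h2
        have h3 : |X ω| ^ ζ * |Y ω| ≤ 1 + |X ω| ^ (2 * ζ) + |Y ω| ^ (2 * ζ) := by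
          rw [← hsq (X ω)]
          nlinarith [sq_nonneg (|X ω| ^ ζ - |Y ω|)]
        calc _ ≤ ψ * (|X ω| ^ ζ * |Y ω|) := by linarith
          _ ≤ _ := mul_le_mul_of_nonneg_left h3 hψ0
      · have hdX1 : Integrable (fun ω => 1 + |X ω| ^ (2 * ζ)) μ := (integrable_const 1).add hXi
        rw [integral_const_mul, integral_add hdX1 hYi, integral_add (integrable_const 1) hXi]
        simp only [integral_const, probReal_univ, smul_eq_mul, mul_one]
        exact mul_le_mul_of_nonneg_left (by linarith) hψ0
    calc |∫ ω, U ω * V ω ∂μ - (∫ ω, U ω ∂μ) * ∫ ω, V ω ∂μ|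
        ≤ |∫ ω, U ω * V ω ∂μ| + |(∫ ω, U ω ∂μ) * ∫ ω, V ω ∂μ| := abs_sub _ _
      _ ≤ ψ * (1 + κ + κ) + ψ * (1 + κ) * (1 + κ) := by
          rw [abs_mul]
          exact add_le_add e3 (mul_le_mul e1 e2 (abs_nonneg _) (by positivity))
      _ ≤ 2 * (1 + κ) ^ 2 * ψ := by nlinarith [mul_nonneg hψ0 (sq_nonneg κ)]
  -- the three parts of the covariance
  set X₁ : Ω → ℝ := fun ω => trunc M (X ω)
  set Y₁ : Ω → ℝ := fun ω => trunc M (Y ω)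
  have hX₁ : Measurable[𝓕] X₁ := (measurable_trunc M).comp hX
  have hY₁ : Measurable[𝓖] Y₁ := (measurable_trunc M).comp hY
  have hX₁m := hX₁.mono h𝓕 le_rfl
  have hY₁m := hY₁.mono h𝓖 le_rfl
  have c1 := covariance_le_of_bounded h𝓕 h𝓖 hα hX₁ (fun ω => abs_trunc_le hM.le (X ω)) hY₁
    (fun ω => abs_trunc_le hM.le (Y ω))
  have c2 := key (X := X) (Y := Y) (U := fun ω => X ω - X₁ ω) (V := Y) hXm hYm (hXm.sub hX₁m) hYm
    hXi hXκ hYi hYκ (fun ω => abs_sub_trunc_le hM hζ (X ω)) (fun ω => le_rfl)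
  have c3 := key (X := Y) (Y := X) (U := fun ω => Y ω - Y₁ ω) (V := X₁) hYm hXm (hYm.sub hY₁m) hX₁m
    hYi hYκ hXi hXκ (fun ω => abs_sub_trunc_le hM hζ (Y ω)) (fun ω => abs_trunc_le_abs hM.le (X ω))
  have hX2 : MemLp X 2 μ := by
    rw [memLp_two_iff_integrable_sq hXm.aestronglyMeasurable]
    refine ((integrable_const 1).add hXi).mono' (hXm.pow_const 2).aestronglyMeasurable
      (Eventually.of_forall fun ω => ?_)
    have := rpow_le_one_add_rpow (abs_nonneg (X ω)) zero_le_two (by linarith : 2 ≤ 2 * ζ)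
    rw [Real.rpow_two, sq_abs] at this
    simpa using this
  have hY2 : MemLp Y 2 μ := by
    rw [memLp_two_iff_integrable_sq hYm.aestronglyMeasurable]
    refine ((integrable_const 1).add hYi).mono' (hYm.pow_const 2).aestronglyMeasurable
      (Eventually.of_forall fun ω => ?_)
    have := rpow_le_one_add_rpow (abs_nonneg (Y ω)) zero_le_two (by linarith : 2 ≤ 2 * ζ)
    rw [Real.rpow_two, sq_abs] at this
    simpa using this
  have hX₁2 : MemLp X₁ 2 μ := MemLp.of_bound hX₁m.aestronglyMeasurable M
    (Eventually.of_forall fun ω => abs_trunc_le hM.le (X ω))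
  have hY₁2 : MemLp Y₁ 2 μ := MemLp.of_bound hY₁m.aestronglyMeasurable M
    (Eventually.of_forall fun ω => abs_trunc_le hM.le (Y ω))
  have i1 : Integrable (fun ω => X ω * Y ω) μ := hX2.integrable_mul hY2
  have i2 : Integrable (fun ω => X₁ ω * Y ω) μ := hX₁2.integrable_mul hY2
  have i3 : Integrable (fun ω => X₁ ω * Y₁ ω) μ := hX₁2.integrable_mul hY₁2
  have j1 := hX2.integrable one_le_two
  have j2 := hY2.integrable one_le_two
  have j3 := hX₁2.integrable one_le_two
  have j4 := hY₁2.integrable one_le_two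
  have d2 : ∫ ω, (X ω - X₁ ω) * Y ω ∂μ = ∫ ω, X ω * Y ω ∂μ - ∫ ω, X₁ ω * Y ω ∂μ := by
    rw [← integral_sub i1 i2]
    exact integral_congr_ae (Eventually.of_forall fun ω => by ring)
  have d3 : ∫ ω, (Y ω - Y₁ ω) * X₁ ω ∂μ = ∫ ω, X₁ ω * Y ω ∂μ - ∫ ω, X₁ ω * Y₁ ω ∂μ := by
    rw [← integral_sub i2 i3]
    exact integral_congr_ae (Eventually.of_forall fun ω => by ring)
  rw [d2, integral_sub j1 j3] at c2
  rw [d3, integral_sub j2 j4] at c3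
  rw [abs_le] at c1 c2 c3 ⊢
  constructor <;> nlinarith [c1.1, c1.2, c2.1, c2.2, c3.1, c3.2]

/-- Davydov's covariance inequality, for variables with `2ζ` moments. -/
lemma covariance_le_rpow (h𝓕 : 𝓕 ≤ mΩ) (h𝓖 : 𝓖 ≤ mΩ) {α : ℝ}
    (hα : ∀ E F, MeasurableSet[𝓕] E → MeasurableSet[𝓖] F →
      |μ.real (E ∩ F) - μ.real E * μ.real F| ≤ α) (hα1 : α ≤ 1) {X Y : Ω → ℝ} {ζ κ : ℝ}
    (hζ : 2 < ζ) (hX : Measurable[𝓕] X) (hY : Measurable[𝓖] Y)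
    (hXi : Integrable (fun ω => |X ω| ^ (2 * ζ)) μ) (hXκ : ∫ ω, |X ω| ^ (2 * ζ) ∂μ ≤ κ)
    (hYi : Integrable (fun ω => |Y ω| ^ (2 * ζ)) μ) (hYκ : ∫ ω, |Y ω| ^ (2 * ζ) ∂μ ≤ κ) :
    |∫ ω, X ω * Y ω ∂μ - (∫ ω, X ω ∂μ) * ∫ ω, Y ω ∂μ| ≤
      (4 + 4 * (1 + κ) ^ 2) * α ^ (1 - 2 / ζ) := by
  have hα0 : 0 ≤ α := (abs_nonneg _).trans (hα ∅ ∅ (@MeasurableSet.empty _ 𝓕) (@MeasurableSet.empty _ 𝓖))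
  have hθ : 0 < 1 - 2 / ζ := by
    rw [sub_pos, div_lt_one (by linarith)]; exact hζ
  have hpos : ∀ β : ℝ, α ≤ β → 0 < β → β ≤ 1 →
      |∫ ω, X ω * Y ω ∂μ - (∫ ω, X ω ∂μ) * ∫ ω, Y ω ∂μ| ≤
        (4 + 4 * (1 + κ) ^ 2) * β ^ (1 - 2 / ζ) := by
    intro β hαβ hβ hβ1
    -- The level `M = β ^ (-1 / ζ)` turns `M ^ 2 * β` into exactly `β ^ (1 - 2 / ζ)` and the
    -- remainder into `β ^ (1 - 1 / ζ)`, which is smaller because `β ≤ 1`.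
    have hM : 0 < β ^ (-1 / ζ) := Real.rpow_pos_of_pos hβ _
    have h1 := covariance_le_truncation h𝓕 h𝓖 (fun E F hE hF => (hα E F hE hF).trans hαβ)
      (by linarith) hX hY hXi hXκ hYi hYκ hM
    have h2 : (β ^ (-1 / ζ)) ^ 2 * β = β ^ (1 - 2 / ζ) := by
      rw [← Real.rpow_natCast, ← Real.rpow_mul hβ.le]
      nth_rw 2 [← Real.rpow_one β]
      rw [← Real.rpow_add hβ]
      congr 1; push_cast; ring
    have h3 : (β ^ (-1 / ζ)) ^ (-(ζ - 1)) ≤ β ^ (1 - 2 / ζ) := by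
      rw [← Real.rpow_mul hβ.le]
      refine Real.rpow_le_rpow_of_exponent_ge hβ hβ1 ?_
      have : -1 / ζ * -(ζ - 1) = 1 - 1 / ζ := by field_simp
      rw [this]
      have : 1 / ζ ≤ 2 / ζ := div_le_div_of_nonneg_right (by norm_num) (by linarith)
      linarith
    calc _ ≤ _ := h1
      _ = 4 * ((β ^ (-1 / ζ)) ^ 2 * β) + 4 * (1 + κ) ^ 2 * (β ^ (-1 / ζ)) ^ (-(ζ - 1)) := by ring
      _ ≤ 4 * β ^ (1 - 2 / ζ) + 4 * (1 + κ) ^ 2 * β ^ (1 - 2 / ζ) := by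
          rw [h2]
          exact add_le_add le_rfl (mul_le_mul_of_nonneg_left h3 (by positivity))
      _ = _ := by ring
  rcases hα0.eq_or_lt with h0 | h0
  -- For `α = 0` the level would be infinite, so the bound for positive `β` is taken to the limit `β
  -- → 0`; the exponent is positive as `ζ > 2`.
  · have hlim : Tendsto (fun β : ℝ => (4 + 4 * (1 + κ) ^ 2) * β ^ (1 - 2 / ζ)) (𝓝[>] 0)
        (𝓝 ((4 + 4 * (1 + κ) ^ 2) * (0 : ℝ) ^ (1 - 2 / ζ))) :=
      (((Real.continuousAt_rpow_const 0 _ (Or.inr hθ.le)).tendsto).mono_left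
        nhdsWithin_le_nhds).const_mul _
    rw [← h0]
    refine ge_of_tendsto hlim ?_
    filter_upwards [Ioo_mem_nhdsGT (zero_lt_one' ℝ)] with β hβ
    exact hpos β (by rw [← h0]; exact hβ.1.le) hβ.1 hβ.2.le
  · exact hpos α le_rfl h0 hα1

end Covariance


/-! ### A maximal law of large numbers for weakly dependent variables -/

section LLN

variable {Ω : Type*} [MeasurableSpace Ω] {μ : Measure Ω}

/-- Markov's inequality for the second moment. -/
lemma measure_lt_abs_le [IsFiniteMeasure μ] {X : Ω → ℝ} {b s : ℝ} (hX : Integrable (fun ω => X ω ^ 2) μ)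
    (hb : ∫ ω, X ω ^ 2 ∂μ ≤ b) (hs : 0 < s) :
    μ {ω | s < |X ω|} ≤ ENNReal.ofReal (b / s ^ 2) := by
  have h1 := mul_meas_ge_le_integral_of_nonneg (μ := μ) (f := fun ω => X ω ^ 2)
    (Eventually.of_forall fun ω => sq_nonneg _) hX (s ^ 2)
  have h2 : μ.real {ω | s ^ 2 ≤ X ω ^ 2} ≤ b / s ^ 2 := by
    rw [le_div_iff₀ (by positivity), mul_comm]; exact h1.trans hb
  calc μ {ω | s < |X ω|} ≤ μ {ω | s ^ 2 ≤ X ω ^ 2} := measure_mono fun ω (hω : s < |X ω|) => by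
        rw [Set.mem_ofPred_eq, ← sq_abs (X ω)]
        exact pow_le_pow_left₀ hs.le hω.le 2
    _ = ENNReal.ofReal (μ.real {ω | s ^ 2 ≤ X ω ^ 2}) := (ofReal_measureReal).symm
    _ ≤ _ := ENNReal.ofReal_le_ofReal h2

/-- The second moment of a sum of weakly correlated variables. -/
lemma integral_sum_sq_le {X : ℕ → Ω → ℝ} {ρ : ℕ → ℝ} (hX : ∀ i, MemLp (X i) 2 μ)
    (hρ0 : ∀ d, 0 ≤ ρ d) (hρ : Summable ρ)
    (hcov : ∀ i j, |∫ ω, X i ω * X j ω ∂μ| ≤ ρ ((max i j) - (min i j))) (N : ℕ) :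
    ∫ ω, (∑ i ∈ Finset.range N, X i ω) ^ 2 ∂μ ≤ N * (2 * ∑' d, ρ d) := by
  have hint : ∀ i j, Integrable (fun ω => X i ω * X j ω) μ := fun i j => (hX i).integrable_mul (hX j)
  have h1 : ∫ ω, (∑ i ∈ Finset.range N, X i ω) ^ 2 ∂μ =
      ∑ i ∈ Finset.range N, ∑ j ∈ Finset.range N, ∫ ω, X i ω * X j ω ∂μ := by
    simp_rw [sq, Finset.sum_mul_sum]
    rw [integral_finsetSum _ fun i _ => integrable_finsetSum _ fun j _ => hint i j]
    exact Finset.sum_congr rfl fun i _ => integral_finsetSum _ fun j _ => hint i j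
  rw [h1]
  -- For fixed `i` every lag occurs at most once to the left and once to the right, hence the factor
  -- two.
  have h2 : ∀ i ∈ Finset.range N, ∑ j ∈ Finset.range N, ∫ ω, X i ω * X j ω ∂μ ≤ 2 * ∑' d, ρ d := by
    intro i hi
    have h3 : ∑ j ∈ Finset.range N, ∫ ω, X i ω * X j ω ∂μ ≤
        ∑ j ∈ Finset.range N, ((if j ≤ i then ρ (i - j) else 0) + if i ≤ j then ρ (j - i) else 0) := by
      refine Finset.sum_le_sum fun j _ => ((le_abs_self _).trans (hcov i j)).trans ?_
      rcases le_total i j with h | h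
      · rw [max_eq_right h, min_eq_left h, if_pos h]
        have : 0 ≤ if j ≤ i then ρ (i - j) else 0 := by split_ifs; exacts [hρ0 _, le_rfl]
        linarith
      · rw [max_eq_left h, min_eq_right h, if_pos h]
        have : 0 ≤ if i ≤ j then ρ (j - i) else 0 := by split_ifs; exacts [hρ0 _, le_rfl]
        linarith
    refine h3.trans ?_
    rw [Finset.sum_add_distrib, two_mul]
    refine add_le_add ?_ ?_
    · rw [← Finset.sum_filter, ← Finset.sum_image (f := ρ) (g := fun j => i - j)]
      · exact hρ.sum_le_tsum _ fun d _ => hρ0 d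
      · intro a ha b hb hab
        simp only [Finset.coe_filter, Set.mem_ofPred_eq] at ha hb hab
        omega
    · rw [← Finset.sum_filter, ← Finset.sum_image (f := ρ) (g := fun j => j - i)]
      · exact hρ.sum_le_tsum _ fun d _ => hρ0 d
      · intro a ha b hb hab
        simp only [Finset.coe_filter, Set.mem_ofPred_eq] at ha hb hab
        omega
  calc _ ≤ ∑ _i ∈ Finset.range N, 2 * ∑' d, ρ d := Finset.sum_le_sum h2
    _ = _ := by rw [Finset.sum_const, Finset.card_range, nsmul_eq_mul]

lemma integral_sum_abs_sq_le {X : ℕ → Ω → ℝ} {K : ℝ} (hX : ∀ i, MemLp (X i) 2 μ)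
    (hK : ∀ i, ∫ ω, X i ω ^ 2 ∂μ ≤ K) (s : Finset ℕ) :
    ∫ ω, (∑ i ∈ s, |X i ω|) ^ 2 ∂μ ≤ (s.card : ℝ) ^ 2 * K := by
  have h1 : ∫ ω, (∑ i ∈ s, |X i ω|) ^ 2 ∂μ ≤ ∫ ω, s.card * ∑ i ∈ s, X i ω ^ 2 ∂μ := by
    refine integral_mono_of_nonneg (Eventually.of_forall fun ω => sq_nonneg _)
      ((integrable_finsetSum _ fun i _ => (hX i).integrable_sq).const_mul _)
      (Eventually.of_forall fun ω => ?_)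
    simpa using sq_sum_le_card_mul_sum_sq (s := s) (f := fun i => |X i ω|)
  refine h1.trans ?_
  rw [integral_const_mul, integral_finsetSum _ fun i _ => (hX i).integrable_sq, sq, mul_assoc]
  refine mul_le_mul_of_nonneg_left ?_ (Nat.cast_nonneg _)
  calc _ ≤ ∑ _i ∈ s, K := Finset.sum_le_sum fun i _ => hK i
    _ = _ := by rw [Finset.sum_const, nsmul_eq_mul]

/-- Partial sums of centred, weakly correlated variables are at most `κ N + C` simultaneously for
all `N`, up to a small probability. -/
lemma exists_maximal_bound [IsProbabilityMeasure μ] {ρ : ℕ → ℝ} (hρ0 : ∀ d, 0 ≤ ρ d) (hρ : Summable ρ) {κ ε : ℝ}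
    (hκ : 0 < κ) (hε : 0 < ε) :
    ∃ C : ℝ, 0 ≤ C ∧ ∀ X : ℕ → Ω → ℝ, (∀ i, MemLp (X i) 2 μ) →
      (∀ i j, |∫ ω, X i ω * X j ω ∂μ| ≤ ρ ((max i j) - (min i j))) →
      μ {ω | ∃ N : ℕ, κ * N + C < |∑ i ∈ Finset.range N, X i ω|} ≤ ENNReal.ofReal ε := by
  set R := 2 * ∑' d, ρ d with hR
  have hR0 : 0 ≤ R := mul_nonneg zero_le_two (tsum_nonneg hρ0)
  -- Chebyshev at the threshold `κ / 2 * j ^ 2`: the sum up to `j ^ 2` has second moment at most `R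
  -- * j ^ 2`, and the absolute sum over the `2 * j + 1 ≤ 3 * j` terms up to the next square at most
  -- `9 * j ^ 2 * ρ 0`. Both probabilities are of the summable order `j ^ (-2)`.
  set D := (R + 9 * ρ 0) * 4 / κ ^ 2 with hD
  have hD0 : 0 ≤ D := by have := hρ0 0; positivity
  have hsum : Summable fun j : ℕ => D * (1 / (j : ℝ) ^ 2) :=
    (Real.summable_one_div_nat_pow.2 one_lt_two).mul_left D
  obtain ⟨J, hJ0, hJ⟩ : ∃ J : ℕ, 0 < J ∧ ∑' j, D * (1 / ((j + J : ℕ) : ℝ) ^ 2) < ε / 2 := by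
    have := (tendsto_order.1 (tendsto_sum_nat_add fun j : ℕ => D * (1 / (j : ℝ) ^ 2))).2 (ε / 2)
      (by linarith)
    obtain ⟨J, hJ⟩ := (this.and (eventually_gt_atTop 0)).exists
    exact ⟨J, hJ.2, hJ.1⟩
  -- Chebyshev for the absolute sum of the first `J ^ 2` terms, at probability `ε / 2`; the `+ 1`
  -- keeps `C` positive.
  set C := Real.sqrt (2 * (J ^ 2 : ℕ) ^ 2 * (ρ 0 + 1) / ε) with hC
  have hC0 : 0 < C := Real.sqrt_pos.2 (by have := hρ0 0; positivity)
  refine ⟨C, hC0.le, fun X hX hcov => ?_⟩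
  have hsq : ∀ i, ∫ ω, X i ω ^ 2 ∂μ ≤ ρ 0 := fun i => by
    have := (le_abs_self _).trans (hcov i i)
    simpa [sq] using this
  set A : ℕ → Set Ω := fun j => {ω | κ / 2 * (j : ℝ) ^ 2 < |∑ i ∈ Finset.range (j ^ 2), X i ω|}
  set B : ℕ → Set Ω := fun j =>
    {ω | κ / 2 * (j : ℝ) ^ 2 < |∑ i ∈ Finset.Ico (j ^ 2) ((j + 1) ^ 2), (|X i ω|)|}
  set E : Set Ω := {ω | C < |∑ i ∈ Finset.range (J ^ 2), (|X i ω|)|}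
  have hA : ∀ j : ℕ, 0 < j → μ (A j) ≤ ENNReal.ofReal (R * 4 / κ ^ 2 * (1 / (j : ℝ) ^ 2)) := by
    intro j hj
    have hj' : (0 : ℝ) < j := by exact_mod_cast hj
    have hm : MemLp (fun ω => ∑ i ∈ Finset.range (j ^ 2), X i ω) 2 μ :=
      memLp_finsetSum _ fun i _ => hX i
    refine (measure_lt_abs_le hm.integrable_sq (integral_sum_sq_le hX hρ0 hρ hcov _)
      (by positivity)).trans (ENNReal.ofReal_le_ofReal (le_of_eq ?_))
    rw [← hR]; push_cast; field_simp; ring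
  have hB : ∀ j : ℕ, 0 < j → μ (B j) ≤ ENNReal.ofReal (9 * ρ 0 * 4 / κ ^ 2 * (1 / (j : ℝ) ^ 2)) := by
    intro j hj
    have hj' : (1 : ℝ) ≤ j := by exact_mod_cast hj
    have hm : MemLp (fun ω => ∑ i ∈ Finset.Ico (j ^ 2) ((j + 1) ^ 2), |X i ω|) 2 μ :=
      memLp_finsetSum _ fun i _ => (hX i).abs
    refine (measure_lt_abs_le hm.integrable_sq (integral_sum_abs_sq_le hX hsq _)
      (by positivity)).trans (ENNReal.ofReal_le_ofReal ?_)
    have hcard : ((Finset.Ico (j ^ 2) ((j + 1) ^ 2)).card : ℝ) = 2 * j + 1 := by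
      rw [Nat.card_Ico, show (j + 1) ^ 2 - j ^ 2 = 2 * j + 1 by
        rw [Nat.sub_eq_iff_eq_add (Nat.pow_le_pow_left (by omega) 2)]; ring]
      push_cast; ring
    rw [hcard]
    have h1 : (2 * (j : ℝ) + 1) ^ 2 ≤ 9 * (j : ℝ) ^ 2 := by nlinarith
    calc (2 * (j : ℝ) + 1) ^ 2 * ρ 0 / (κ / 2 * (j : ℝ) ^ 2) ^ 2
        ≤ 9 * (j : ℝ) ^ 2 * ρ 0 / (κ / 2 * (j : ℝ) ^ 2) ^ 2 := by
          refine div_le_div_of_nonneg_right (mul_le_mul_of_nonneg_right h1 (hρ0 0)) (by positivity)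
      _ = _ := by field_simp; ring
  have hE : μ E ≤ ENNReal.ofReal (ε / 2) := by
    have hm : MemLp (fun ω => ∑ i ∈ Finset.range (J ^ 2), |X i ω|) 2 μ :=
      memLp_finsetSum _ fun i _ => (hX i).abs
    refine (measure_lt_abs_le hm.integrable_sq (integral_sum_abs_sq_le hX hsq _)
      hC0).trans (ENNReal.ofReal_le_ofReal ?_)
    have h0 := hρ0 0
    rw [hC, Real.sq_sqrt (by positivity), Finset.card_range, div_le_iff₀ (by positivity)]
    have : ε / 2 * (2 * ((J ^ 2 : ℕ) : ℝ) ^ 2 * (ρ 0 + 1) / ε) = ((J ^ 2 : ℕ) : ℝ) ^ 2 * (ρ 0 + 1) := by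
      field_simp
    rw [this]
    exact mul_le_mul_of_nonneg_left (by linarith) (by positivity)
  have hcover : {ω | ∃ N : ℕ, κ * N + C < |∑ i ∈ Finset.range N, X i ω|} ⊆
      (⋃ j, (A (j + J) ∪ B (j + J))) ∪ E := by
    rintro ω ⟨N, hN⟩
    by_contra hcon
    simp only [Set.mem_union, Set.mem_iUnion, not_or, not_exists] at hcon
    obtain ⟨hAB, hEn⟩ := hcon
    -- Before `J ^ 2` the constant `C` suffices. Afterwards `N` lies between two consecutive
    -- squares, and the sum up to the lower square and the remaining block use up half of the slope
    -- each.
    rcases lt_or_ge N (J ^ 2) with hNJ | hNJ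
    · refine hEn ?_
      have h1 : |∑ i ∈ Finset.range N, X i ω| ≤ ∑ i ∈ Finset.range (J ^ 2), |X i ω| :=
        (Finset.abs_sum_le_sum_abs _ _).trans (Finset.sum_le_sum_of_subset_of_nonneg
          (Finset.range_mono hNJ.le) fun i _ _ => abs_nonneg _)
      have h2 : 0 ≤ κ * (N : ℝ) := by positivity
      exact (lt_of_lt_of_le (by linarith) h1).trans_le (le_abs_self _)
    · obtain ⟨i, hi⟩ : ∃ i, Nat.sqrt N = i + J :=
        ⟨Nat.sqrt N - J, (Nat.sub_add_cancel (Nat.le_sqrt'.2 hNJ)).symm⟩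
      have hlow : (i + J) ^ 2 ≤ N := by rw [← hi]; exact Nat.sqrt_le' N
      have hupp : N < (i + J + 1) ^ 2 := by rw [← hi]; exact Nat.lt_succ_sqrt' N
      have hAi : |∑ l ∈ Finset.range ((i + J) ^ 2), X l ω| ≤ κ / 2 * ((i + J : ℕ) : ℝ) ^ 2 :=
        not_lt.1 (hAB i).1
      have hBi : |∑ l ∈ Finset.Ico ((i + J) ^ 2) ((i + J + 1) ^ 2), (|X l ω|)| ≤
        κ / 2 * ((i + J : ℕ) : ℝ) ^ 2 := not_lt.1 (hAB i).2
      have h1 : ∑ l ∈ Finset.range N, X l ω = ∑ l ∈ Finset.range ((i + J) ^ 2), X l ω +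
          ∑ l ∈ Finset.Ico ((i + J) ^ 2) N, X l ω := by
        rw [Finset.sum_range_add_sum_Ico _ hlow]
      have h2 : |∑ l ∈ Finset.Ico ((i + J) ^ 2) N, X l ω| ≤
          ∑ l ∈ Finset.Ico ((i + J) ^ 2) ((i + J + 1) ^ 2), |X l ω| :=
        (Finset.abs_sum_le_sum_abs _ _).trans (Finset.sum_le_sum_of_subset_of_nonneg
          (Finset.Ico_subset_Ico le_rfl hupp.le) fun i _ _ => abs_nonneg _)
      have h3 : ((i + J : ℕ) : ℝ) ^ 2 ≤ N := by exact_mod_cast hlow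
      have h4 := abs_add_le (∑ l ∈ Finset.range ((i + J) ^ 2), X l ω)
        (∑ l ∈ Finset.Ico ((i + J) ^ 2) N, X l ω)
      rw [← h1] at h4
      have h5 := (le_abs_self _).trans hBi
      have h6 : κ * ((i + J : ℕ) : ℝ) ^ 2 ≤ κ * N := mul_le_mul_of_nonneg_left h3 hκ.le
      linarith
  calc μ {ω | ∃ N : ℕ, κ * N + C < |∑ i ∈ Finset.range N, X i ω|}
      ≤ μ (⋃ j, (A (j + J) ∪ B (j + J))) + μ E := (measure_mono hcover).trans (measure_union_le _ _)
    _ ≤ ∑' j, μ (A (j + J) ∪ B (j + J)) + μ E := by gcongr; exact measure_iUnion_le _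
    _ ≤ ∑' j, ENNReal.ofReal (D * (1 / ((j + J : ℕ) : ℝ) ^ 2)) + ENNReal.ofReal (ε / 2) := by
        refine add_le_add (ENNReal.tsum_le_tsum fun j => ?_) hE
        refine (measure_union_le _ _).trans ((add_le_add (hA _ (by omega)) (hB _ (by omega))).trans ?_)
        rw [← ENNReal.ofReal_add (by positivity) (by have := hρ0 0; positivity)]
        refine ENNReal.ofReal_le_ofReal (le_of_eq ?_)
        rw [hD]; ring
    _ = ENNReal.ofReal (∑' j, D * (1 / ((j + J : ℕ) : ℝ) ^ 2)) + ENNReal.ofReal (ε / 2) := by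
        rw [ENNReal.ofReal_tsum_of_nonneg (fun j => by positivity)
          ((summable_nat_add_iff J).2 hsum)]
    _ ≤ ENNReal.ofReal (ε / 2) + ENNReal.ofReal (ε / 2) := by
        gcongr
    _ = ENNReal.ofReal ε := by
        rw [← ENNReal.ofReal_add (by linarith) (by linarith), add_halves]

end LLN


/-! ### Partial sums of functions of a strongly mixing process -/

section Mixing

variable {Ω : Type*} {k : Fin 2 → ℕ} {x : ∀ i, ℤ → Ω → Fin (k i) → ℝ}

lemma measurable_sigmaX (x : ∀ i, ℤ → Ω → Fin (k i) → ℝ) {T : Set ℤ} {t : ℤ} (ht : t ∈ T)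
    (i : Fin 2) : Measurable[sigmaX x T] (x i t) :=
  (comap_measurable (x i t)).mono
    (le_iSup₂_of_le (f := fun t (_ : t ∈ T) => ⨆ i, MeasurableSpace.comap (x i t) inferInstance)
      t ht (le_iSup (fun i => MeasurableSpace.comap (x i t) inferInstance) i)) le_rfl

lemma sigmaX_mono {T T' : Set ℤ} (h : T ⊆ T') : sigmaX x T ≤ sigmaX x T' :=
  biSup_mono h

variable [mΩ : MeasurableSpace Ω] {μ : Measure Ω}

lemma sigmaX_le (hx : ∀ i t, Measurable (x i t)) (T : Set ℤ) : sigmaX x T ≤ mΩ :=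
  iSup₂_le fun t _ => iSup_le fun i => (hx i t).comap_le

/-- A bound for the autocovariances of functions of the factor process at the times
`t, …, t + h`. -/
def covBound (μ : Measure Ω) (x : ∀ i, ℤ → Ω → Fin (k i) → ℝ) (ζ κ₀ : ℝ) (h d : ℕ) : ℝ :=
  (4 + 4 * (1 + κ₀) ^ 2) * if d ≤ h then 1 else alphaMix μ x (d - h) ^ (1 - 2 / ζ)

lemma summable_covBound {ζ : ℝ}
    (h_mixing : Summable fun t : ℕ => alphaMix μ x (t + 1) ^ (1 - 2 / ζ)) (κ₀ : ℝ) (h : ℕ) :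
    Summable (covBound μ x ζ κ₀ h) := by
  refine (summable_nat_add_iff (h + 1)).1 ((h_mixing.mul_left (4 + 4 * (1 + κ₀) ^ 2)).congr ?_)
  intro d
  rw [covBound, if_neg (by omega), show d + (h + 1) - h = d + 1 by omega]

variable [IsProbabilityMeasure μ]

lemma abs_measureReal_inter_sub_le (E F : Set Ω) :
    |μ.real (E ∩ F) - μ.real E * μ.real F| ≤ 1 := by
  have h1 : μ.real (E ∩ F) ≤ 1 := measureReal_le_one
  have h2 : μ.real E ≤ 1 := measureReal_le_one
  have h3 : μ.real F ≤ 1 := measureReal_le_one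
  have h4 : 0 ≤ μ.real (E ∩ F) := measureReal_nonneg
  have h5 : 0 ≤ μ.real E := measureReal_nonneg
  have h6 : 0 ≤ μ.real F := measureReal_nonneg
  rw [abs_le]
  constructor <;> nlinarith

lemma alphaMix_set_bdd (x : ∀ i, ℤ → Ω → Fin (k i) → ℝ) (t : ℕ) :
    BddAbove {r : ℝ | ∃ (j : ℤ) (E F : Set Ω),
      MeasurableSet[sigmaX x (Set.Iic j)] E ∧ MeasurableSet[sigmaX x (Set.Ici (j + t))] F ∧
        r = |μ.real (E ∩ F) - μ.real E * μ.real F|} := by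
  refine ⟨1, ?_⟩
  rintro r ⟨j, E, F, -, -, rfl⟩
  exact abs_measureReal_inter_sub_le E F

lemma abs_le_alphaMix (x : ∀ i, ℤ → Ω → Fin (k i) → ℝ) (t : ℕ) (j : ℤ) (E F : Set Ω)
    (hE : MeasurableSet[sigmaX x (Set.Iic j)] E)
    (hF : MeasurableSet[sigmaX x (Set.Ici (j + t))] F) :
    |μ.real (E ∩ F) - μ.real E * μ.real F| ≤ alphaMix μ x t :=
  le_csSup (alphaMix_set_bdd x t) ⟨j, E, F, hE, hF, rfl⟩

lemma alphaMix_nonneg (x : ∀ i, ℤ → Ω → Fin (k i) → ℝ) (t : ℕ) : 0 ≤ alphaMix μ x t :=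
  (abs_nonneg _).trans (abs_le_alphaMix (μ := μ) x t 0 ∅ ∅ (@MeasurableSet.empty _ (_))
    (@MeasurableSet.empty _ (_)))

lemma alphaMix_le_one (x : ∀ i, ℤ → Ω → Fin (k i) → ℝ) (t : ℕ) : alphaMix μ x t ≤ 1 := by
  refine csSup_le ⟨_, 0, ∅, ∅, @MeasurableSet.empty _ (_), @MeasurableSet.empty _ (_), rfl⟩ ?_
  rintro r ⟨j, E, F, -, -, rfl⟩
  exact abs_measureReal_inter_sub_le E F

lemma covBound_nonneg (x : ∀ i, ℤ → Ω → Fin (k i) → ℝ) (ζ κ₀ : ℝ) (h d : ℕ) :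
    0 ≤ covBound μ x ζ κ₀ h d := by
  have := Real.rpow_nonneg (alphaMix_nonneg (μ := μ) x (d - h)) (1 - 2 / ζ)
  unfold covBound
  split_ifs <;> positivity

variable {W : ℤ → Ω → ℝ} {ζ κ₀ : ℝ} {h : ℕ}

/-- `W s` depends on the factors up to `s + h` and `W t` on those from `t` on, so the gap between
the σ-fields is the lag minus `h`. For lags up to `h` the trivial mixing bound `1` is used. -/
lemma covariance_le_covBound (hx : ∀ i t, Measurable (x i t)) (hζ : 2 < ζ)
    (hW : ∀ t, Measurable[sigmaX x (Set.Icc t (t + h))] (W t))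
    (hWi : ∀ t, 1 ≤ t → Integrable (fun ω => |W t ω| ^ (2 * ζ)) μ ∧
      ∫ ω, |W t ω| ^ (2 * ζ) ∂μ ≤ κ₀) {s t : ℤ} (hs : 1 ≤ s) (hst : s ≤ t) :
    |∫ ω, W s ω * W t ω ∂μ - (∫ ω, W s ω ∂μ) * ∫ ω, W t ω ∂μ| ≤
      covBound μ x ζ κ₀ h (t - s).toNat := by
  have ht := hs.trans hst
  rw [covBound]
  split_ifs with hd
  · have := covariance_le_rpow (μ := μ) (𝓕 := mΩ) (𝓖 := mΩ) le_rfl le_rfl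
      (fun E F _ _ => abs_measureReal_inter_sub_le E F) le_rfl hζ
      ((hW s).mono (sigmaX_le hx _) le_rfl) ((hW t).mono (sigmaX_le hx _) le_rfl)
      (hWi s hs).1 (hWi s hs).2 (hWi t ht).1 (hWi t ht).2
    rwa [Real.one_rpow] at this
  · refine covariance_le_rpow (μ := μ) (sigmaX_le hx (Set.Iic (s + h)))
      (sigmaX_le hx (Set.Ici (s + h + ((t - s).toNat - h : ℕ))))
      (abs_le_alphaMix x _ _) (alphaMix_le_one x _) hζ
      ((hW s).mono (sigmaX_mono fun u hu => hu.2) le_rfl)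
      ((hW t).mono (sigmaX_mono fun u hu => ?_) le_rfl)
      (hWi s hs).1 (hWi s hs).2 (hWi t ht).1 (hWi t ht).2
    have := hu.1
    simp only [Set.mem_Ici]
    omega

lemma memLp_two_of_rpow {U : Ω → ℝ} (hU : Measurable U) (hζ : 2 < ζ)
    (hUi : Integrable (fun ω => |U ω| ^ (2 * ζ)) μ) : MemLp U 2 μ := by
  rw [memLp_two_iff_integrable_sq hU.aestronglyMeasurable]
  refine ((integrable_const 1).add hUi).mono' (hU.pow_const 2).aestronglyMeasurable
    (Eventually.of_forall fun ω => ?_)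
  have := rpow_le_one_add_rpow (abs_nonneg (U ω)) zero_le_two (by linarith : 2 ≤ 2 * ζ)
  rw [Real.rpow_two, sq_abs] at this
  simpa using this

lemma integral_abs_le_of_rpow {U : Ω → ℝ} (hζ : 2 < ζ)
    (hUi : Integrable (fun ω => |U ω| ^ (2 * ζ)) μ) (hκ : ∫ ω, |U ω| ^ (2 * ζ) ∂μ ≤ κ₀) :
    ∫ ω, |U ω| ∂μ ≤ 1 + κ₀ := by
  refine (integral_mono_of_nonneg (Eventually.of_forall fun ω => abs_nonneg _)
    ((integrable_const 1).add hUi) (Eventually.of_forall fun ω => ?_)).trans ?_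
  · have := rpow_le_one_add_rpow (abs_nonneg (U ω)) zero_le_one (by linarith : 1 ≤ 2 * ζ)
    rw [Real.rpow_one] at this
    exact this
  · simp only [Pi.add_apply]
    rw [integral_add (integrable_const 1) hUi]
    simp only [integral_const, probReal_univ, smul_eq_mul, mul_one]
    linarith

/-- The sign `s` lets the sums run forward or backward from `b`; the covariance bounds depend on
time differences only. The constant is chosen before `W`, `b` and `s`, so it serves all experiments.
-/
lemma exists_partial_sum_bound (hx : ∀ i t, Measurable (x i t)) (hζ : 2 < ζ)
    (h_mixing : Summable fun t : ℕ => alphaMix μ x (t + 1) ^ (1 - 2 / ζ)) (κ₀ : ℝ) (h : ℕ)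
    {κ ε : ℝ} (hκ : 0 < κ) (hε : 0 < ε) :
    ∃ C : ℝ, 0 ≤ C ∧ ∀ W : ℤ → Ω → ℝ,
      (∀ t, Measurable[sigmaX x (Set.Icc t (t + h))] (W t)) →
      (∀ t, 1 ≤ t → Integrable (fun ω => |W t ω| ^ (2 * ζ)) μ ∧
        ∫ ω, |W t ω| ^ (2 * ζ) ∂μ ≤ κ₀) →
      ∀ b s : ℤ, s = 1 ∨ s = -1 →
        μ {ω | ∃ N : ℕ, (∀ j < N, 1 ≤ b + s * j) ∧
          κ * N + C < |∑ j ∈ Finset.range N, (W (b + s * j) ω - ∫ ω, W (b + s * j) ω ∂μ)|} ≤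
            ENNReal.ofReal ε := by
  obtain ⟨C, hC, hmax⟩ := exists_maximal_bound (μ := μ) (covBound_nonneg (μ := μ) x ζ κ₀ h)
    (summable_covBound h_mixing κ₀ h) hκ hε
  refine ⟨C, hC, fun W hW hWi b s hs => ?_⟩
  have hWm : ∀ t, Measurable (W t) := fun t => (hW t).mono (sigmaX_le hx _) le_rfl
  have hW2 : ∀ t, 1 ≤ t → MemLp (W t) 2 μ := fun t ht =>
    memLp_two_of_rpow (hWm t) hζ (hWi t ht).1
  -- Moments are bounded only from time one on. Earlier summands are replaced by zero, and the
  -- admissible `N` never reach them.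
  set X : ℕ → Ω → ℝ := fun j ω =>
    if 1 ≤ b + s * j then W (b + s * j) ω - ∫ ω, W (b + s * j) ω ∂μ else 0 with hX
  have hcov : ∀ t t', 1 ≤ t → 1 ≤ t' →
      ∫ ω, (W t ω - ∫ ω, W t ω ∂μ) * (W t' ω - ∫ ω, W t' ω ∂μ) ∂μ =
        ∫ ω, W t ω * W t' ω ∂μ - (∫ ω, W t ω ∂μ) * ∫ ω, W t' ω ∂μ := by
    intro t t' ht ht'
    exact covariance_eq_sub (hW2 t ht) (hW2 t' ht')
  have hXc : ∀ i j, |∫ ω, X i ω * X j ω ∂μ| ≤ covBound μ x ζ κ₀ h (max i j - min i j) := by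
    have main : ∀ i j : ℕ, b + s * i ≤ b + s * j →
        |∫ ω, X i ω * X j ω ∂μ| ≤ covBound μ x ζ κ₀ h (max i j - min i j) := by
      intro i j hij
      by_cases hi : 1 ≤ b + s * i
      · have hj := hi.trans hij
        have e : ∫ ω, X i ω * X j ω ∂μ = ∫ ω, (W (b + s * i) ω - ∫ ω, W (b + s * i) ω ∂μ) *
            (W (b + s * j) ω - ∫ ω, W (b + s * j) ω ∂μ) ∂μ := by
          simp only [hX, if_pos hi, if_pos hj]
        rw [e, hcov _ _ hi hj]
        have := covariance_le_covBound hx hζ hW hWi hi hij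
        have hd : (b + s * j - (b + s * i)).toNat = max i j - min i j := by
          rcases hs with rfl | rfl <;> omega
        rwa [hd] at this
      · have e : ∫ ω, X i ω * X j ω ∂μ = 0 := by simp only [hX, if_neg hi]; simp
        rw [e, abs_zero]; exact covBound_nonneg x ζ κ₀ h _
    intro i j
    rcases le_total (b + s * i) (b + s * j) with hij | hij
    · exact main i j hij
    · rw [max_comm, min_comm]
      simp_rw [mul_comm (X i _)]
      exact main j i hij
  have hX2 : ∀ i, MemLp (X i) 2 μ := by
    intro i
    by_cases hi : 1 ≤ b + s * i
    · simp only [hX, if_pos hi]; exact (hW2 _ hi).sub (memLp_const _)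
    · simp only [hX, if_neg hi]; exact MemLp.zero
  refine (measure_mono ?_).trans (hmax X hX2 hXc)
  rintro ω ⟨N, hN, hlt⟩
  refine ⟨N, ?_⟩
  have e : ∑ j ∈ Finset.range N, X j ω =
      ∑ j ∈ Finset.range N, (W (b + s * j) ω - ∫ ω, W (b + s * j) ω ∂μ) :=
    Finset.sum_congr rfl fun j hj => if_pos (hN j (Finset.mem_range.1 hj))
  rw [e]
  exact hlt

lemma sum_Ioc_add (f : ℤ → ℝ) (b : ℤ) (N : ℕ) :
    ∑ t ∈ Finset.Ioc b (b + N), f t = ∑ j ∈ Finset.range N, f (b + 1 + 1 * j) := by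
  refine (Finset.sum_bij (fun (j : ℕ) _ => b + 1 + 1 * (j : ℤ)) ?_ ?_ ?_ fun _ _ => rfl).symm
  · intro j hj; simp only [Finset.mem_range, Finset.mem_Ioc] at *; omega
  · intro i _ j _ hij; omega
  · intro t ht
    simp only [Finset.mem_Ioc] at ht
    exact ⟨(t - b - 1).toNat, by simp only [Finset.mem_range]; omega, by omega⟩

lemma sum_Ioc_sub (f : ℤ → ℝ) (b : ℤ) (N : ℕ) :
    ∑ t ∈ Finset.Ioc (b - N) b, f t = ∑ j ∈ Finset.range N, f (b + -1 * j) := by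
  refine (Finset.sum_bij (fun (j : ℕ) _ => b + -1 * (j : ℤ)) ?_ ?_ ?_ fun _ _ => rfl).symm
  · intro j hj; simp only [Finset.mem_range, Finset.mem_Ioc] at *; omega
  · intro i _ j _ hij; omega
  · intro t ht
    simp only [Finset.mem_Ioc] at ht
    exact ⟨(b - t).toNat, by simp only [Finset.mem_range]; omega, by omega⟩

/-- The sum of `w` over `(l, u]` is close to that of `m`, and the absolute sum is of the order of
the length. -/
def IntervalBound (κ C : ℝ) (w m : ℤ → ℝ) (l u : ℤ) : Prop :=
  |∑ t ∈ Finset.Ioc l u, (w t - m t)| ≤ κ * (u - l).toNat + C ∧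
    ∑ t ∈ Finset.Ioc l u, |w t| ≤ C * ((u - l).toNat + 1)

lemma IntervalBound.mono {κ C C' : ℝ} {w m : ℤ → ℝ} {l u : ℤ} (h : IntervalBound κ C w m l u)
    (hC : C ≤ C') : IntervalBound κ C' w m l u :=
  ⟨h.1.trans (by linarith), h.2.trans (mul_le_mul_of_nonneg_right hC (by positivity))⟩

/-- Partial sums over intervals with one fixed endpoint are controlled simultaneously. -/
lemma exists_intervalBound (hx : ∀ i t, Measurable (x i t)) (hζ : 2 < ζ)
    (h_mixing : Summable fun t : ℕ => alphaMix μ x (t + 1) ^ (1 - 2 / ζ)) {κ₀ : ℝ}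
    (hκ₀ : 0 ≤ κ₀) (h : ℕ) {κ ε : ℝ} (hκ : 0 < κ) (hε : 0 < ε) :
    ∃ C : ℝ, 0 ≤ C ∧ ∀ W : ℤ → Ω → ℝ,
      (∀ t, Measurable[sigmaX x (Set.Icc t (t + h))] (W t)) →
      (∀ t, 1 ≤ t → Integrable (fun ω => |W t ω| ^ (2 * ζ)) μ ∧
        ∫ ω, |W t ω| ^ (2 * ζ) ∂μ ≤ κ₀) →
      (∀ b : ℤ, 0 ≤ b → μ {ω | ∃ u, ¬ IntervalBound κ C (fun t => W t ω)
        (fun t => ∫ ω, W t ω ∂μ) b u} ≤ ENNReal.ofReal ε) ∧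
      (∀ b : ℤ, μ {ω | ∃ l, 0 ≤ l ∧ ¬ IntervalBound κ C (fun t => W t ω)
        (fun t => ∫ ω, W t ω ∂μ) l b} ≤ ENNReal.ofReal ε) := by
  obtain ⟨C, hC, hmax⟩ := exists_partial_sum_bound (μ := μ) hx hζ h_mixing κ₀ h hκ
    (half_pos hε)
  have hCC : C ≤ C + κ + 1 + κ₀ := by linarith
  -- The absolute sum is its mean, at most `1 + κ₀` per term, plus a deviation with slope `κ` and
  -- constant `C`.
  refine ⟨C + κ + 1 + κ₀, by linarith, fun W hW hWi => ?_⟩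
  set W' : ℤ → Ω → ℝ := fun t ω => |W t ω|
  have hW' : ∀ t, Measurable[sigmaX x (Set.Icc t (t + h))] (W' t) := fun t => continuous_abs.measurable.comp (hW t)
  have hWi' : ∀ t, 1 ≤ t → Integrable (fun ω => |W' t ω| ^ (2 * ζ)) μ ∧
      ∫ ω, |W' t ω| ^ (2 * ζ) ∂μ ≤ κ₀ := fun t ht => by
    simpa only [W', abs_abs] using hWi t ht
  have both : ∀ b s : ℤ, s = 1 ∨ s = -1 → μ {ω | ∃ N : ℕ, (∀ j < N, 1 ≤ b + s * j) ∧
      ¬ (|∑ j ∈ Finset.range N, (W (b + s * j) ω - ∫ ω, W (b + s * j) ω ∂μ)| ≤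
          κ * N + (C + κ + 1 + κ₀) ∧
        ∑ j ∈ Finset.range N, |W (b + s * j) ω| ≤ (C + κ + 1 + κ₀) * (N + 1))} ≤
      ENNReal.ofReal ε := by
    intro b s hs
    have h1 := hmax W hW hWi b s hs
    have h2 := hmax W' hW' hWi' b s hs
    refine (measure_mono ?_).trans ((measure_union_le _ _).trans ((add_le_add h1 h2).trans ?_))
    · rintro ω ⟨N, hN, hnot⟩
      by_contra hcon
      simp only [Set.mem_union, not_or] at hcon
      refine hnot ⟨?_, ?_⟩
      · by_contra hlt
        exact hcon.1 ⟨N, hN, by linarith⟩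
      · have h3 : |∑ j ∈ Finset.range N, (W' (b + s * j) ω - ∫ ω, W' (b + s * j) ω ∂μ)| ≤
            κ * N + C := by
          by_contra hlt
          exact hcon.2 ⟨N, hN, not_le.1 hlt⟩
        have h4 : ∑ j ∈ Finset.range N, ∫ ω, W' (b + s * j) ω ∂μ ≤ N * (1 + κ₀) := by
          calc _ ≤ ∑ _j ∈ Finset.range N, (1 + κ₀) := Finset.sum_le_sum fun j hj =>
                integral_abs_le_of_rpow hζ (hWi _ (hN j (Finset.mem_range.1 hj))).1
                  (hWi _ (hN j (Finset.mem_range.1 hj))).2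
            _ = _ := by rw [Finset.sum_const, Finset.card_range, nsmul_eq_mul]
        rw [Finset.sum_sub_distrib] at h3
        have h5 := (le_abs_self _).trans h3
        have h6 : (0 : ℝ) ≤ N := Nat.cast_nonneg _
        calc ∑ j ∈ Finset.range N, |W (b + s * j) ω| ≤ κ * N + C + N * (1 + κ₀) := by linarith
          _ ≤ _ := by nlinarith
    · rw [← ENNReal.ofReal_add (by linarith) (by linarith), add_halves]
  constructor
  · intro b hb
    refine (measure_mono ?_).trans (both (b + 1) 1 (Or.inl rfl))
    rintro ω ⟨u, hu⟩
    refine ⟨(u - b).toNat, fun j _ => by omega, fun hcon => hu ?_⟩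
    rcases le_total b u with hbu | hbu
    · have e : u = b + (u - b).toNat := by omega
      rw [IntervalBound]
      conv_lhs => rw [e]
      conv_rhs => rw [e]
      rw [sum_Ioc_add, sum_Ioc_add, ← e]
      exact hcon
    · rw [IntervalBound, Finset.Ioc_eq_empty (by omega)]
      have : (u - b).toNat = 0 := by omega
      simp only [Finset.sum_empty, abs_zero, this, Nat.cast_zero, mul_zero, zero_add, mul_one]
      constructor <;> linarith
  · intro b
    refine (measure_mono ?_).trans (both b (-1) (Or.inr rfl))
    rintro ω ⟨l, hl, hu⟩
    refine ⟨(b - l).toNat, fun j _ => by omega, fun hcon => hu ?_⟩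
    rcases le_total l b with hbu | hbu
    · have e : l = b - (b - l).toNat := by omega
      rw [IntervalBound]
      conv_lhs => rw [e]
      conv_rhs => rw [e]
      rw [sum_Ioc_sub, sum_Ioc_sub, ← e]
      exact hcon
    · rw [IntervalBound, Finset.Ioc_eq_empty (by omega)]
      have : (b - l).toNat = 0 := by omega
      simp only [Finset.sum_empty, abs_zero, this, Nat.cast_zero, mul_zero, zero_add, mul_one]
      constructor <;> linarith

end Mixing


/-! ### A maximal inequality for transforms of white noise -/

section Noise

variable {Ω : Type*} {m mΩ : MeasurableSpace Ω} {μ : Measure Ω} [IsFiniteMeasure μ] {σ : ℝ}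

/-- The product of a square-integrable `m`-measurable variable and one of bounded conditional second
moment is square-integrable. -/
lemma memLp_mul_of_condExp_sq_le (hm : m ≤ mΩ) {f g : Ω → ℝ} (hf : Measurable[m] f)
    (hf2 : MemLp f 2 μ) (hg2 : MemLp g 2 μ)
    (hvar : μ[fun ω => g ω ^ 2 | m] ≤ᵐ[μ] fun _ => σ ^ 2) :
    MemLp (fun ω => f ω * g ω) 2 μ ∧ ∫ ω, (f ω * g ω) ^ 2 ∂μ ≤ σ ^ 2 * ∫ ω, f ω ^ 2 ∂μ := by
  have hgi := hg2.integrable_sq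
  have hfi := hf2.integrable_sq
  -- As long as `f * g` is not known to be square-integrable, `f ^ 2` cannot be pulled out of the
  -- conditional expectation. Truncation at `n` makes this legitimate, and Fatou's lemma removes the
  -- truncation.
  set F : ℕ → Ω → ℝ := fun n ω => min (f ω ^ 2) n
  have hF0 : ∀ n ω, 0 ≤ F n ω := fun n ω => le_min (sq_nonneg _) (Nat.cast_nonneg _)
  have hFm : ∀ n, Measurable[m] (F n) := fun n => (hf.pow_const 2).min measurable_const
  have hFm' : ∀ n, AEStronglyMeasurable (F n) μ := fun n =>
    ((hFm n).mono hm le_rfl).aestronglyMeasurable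
  have hFb : ∀ n, ∀ᵐ ω ∂μ, ‖F n ω‖ ≤ n := fun n => Eventually.of_forall fun ω => by
    rw [Real.norm_of_nonneg (hF0 n ω)]; exact min_le_right _ _
  have hFg : ∀ n, Integrable (fun ω => F n ω * g ω ^ 2) μ := fun n =>
    hgi.bdd_mul (hFm' n) (hFb n)
  have hFi : ∀ n, Integrable (F n) μ := fun n => Integrable.of_bound (hFm' n) n (hFb n)
  have hbound : ∀ n, ∫ ω, F n ω * g ω ^ 2 ∂μ ≤ σ ^ 2 * ∫ ω, f ω ^ 2 ∂μ := by
    intro n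
    have h1 : ∫ ω, F n ω * g ω ^ 2 ∂μ = ∫ ω, F n ω * (μ[fun ω => g ω ^ 2 | m]) ω ∂μ := by
      rw [← integral_condExp hm]
      exact integral_congr_ae (condExp_mul_of_stronglyMeasurable_left (hFm n).stronglyMeasurable
        (hFg n) hgi)
    have h2 : Integrable (fun ω => F n ω * (μ[fun ω => g ω ^ 2 | m]) ω) μ :=
      integrable_condExp.bdd_mul (hFm' n) (hFb n)
    rw [h1, ← integral_const_mul]
    refine integral_mono_ae h2 (hfi.const_mul _) ?_
    filter_upwards [hvar] with ω hω
    calc F n ω * (μ[fun ω => g ω ^ 2 | m]) ω ≤ F n ω * σ ^ 2 :=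
          mul_le_mul_of_nonneg_left hω (hF0 n ω)
      _ ≤ σ ^ 2 * f ω ^ 2 := by
          rw [mul_comm]
          exact mul_le_mul_of_nonneg_left (min_le_left _ _) (sq_nonneg _)
  have hfm := hf2.aestronglyMeasurable
  have hgm := hg2.aestronglyMeasurable
  have hle : ∫⁻ ω, ENNReal.ofReal ((f ω * g ω) ^ 2) ∂μ ≤
      ENNReal.ofReal (σ ^ 2 * ∫ ω, f ω ^ 2 ∂μ) := by
    have h1 : ∀ ω, ENNReal.ofReal ((f ω * g ω) ^ 2) =
        liminf (fun n => ENNReal.ofReal (F n ω * g ω ^ 2)) atTop := by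
      intro ω
      refine (Tendsto.liminf_eq ?_).symm
      refine tendsto_const_nhds.congr' ?_
      filter_upwards [tendsto_natCast_atTop_atTop.eventually_ge_atTop (f ω ^ 2)] with n hn
      simp only [F, min_eq_left hn, mul_pow]
    simp_rw [h1]
    refine (lintegral_liminf_le' fun n => ((hFg n).aemeasurable.ennreal_ofReal)).trans ?_
    refine liminf_le_of_le (by isBoundedDefault) fun b hb => ?_
    obtain ⟨n, hn⟩ := hb.exists
    refine hn.trans ?_
    rw [← ofReal_integral_eq_lintegral_ofReal (hFg n)
      (Eventually.of_forall fun ω => mul_nonneg (hF0 n ω) (sq_nonneg _))]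
    exact ENNReal.ofReal_le_ofReal (hbound n)
  have hint : Integrable (fun ω => (f ω * g ω) ^ 2) μ := by
    refine ⟨(hfm.mul hgm).pow 2, ?_⟩
    rw [hasFiniteIntegral_iff_ofReal (Eventually.of_forall fun ω => sq_nonneg _)]
    exact hle.trans_lt ENNReal.ofReal_lt_top
  refine ⟨(memLp_two_iff_integrable_sq (hfm.mul hgm)).2 hint, ?_⟩
  rw [← ofReal_integral_eq_lintegral_ofReal hint (Eventually.of_forall fun ω => sq_nonneg _)] at hle
  refine (ENNReal.ofReal_le_ofReal_iff ?_).1 hle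
  exact mul_nonneg (sq_nonneg _) (integral_nonneg fun ω => sq_nonneg _)

/-- Given `m`, the factor `f` is known and comes out of a vanishing conditional expectation. General
sets `s` serve the submartingale property, and `univ` gives uncorrelatedness. -/
lemma setIntegral_mul_eq_zero (hm : m ≤ mΩ) {f g : Ω → ℝ} (hf : Measurable[m] f)
    (hfg : Integrable (fun ω => f ω * g ω) μ) (hg : Integrable g μ) (hmean : μ[g | m] =ᵐ[μ] 0)
    {s : Set Ω} (hs : MeasurableSet[m] s) : ∫ ω in s, f ω * g ω ∂μ = 0 := by
  rw [← setIntegral_condExp hm hfg hs]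
  have h1 : μ[fun ω => f ω * g ω | m] =ᵐ[μ] 0 := by
    filter_upwards [condExp_mul_of_stronglyMeasurable_left hf.stronglyMeasurable hfg hg, hmean]
      with ω h1 h2
    have h3 : (μ[fun ω => f ω * g ω | m]) ω = f ω * (μ[g | m]) ω := h1
    rw [h3, h2, Pi.zero_apply, mul_zero]
  rw [setIntegral_congr_ae (hm _ hs) (h1.mono fun ω hω _ => hω)]
  simp

/-- Kolmogorov's maximal inequality for families of martingale transforms of white noise. -/
lemma measure_exists_sum_sq_lt_le {ι : Type*} [Fintype ι] (𝓕 : Filtration ℕ mΩ)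
    {f g : ℕ → ι → Ω → ℝ} (hf : ∀ j c, Measurable[𝓕 j] (f j c)) (hf2 : ∀ j c, MemLp (f j c) 2 μ)
    (hg : ∀ j c, Measurable[𝓕 (j + 1)] (g j c)) (hg2 : ∀ j c, MemLp (g j c) 2 μ)
    (hmean : ∀ j c, μ[g j c | 𝓕 j] =ᵐ[μ] 0)
    (hvar : ∀ j c, μ[fun ω => g j c ω ^ 2 | 𝓕 j] ≤ᵐ[μ] fun _ => σ ^ 2)
    {K : ℝ} (hK : ∀ j, ∑ c, ∫ ω, f j c ω ^ 2 ∂μ ≤ K) (n : ℕ) {l : ℝ} (hl : 0 < l) :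
    μ {ω | ∃ N ≤ n, l < ∑ c, (∑ j ∈ Finset.range N, f j c ω * g j c ω) ^ 2} ≤
      ENNReal.ofReal (n * (σ ^ 2 * K) / l) := by
  have hd : ∀ j c, MemLp (fun ω => f j c ω * g j c ω) 2 μ := fun j c =>
    (memLp_mul_of_condExp_sq_le (𝓕.le j) (hf j c) (hf2 j c) (hg2 j c) (hvar j c)).1
  set S : ℕ → ι → Ω → ℝ := fun N c ω => ∑ j ∈ Finset.range N, f j c ω * g j c ω with hS
  have hS2 : ∀ N c, MemLp (S N c) 2 μ := fun N c => memLp_finsetSum _ fun j _ => hd j c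
  have hSm : ∀ N c, Measurable[𝓕 N] (S N c) := fun N c =>
    Finset.measurable_sum _ fun j hj => by
      have hjN : j + 1 ≤ N := Finset.mem_range.1 hj
      exact ((hf j c).mono (𝓕.mono (by omega)) le_rfl).mul ((hg j c).mono (𝓕.mono hjN) le_rfl)
  set Y : ℕ → Ω → ℝ := fun N ω => ∑ c, S N c ω ^ 2 with hY
  have hYi : ∀ N, Integrable (Y N) μ := fun N =>
    integrable_finsetSum _ fun c _ => (hS2 N c).integrable_sq
  have hstep : ∀ N s, MeasurableSet[𝓕 N] s → ∫ ω in s, Y (N + 1) ω ∂μ =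
      ∫ ω in s, Y N ω ∂μ + ∑ c, ∫ ω in s, (f N c ω * g N c ω) ^ 2 ∂μ := by
    intro N s hs
    -- Expanding the squares: the increment of `Y` is a sum of squares plus cross terms, and the
    -- latter integrate to zero over every set known at time `N`.
    have e : ∀ ω, Y (N + 1) ω = Y N ω + (∑ c, (f N c ω * g N c ω) ^ 2 +
        2 * ∑ c, (S N c ω * f N c ω) * g N c ω) := by
      intro ω
      simp only [hY]
      rw [Finset.mul_sum, ← Finset.sum_add_distrib, ← Finset.sum_add_distrib]
      refine Finset.sum_congr rfl fun c _ => ?_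
      simp only [hS, Finset.sum_range_succ]
      ring
    have i1 : ∀ c, Integrable (fun ω => (S N c ω * f N c ω) * g N c ω) μ := fun c => by
      simp only [mul_assoc]
      exact (hS2 N c).integrable_mul (hd N c)
    have i2 : Integrable (fun ω => ∑ c, (f N c ω * g N c ω) ^ 2) μ :=
      integrable_finsetSum _ fun c _ => (hd N c).integrable_sq
    have i3 : Integrable (fun ω => 2 * ∑ c, (S N c ω * f N c ω) * g N c ω) μ :=
      (integrable_finsetSum _ fun c _ => i1 c).const_mul 2
    have i23 : Integrable (fun ω => ∑ c, (f N c ω * g N c ω) ^ 2 +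
        2 * ∑ c, (S N c ω * f N c ω) * g N c ω) μ := i2.add i3
    simp_rw [e]
    rw [integral_add (hYi N).integrableOn i23.integrableOn,
      integral_add i2.integrableOn i3.integrableOn, integral_const_mul,
      integral_finsetSum _ fun c _ => (i1 c).integrableOn,
      integral_finsetSum _ fun c _ => (hd N c).integrable_sq.integrableOn]
    have h0 : ∀ c, ∫ ω in s, (S N c ω * f N c ω) * g N c ω ∂μ = 0 := fun c =>
      setIntegral_mul_eq_zero (𝓕.le N) ((hSm N c).mul (hf N c)) (i1 c)
        ((hg2 N c).integrable one_le_two) (hmean N c) hs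
    simp [h0]
  have hsub : Submartingale Y 𝓕 μ := by
    refine submartingale_of_setIntegral_le_succ (fun N => ?_) hYi fun N s hs => ?_
    · exact (Finset.measurable_sum _ fun c _ => (hSm N c).pow_const 2).stronglyMeasurable
    · rw [hstep N s hs]
      exact le_add_of_nonneg_right (Finset.sum_nonneg fun c _ => integral_nonneg fun ω => sq_nonneg _)
  have hY0 : 0 ≤ Y := fun N ω => Finset.sum_nonneg fun c _ => sq_nonneg _
  have hYn : ∀ N : ℕ, ∫ ω, Y N ω ∂μ ≤ N * (σ ^ 2 * K) := by
    intro N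
    induction N with
    | zero => simp [hY, hS]
    | succ N ih =>
      have h1 := hstep N Set.univ MeasurableSet.univ
      simp only [setIntegral_univ] at h1
      have h2 : ∑ c, ∫ ω, (f N c ω * g N c ω) ^ 2 ∂μ ≤ σ ^ 2 * K := by
        calc _ ≤ ∑ c, σ ^ 2 * ∫ ω, f N c ω ^ 2 ∂μ := Finset.sum_le_sum fun c _ =>
              (memLp_mul_of_condExp_sq_le (𝓕.le N) (hf N c) (hf2 N c) (hg2 N c) (hvar N c)).2
          _ = σ ^ 2 * ∑ c, ∫ ω, f N c ω ^ 2 ∂μ := by rw [Finset.mul_sum]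
          _ ≤ _ := mul_le_mul_of_nonneg_left (hK N) (sq_nonneg _)
      rw [h1]; push_cast; linarith
  have hmax := maximal_ineq hsub hY0 (ε := l.toNNReal) n
  rw [Real.coe_toNNReal l hl.le] at hmax
  have hsubset : {ω | ∃ N ≤ n, l < Y N ω} ⊆ {ω | l ≤
      (Finset.range (n + 1)).sup' Finset.nonempty_range_add_one fun k => Y k ω} := by
    rintro ω ⟨N, hN, hlt⟩
    refine hlt.le.trans (Finset.le_sup' (fun k => Y k ω) (Finset.mem_range.2 (by omega)))
  have hle : ENNReal.ofReal l * μ {ω | ∃ N ≤ n, l < Y N ω} ≤ ENNReal.ofReal (n * (σ ^ 2 * K)) := by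
    have e : (l.toNNReal : ENNReal) = ENNReal.ofReal l := rfl
    rw [e] at hmax
    refine (mul_le_mul_right (measure_mono hsubset) _).trans (hmax.trans
      (ENNReal.ofReal_le_ofReal ((setIntegral_le_integral (hYi n)
        (Eventually.of_forall fun ω => hY0 n ω)).trans (hYn n))))
  rw [ENNReal.ofReal_div_of_pos hl, ENNReal.le_div_iff_mul_le (Or.inl (by simpa using hl))
    (Or.inl ENNReal.ofReal_ne_top), mul_comm]
  exact hle

end Noise


/-! ### Moments in the factor model -/

section Signal

variable {Ω : Type*} {k : Fin 2 → ℕ} {p r₀ : ℕ}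
  {x : ∀ i, ℤ → Ω → Fin (k i) → ℝ} {A : ∀ i, Matrix (Fin p) (Fin (k i)) ℝ}
  {ε : ℤ → Ω → Fin p → ℝ}

/-- The common component of the observations. -/
def signal (A : ∀ i, Matrix (Fin p) (Fin (k i)) ℝ) (x : ∀ i, ℤ → Ω → Fin (k i) → ℝ)
    (r₀ : ℕ) (t : ℤ) (ω : Ω) : Fin p → ℝ :=
  if t ≤ (r₀ : ℤ) then A 0 *ᵥ x 0 t ω else A 1 *ᵥ x 1 t ω

lemma obs_apply (t : ℤ) (ω : Ω) (a : Fin p) :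
    obs A x ε r₀ t ω a = signal A x r₀ t ω a + ε t ω a := by
  unfold obs signal
  split_ifs <;> rfl

lemma sigmaX_le_noisePast (T : Set ℤ) (t : ℤ) : sigmaX x T ≤ noisePast x ε t :=
  (sigmaX_mono (Set.subset_univ T)).trans le_sup_left

lemma measurable_noise_noisePast {s t : ℤ} (h : s < t) (a : Fin p) :
    Measurable[noisePast x ε t] fun ω => ε s ω a :=
  (measurable_pi_apply a).comp ((comap_measurable (ε s)).mono
    ((le_iSup₂_of_le (f := fun s (_ : s ∈ Set.Iio t) => MeasurableSpace.comap (ε s) inferInstance)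
      s h le_rfl).trans le_sup_right) le_rfl)

lemma measurable_signal {m : MeasurableSpace Ω} (hm : ∀ i t, Measurable[m] (x i t)) (t : ℤ)
    (a : Fin p) : Measurable[m] fun ω => signal A x r₀ t ω a := by
  have h : ∀ i, Measurable[m] fun ω => (A i *ᵥ x i t ω) a := fun i => by
    change Measurable[m] fun ω => ∑ j, A i a j * x i t ω j
    exact Finset.measurable_sum _ fun j _ => ((measurable_pi_apply j).comp (hm i t)).const_mul _
  unfold signal
  split_ifs
  exacts [h 0, h 1]

/-- The conditioning σ-field contains the whole factor process, so even future common components are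
known. This makes their products with earlier noise martingale differences. -/
lemma measurable_signal_noisePast (s t : ℤ) (a : Fin p) :
    Measurable[noisePast x ε t] fun ω => signal A x r₀ s ω a :=
  measurable_signal (fun i s => (measurable_sigmaX x (Set.mem_univ s) i).mono
    (sigmaX_le_noisePast _ t) le_rfl) s a

lemma measurable_obs_noisePast {s t : ℤ} (h : s < t) (a : Fin p) :
    Measurable[noisePast x ε t] fun ω => obs A x ε r₀ s ω a := by
  simp only [obs_apply]
  exact (measurable_signal_noisePast s t a).add (measurable_noise_noisePast h a)

lemma noisePast_mono {s t : ℤ} (h : s ≤ t) : noisePast x ε s ≤ noisePast x ε t :=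
  sup_le_sup_left (biSup_mono fun _ hu => lt_of_lt_of_le hu h) _

/-- The deviation of a product of observations from the product of the common components. -/
lemma obs_mul_obs (s t : ℤ) (ω : Ω) (a b : Fin p) :
    obs A x ε r₀ s ω a * obs A x ε r₀ t ω b = signal A x r₀ s ω a * signal A x r₀ t ω b +
      (obs A x ε r₀ s ω a * ε t ω b + signal A x r₀ t ω b * ε s ω a) := by
  simp only [obs_apply]; ring

end Signal

/-! ### Second moments of signal and observations, and the uniform bound for the noise terms. -/

section Moments

variable {Ω : Type*} [mΩ : MeasurableSpace Ω] {μ : Measure Ω} {k : Fin 2 → ℕ} {p r₀ : ℕ}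
  {x : ∀ i, ℤ → Ω → Fin (k i) → ℝ} {A : ∀ i, Matrix (Fin p) (Fin (k i)) ℝ}
  {ε : ℤ → Ω → Fin p → ℝ} {ζ σx σ : ℝ}

lemma IsWhiteNoise.noisePast_le (hε : IsWhiteNoise μ x ε σ) (hx : ∀ i t, Measurable (x i t))
    (t : ℤ) : noisePast x ε t ≤ mΩ :=
  sup_le (sigmaX_le hx _) (iSup₂_le fun s _ => (hε.measurable s).comap_le)

/-- Uniformly bounded moments of order `4ζ`, from time one on. -/
def MomentBound (μ : Measure Ω) (x : ∀ i, ℤ → Ω → Fin (k i) → ℝ) (ζ σx : ℝ) : Prop :=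
  ∀ i (j : Fin (k i)) (t : ℤ), 1 ≤ t → Integrable (fun ω => |x i t ω j| ^ (4 * ζ)) μ ∧
    ∫ ω, |x i t ω j| ^ (4 * ζ) ∂μ < σx ^ (4 * ζ)

/-- By the arithmetic-geometric mean inequality, moments of order `4ζ` of the factors give moments
of order `2ζ` of their products, as the covariance inequality requires. -/
lemma MomentBound.mul (hm : MomentBound μ x ζ σx) (hx : ∀ i t, Measurable (x i t))
    {i i' : Fin 2} (a : Fin (k i)) (b : Fin (k i')) {s t : ℤ} (hs : 1 ≤ s) (ht : 1 ≤ t) :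
    Integrable (fun ω => |x i s ω a * x i' t ω b| ^ (2 * ζ)) μ ∧
      ∫ ω, |x i s ω a * x i' t ω b| ^ (2 * ζ) ∂μ ≤ σx ^ (4 * ζ) := by
  have h1 := hm i a s hs
  have h2 := hm i' b t ht
  have hle : ∀ ω, |x i s ω a * x i' t ω b| ^ (2 * ζ) ≤
      (|x i s ω a| ^ (4 * ζ) + |x i' t ω b| ^ (4 * ζ)) / 2 := fun ω => by
    have e : ∀ y : ℝ, |y| ^ (4 * ζ) = (|y| ^ (2 * ζ)) ^ 2 := fun y => by
      rw [← Real.rpow_natCast, ← Real.rpow_mul (abs_nonneg y)]; norm_num; ring_nf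
    rw [abs_mul, Real.mul_rpow (abs_nonneg _) (abs_nonneg _), e, e]
    nlinarith [sq_nonneg (|x i s ω a| ^ (2 * ζ) - |x i' t ω b| ^ (2 * ζ))]
  have hi : Integrable (fun ω => (|x i s ω a| ^ (4 * ζ) + |x i' t ω b| ^ (4 * ζ)) / 2) μ :=
    (h1.1.add h2.1).div_const 2
  have hmeas : Measurable fun ω => |x i s ω a * x i' t ω b| ^ (2 * ζ) := by
    have ha : Measurable fun ω => x i s ω a := (measurable_pi_apply a).comp (hx i s)
    have hb : Measurable fun ω => x i' t ω b := (measurable_pi_apply b).comp (hx i' t)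
    fun_prop
  have hint : Integrable (fun ω => |x i s ω a * x i' t ω b| ^ (2 * ζ)) μ :=
    hi.mono' hmeas.aestronglyMeasurable (Eventually.of_forall fun ω => by
      rw [Real.norm_of_nonneg (by positivity)]; exact hle ω)
  refine ⟨hint, (integral_mono hint hi hle).trans ?_⟩
  rw [integral_div, integral_add h1.1 h2.1]
  linarith [h1.2, h2.2]

variable [IsProbabilityMeasure μ]

lemma integral_sq_le_of_rpow {U : Ω → ℝ} {ζ κ₀ : ℝ} (hζ : 2 < ζ)
    (hUi : Integrable (fun ω => |U ω| ^ (2 * ζ)) μ) (hκ : ∫ ω, |U ω| ^ (2 * ζ) ∂μ ≤ κ₀) :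
    ∫ ω, U ω ^ 2 ∂μ ≤ 1 + κ₀ := by
  refine (integral_mono_of_nonneg (Eventually.of_forall fun ω => sq_nonneg _)
    ((integrable_const 1).add hUi) (Eventually.of_forall fun ω => ?_)).trans ?_
  · have := rpow_le_one_add_rpow (abs_nonneg (U ω)) zero_le_two (by linarith : 2 ≤ 2 * ζ)
    rw [Real.rpow_two, sq_abs] at this
    exact this
  · simp only [Pi.add_apply]
    rw [integral_add (integrable_const 1) hUi]
    simp only [integral_const, probReal_univ, smul_eq_mul, mul_one]
    linarith

lemma MomentBound.memLp (hm : MomentBound μ x ζ σx) (hx : ∀ i t, Measurable (x i t)) (hζ : 2 < ζ)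
    (i : Fin 2) (j : Fin (k i)) {t : ℤ} (ht : 1 ≤ t) : MemLp (fun ω => x i t ω j) 2 μ := by
  refine memLp_two_of_rpow (ζ := 2 * ζ) ((measurable_pi_apply j).comp (hx i t)) (by linarith) ?_
  rw [show 2 * (2 * ζ) = 4 * ζ by ring]
  exact (hm i j t ht).1

lemma MomentBound.integral_sq_le (hm : MomentBound μ x ζ σx) (hζ : 2 < ζ)
    (i : Fin 2) (j : Fin (k i)) {t : ℤ} (ht : 1 ≤ t) :
    ∫ ω, x i t ω j ^ 2 ∂μ ≤ 1 + σx ^ (4 * ζ) := by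
  have := hm i j t ht
  rw [show 4 * ζ = 2 * (2 * ζ) by ring] at this ⊢
  exact integral_sq_le_of_rpow (by linarith) this.1 this.2.le

lemma signal_memLp (hm : MomentBound μ x ζ σx) (hx : ∀ i t, Measurable (x i t)) (hζ : 2 < ζ)
    {t : ℤ} (ht : 1 ≤ t) (a : Fin p) : MemLp (fun ω => signal A x r₀ t ω a) 2 μ := by
  have h : ∀ i, MemLp (fun ω => (A i *ᵥ x i t ω) a) 2 μ := fun i => by
    change MemLp (fun ω => ∑ j, A i a j * x i t ω j) 2 μ
    exact memLp_finsetSum _ fun j _ => (hm.memLp hx hζ i j ht).const_mul (A i a j)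
  unfold signal
  split_ifs
  exacts [h 0, h 1]

lemma obs_memLp (hm : MomentBound μ x ζ σx) (hx : ∀ i t, Measurable (x i t)) (hζ : 2 < ζ)
    (hε : IsWhiteNoise μ x ε σ) {t : ℤ} (ht : 1 ≤ t) (a : Fin p) :
    MemLp (fun ω => obs A x ε r₀ t ω a) 2 μ := by
  simp only [obs_apply]
  exact (signal_memLp hm hx hζ ht a).add (hε.memLp t a)

/-- The operator bound is applied to the whole vector at each realisation, so the total energy over
the coordinates is of order `B` instead of one such term per coordinate. The sum `k 0 + k 1` covers
either regime. -/
lemma sum_integral_signal_sq_le (hm : MomentBound μ x ζ σx) (hx : ∀ i t, Measurable (x i t))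
    (hζ : 2 < ζ) {L : Fin 2 → ℝ} {B : ℝ} (hB : 0 ≤ B) (hσx : 0 < σx)
    (hA : ∀ i v, vnorm (A i *ᵥ v) ≤ L i * vnorm v) (hL : ∀ i, L i ^ 2 ≤ B)
    {t : ℤ} (ht : 1 ≤ t) :
    ∑ a, ∫ ω, signal A x r₀ t ω a ^ 2 ∂μ ≤ B * ((k 0 + k 1) * (1 + σx ^ (4 * ζ))) := by
  have hσ : 0 ≤ 1 + σx ^ (4 * ζ) := by positivity
  have h : ∀ i, ∑ a, ∫ ω, (A i *ᵥ x i t ω) a ^ 2 ∂μ ≤ B * (k i * (1 + σx ^ (4 * ζ))) := by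
    intro i
    have h1 : ∀ a, MemLp (fun ω => (A i *ᵥ x i t ω) a) 2 μ := fun a => by
      change MemLp (fun ω => ∑ j, A i a j * x i t ω j) 2 μ
      exact memLp_finsetSum _ fun j _ => (hm.memLp hx hζ i j ht).const_mul (A i a j)
    have h2 : ∀ j, Integrable (fun ω => x i t ω j ^ 2) μ := fun j =>
      (hm.memLp hx hζ i j ht).integrable_sq
    rw [← integral_finsetSum _ fun a _ => (h1 a).integrable_sq]
    calc ∫ ω, ∑ a, (A i *ᵥ x i t ω) a ^ 2 ∂μ ≤ ∫ ω, B * ∑ j, x i t ω j ^ 2 ∂μ := by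
          refine integral_mono (integrable_finsetSum _ fun a _ => (h1 a).integrable_sq)
            ((integrable_finsetSum _ fun j _ => h2 j).const_mul B) fun ω => ?_
          simp only
          rw [← vnorm_sq_eq_sum, ← vnorm_sq_eq_sum]
          calc vnorm (A i *ᵥ x i t ω) ^ 2 ≤ (L i * vnorm (x i t ω)) ^ 2 :=
                pow_le_pow_left₀ (vnorm_nonneg _) (hA i _) 2
            _ = L i ^ 2 * vnorm (x i t ω) ^ 2 := by ring
            _ ≤ _ := mul_le_mul_of_nonneg_right (hL i) (sq_nonneg _)
      _ = B * ∑ j, ∫ ω, x i t ω j ^ 2 ∂μ := by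
          rw [integral_const_mul, integral_finsetSum _ fun j _ => h2 j]
      _ ≤ B * ∑ _j : Fin (k i), (1 + σx ^ (4 * ζ)) :=
          mul_le_mul_of_nonneg_left (Finset.sum_le_sum fun j _ => hm.integral_sq_le hζ i j ht) hB
      _ = _ := by rw [Finset.sum_const, Finset.card_univ, Fintype.card_fin, nsmul_eq_mul]
  have h0 : (0 : ℝ) ≤ k 0 := Nat.cast_nonneg _
  have h1 : (0 : ℝ) ≤ k 1 := Nat.cast_nonneg _
  unfold signal
  split_ifs
  · refine (h 0).trans (mul_le_mul_of_nonneg_left (mul_le_mul_of_nonneg_right ?_ hσ) hB)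
    linarith
  · refine (h 1).trans (mul_le_mul_of_nonneg_left (mul_le_mul_of_nonneg_right ?_ hσ) hB)
    linarith

lemma IsWhiteNoise.integral_sq_le (hε : IsWhiteNoise μ x ε σ) (hx : ∀ i t, Measurable (x i t))
    (t : ℤ) (a : Fin p) : ∫ ω, ε t ω a ^ 2 ∂μ ≤ σ ^ 2 := by
  rw [← integral_condExp (hε.noisePast_le hx t)]
  refine (integral_mono_ae integrable_condExp (integrable_const _) (hε.variance t a)).trans ?_
  simp

lemma sum_integral_obs_sq_le (hm : MomentBound μ x ζ σx) (hx : ∀ i t, Measurable (x i t))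
    (hζ : 2 < ζ) (hε : IsWhiteNoise μ x ε σ) {L : Fin 2 → ℝ} {B : ℝ} (hB : 0 ≤ B) (hσx : 0 < σx)
    (hA : ∀ i v, vnorm (A i *ᵥ v) ≤ L i * vnorm v) (hL : ∀ i, L i ^ 2 ≤ B)
    {t : ℤ} (ht : 1 ≤ t) :
    ∑ a, ∫ ω, obs A x ε r₀ t ω a ^ 2 ∂μ ≤
      2 * (B * ((k 0 + k 1) * (1 + σx ^ (4 * ζ)))) + 2 * (p * σ ^ 2) := by
  have h1 := sum_integral_signal_sq_le (r₀ := r₀) hm hx hζ hB hσx hA hL ht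
  have h2 : ∑ a, ∫ ω, ε t ω a ^ 2 ∂μ ≤ p * σ ^ 2 := by
    calc _ ≤ ∑ _a : Fin p, σ ^ 2 := Finset.sum_le_sum fun a _ => hε.integral_sq_le hx t a
      _ = _ := by rw [Finset.sum_const, Finset.card_univ, Fintype.card_fin, nsmul_eq_mul]
  have h3 : ∀ a, ∫ ω, obs A x ε r₀ t ω a ^ 2 ∂μ ≤
      2 * ∫ ω, signal A x r₀ t ω a ^ 2 ∂μ + 2 * ∫ ω, ε t ω a ^ 2 ∂μ := fun a => by
    have i1 := (signal_memLp (A := A) (r₀ := r₀) hm hx hζ ht a).integrable_sq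
    have i2 := (hε.memLp t a).integrable_sq
    rw [← integral_const_mul, ← integral_const_mul,
      ← integral_add (i1.const_mul 2) (i2.const_mul 2)]
    refine integral_mono (obs_memLp hm hx hζ hε ht a).integrable_sq
      ((i1.const_mul 2).add (i2.const_mul 2)) fun ω => ?_
    simp only [obs_apply]
    nlinarith [sq_nonneg (signal A x r₀ t ω a - ε t ω a)]
  calc _ ≤ ∑ a, (2 * ∫ ω, signal A x r₀ t ω a ^ 2 ∂μ + 2 * ∫ ω, ε t ω a ^ 2 ∂μ) :=
        Finset.sum_le_sum fun a _ => h3 a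
    _ = 2 * ∑ a, ∫ ω, signal A x r₀ t ω a ^ 2 ∂μ + 2 * ∑ a, ∫ ω, ε t ω a ^ 2 ∂μ := by
        rw [Finset.sum_add_distrib, Finset.mul_sum, Finset.mul_sum]
    _ ≤ _ := by linarith

/-- Lagged second moments of the observations are those of the common component. -/
lemma integral_obs_mul_obs (hm : MomentBound μ x ζ σx) (hx : ∀ i t, Measurable (x i t))
    (hζ : 2 < ζ) (hε : IsWhiteNoise μ x ε σ) {s t : ℤ} (hs : 1 ≤ s) (hst : s < t) (a b : Fin p) :
    ∫ ω, obs A x ε r₀ s ω a * obs A x ε r₀ t ω b ∂μ =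
      ∫ ω, signal A x r₀ s ω a * signal A x r₀ t ω b ∂μ := by
  have ht : 1 ≤ t := hs.trans hst.le
  have i1 : Integrable (fun ω => signal A x r₀ s ω a * signal A x r₀ t ω b) μ :=
    (signal_memLp hm hx hζ hs a).integrable_mul (signal_memLp hm hx hζ ht b)
  have i2 : Integrable (fun ω => obs A x ε r₀ s ω a * ε t ω b) μ :=
    (obs_memLp hm hx hζ hε hs a).integrable_mul (hε.memLp t b)
  have i3 : Integrable (fun ω => signal A x r₀ t ω b * ε s ω a) μ :=
    (signal_memLp hm hx hζ ht b).integrable_mul (hε.memLp s a)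
  have e2 := setIntegral_mul_eq_zero (hε.noisePast_le hx t) (measurable_obs_noisePast hst a) i2
    ((hε.memLp t b).integrable one_le_two) (hε.mean t b) MeasurableSet.univ
  have e3 := setIntegral_mul_eq_zero (hε.noisePast_le hx s) (measurable_signal_noisePast t s b) i3
    ((hε.memLp s a).integrable one_le_two) (hε.mean s a) MeasurableSet.univ
  rw [setIntegral_univ] at e2 e3
  have i23 : Integrable (fun ω => obs A x ε r₀ s ω a * ε t ω b +
    signal A x r₀ t ω b * ε s ω a) μ := i2.add i3
  simp_rw [obs_mul_obs]
  rw [integral_add i1 i23, integral_add i2 i3, e2, e3, add_zero, add_zero]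

/-- The noise contribution to the sample autocovariances, uniformly over initial stretches. -/
lemma exists_noise_bound (hm : MomentBound μ x ζ σx) (hx : ∀ i t, Measurable (x i t))
    (hζ : 2 < ζ) (hσx : 0 < σx) (B σ : ℝ) (hB : 0 ≤ B) {e : ℝ} (he : 0 < e) :
    ∃ C : ℝ, 0 ≤ C ∧ ∀ (p n r₀ : ℕ) (A : ∀ i, Matrix (Fin p) (Fin (k i)) ℝ)
      (ε : ℤ → Ω → Fin p → ℝ) (L : Fin 2 → ℝ) (h : ℕ), 0 < p → 0 < n → 1 ≤ h →
      IsWhiteNoise μ x ε σ → (∀ i v, vnorm (A i *ᵥ v) ≤ L i * vnorm v) →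
      (∀ i, L i ^ 2 ≤ B * p) →
      μ {ω | ∃ N ≤ n, C * ((p : ℝ) ^ 2 * n) < ∑ c : Fin p × Fin p, (∑ j ∈ Finset.range N,
        (obs A x ε r₀ (1 + j) ω c.1 * obs A x ε r₀ (1 + j + h) ω c.2 -
          signal A x r₀ (1 + j) ω c.1 * signal A x r₀ (1 + j + h) ω c.2)) ^ 2} ≤
        ENNReal.ofReal e := by
  set Q := 2 * (B * ((k 0 + k 1) * (1 + σx ^ (4 * ζ)))) + 2 * σ ^ 2 with hQ
  have hQ0 : 0 ≤ Q := by positivity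
  -- The product error is a sum of two martingales. Since `(u + v) ^ 2 ≤ 2 * u ^ 2 + 2 * v ^ 2`,
  -- each may reach a quarter of the threshold, with probability at most `e / 2`; together this
  -- gives the factor `8`.
  set C := 8 * (σ ^ 2 * Q) / e + 1 with hC
  have hC0 : 0 < C := by positivity
  refine ⟨C, hC0.le, fun p n r₀ A ε L h hp hn hh hε hA hL => ?_⟩
  have hp' : (0 : ℝ) < p := by exact_mod_cast hp
  have hn' : (0 : ℝ) < n := by exact_mod_cast hn
  set l := C * ((p : ℝ) ^ 2 * n) / 4 with hl
  have hl0 : 0 < l := by positivity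
  have hBp : 0 ≤ B * p := by positivity
  -- At step `j` the σ-field is the past of the noise at time `τ + j`; the shift is `1 + h` for the
  -- later noise and `1` for the earlier one.
  let filt : ℤ → Filtration ℕ mΩ := fun τ =>
    ⟨fun j => noisePast x ε (τ + j), fun i j hij => noisePast_mono (by omega),
      fun j => hε.noisePast_le hx _⟩
  have hprob : ENNReal.ofReal (n * (σ ^ 2 * ((p : ℝ) ^ 2 * Q)) / l) ≤ ENNReal.ofReal (e / 2) := by
    refine ENNReal.ofReal_le_ofReal ?_
    rw [div_le_iff₀ hl0, hl]
    have h1 : 8 * (σ ^ 2 * Q) ≤ C * e := by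
      rw [hC, add_mul, div_mul_cancel₀ _ he.ne']; linarith
    calc n * (σ ^ 2 * ((p : ℝ) ^ 2 * Q)) = (8 * (σ ^ 2 * Q)) * ((p : ℝ) ^ 2 * n / 8) := by ring
      _ ≤ (C * e) * ((p : ℝ) ^ 2 * n / 8) := mul_le_mul_of_nonneg_right h1 (by positivity)
      _ = _ := by ring
  -- the martingale driven by the later noise
  have b1 := measure_exists_sum_sq_lt_le (μ := μ) (σ := σ) (ι := Fin p × Fin p) (filt (1 + h))
    (f := fun j c ω => obs A x ε r₀ (1 + j) ω c.1) (g := fun j c ω => ε (1 + j + h) ω c.2)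
    (K := (p : ℝ) ^ 2 * Q)
    (fun j c => measurable_obs_noisePast (by omega) c.1)
    (fun j c => obs_memLp hm hx hζ hε (by omega) c.1)
    (fun j c => measurable_noise_noisePast (by push_cast; omega) c.2)
    (fun j c => hε.memLp _ c.2)
    (fun j c => by
      have := hε.mean (1 + j + h) c.2
      rwa [show (1 : ℤ) + j + h = 1 + h + j by ring] at this ⊢)
    (fun j c => by
      have := hε.variance (1 + j + h) c.2
      rwa [show (1 : ℤ) + j + h = 1 + h + j by ring] at this ⊢)
    (fun j => by
      -- The multiplier ignores one coordinate of the pair, which costs a factor `p`. The energy of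
      -- the observations supplies the second one.
      have h1 := sum_integral_obs_sq_le (r₀ := r₀) hm hx hζ hε hBp hσx hA hL
        (by omega : (1 : ℤ) ≤ 1 + j)
      rw [Fintype.sum_prod_type]
      simp only [Finset.sum_const, Finset.card_univ, Fintype.card_fin, nsmul_eq_mul]
      rw [← Finset.mul_sum]
      calc _ ≤ (p : ℝ) * (2 * (B * p * ((k 0 + k 1) * (1 + σx ^ (4 * ζ)))) + 2 * (p * σ ^ 2)) :=
            mul_le_mul_of_nonneg_left h1 hp'.le
        _ = (p : ℝ) ^ 2 * Q := by rw [hQ]; ring) n hl0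
  -- the martingale driven by the earlier noise, given the factors
  have b2 := measure_exists_sum_sq_lt_le (μ := μ) (σ := σ) (ι := Fin p × Fin p) (filt 1)
    (f := fun j c ω => signal A x r₀ (1 + j + h) ω c.2) (g := fun j c ω => ε (1 + j) ω c.1)
    (K := (p : ℝ) ^ 2 * Q)
    (fun j c => measurable_signal_noisePast _ _ c.2)
    (fun j c => signal_memLp hm hx hζ (by omega) c.2)
    (fun j c => measurable_noise_noisePast (by push_cast; omega) c.1)
    (fun j c => hε.memLp _ c.1)
    (fun j c => hε.mean (1 + j) c.1)
    (fun j c => hε.variance (1 + j) c.1)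
    (fun j => by
      have h1 := sum_integral_signal_sq_le (r₀ := r₀) hm hx hζ hBp hσx hA hL
        (by omega : (1 : ℤ) ≤ 1 + j + h)
      rw [Fintype.sum_prod_type]
      simp only [Finset.sum_const, Finset.card_univ, Fintype.card_fin, nsmul_eq_mul]
      calc _ ≤ (p : ℝ) * (B * p * ((k 0 + k 1) * (1 + σx ^ (4 * ζ)))) :=
            mul_le_mul_of_nonneg_left h1 hp'.le
        _ = (p : ℝ) ^ 2 * (B * ((k 0 + k 1) * (1 + σx ^ (4 * ζ)))) := by ring
        _ ≤ (p : ℝ) ^ 2 * Q := by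
            refine mul_le_mul_of_nonneg_left ?_ (by positivity)
            have h2 : 0 ≤ B * ((k 0 + k 1) * (1 + σx ^ (4 * ζ))) := by positivity
            nlinarith [sq_nonneg σ]) n hl0
  refine (measure_mono ?_).trans ((measure_union_le _ _).trans
    ((add_le_add (b1.trans hprob) (b2.trans hprob)).trans ?_))
  · rintro ω ⟨N, hN, hlt⟩
    by_contra hcon
    simp only [Set.mem_union, Set.mem_ofPred_eq, not_or, not_exists, not_and, not_lt] at hcon
    have h1 := hcon.1 N hN
    have h2 := hcon.2 N hN
    have h3 : ∀ c : Fin p × Fin p, (∑ j ∈ Finset.range N,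
        (obs A x ε r₀ (1 + j) ω c.1 * obs A x ε r₀ (1 + j + h) ω c.2 -
          signal A x r₀ (1 + j) ω c.1 * signal A x r₀ (1 + j + h) ω c.2)) ^ 2 ≤
        2 * (∑ j ∈ Finset.range N, obs A x ε r₀ (1 + j) ω c.1 * ε (1 + j + h) ω c.2) ^ 2 +
        2 * (∑ j ∈ Finset.range N, signal A x r₀ (1 + j + h) ω c.2 * ε (1 + j) ω c.1) ^ 2 := by
      intro c
      simp only [obs_mul_obs, add_sub_cancel_left]
      rw [Finset.sum_add_distrib]
      nlinarith [sq_nonneg ((∑ j ∈ Finset.range N, obs A x ε r₀ (1 + j) ω c.1 * ε (1 + j + h) ω c.2)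
        - ∑ j ∈ Finset.range N, signal A x r₀ (1 + j + h) ω c.2 * ε (1 + j) ω c.1)]
    have h4 := Finset.sum_le_sum fun c (_ : c ∈ Finset.univ) => h3 c
    rw [Finset.sum_add_distrib, ← Finset.mul_sum, ← Finset.mul_sum] at h4
    rw [hl] at h1 h2
    linarith
  · rw [← ENNReal.ofReal_add (by linarith) (by linarith), add_halves]

end Moments


/-! ### Lagged second moments over a stretch of time -/

section LagSum

variable {ι ι' κ κ' : Type*}

/-- `n⁻¹ ∑_{t ∈ I} z_t w_{t+h}'`. -/
def lagSum (n : ℕ) (z : ℤ → ι → ℝ) (w : ℤ → κ → ℝ) (h : ℕ) (I : Finset ℤ) : Matrix ι κ ℝ :=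
  (n : ℝ)⁻¹ • ∑ t ∈ I, Matrix.vecMulVec (z t) (w (t + h))

lemma lagSum_apply (n : ℕ) (z : ℤ → ι → ℝ) (w : ℤ → κ → ℝ) (h : ℕ) (I : Finset ℤ) (a : ι) (b : κ) :
    lagSum n z w h I a b = (n : ℝ)⁻¹ * ∑ t ∈ I, z t a * w (t + h) b := by
  simp [lagSum, Matrix.sum_apply, Matrix.vecMulVec_apply]

lemma mul_lagSum_mul [Fintype ι] [Fintype κ] (A : Matrix ι' ι ℝ) (B : Matrix κ' κ ℝ) (n : ℕ)
    (z : ℤ → ι → ℝ) (w : ℤ → κ → ℝ) (h : ℕ) (I : Finset ℤ) :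
    A * lagSum n z w h I * Bᵀ = lagSum n (fun t => A *ᵥ z t) (fun t => B *ᵥ w t) h I := by
  simp only [lagSum, Matrix.mul_smul, Matrix.smul_mul, Matrix.mul_sum, Matrix.sum_mul,
    Matrix.mul_vecMulVec, Matrix.vecMulVec_mul, Matrix.vecMul_transpose]

/-- Used with `s = r₀ - h` and `r = r₀`: the times `t` and `t + h` lie both before the break, on
different sides of it, or both after it. -/
lemma sum_Ioc_split (f f₀ f₁ f₂ : ℤ → ℝ) (l u r s : ℤ) (hsr : s ≤ r)
    (h₀ : ∀ t, t ≤ s → f t = f₀ t) (h₁ : ∀ t, s < t → t ≤ r → f t = f₁ t)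
    (h₂ : ∀ t, r < t → f t = f₂ t) :
    ∑ t ∈ Finset.Ioc l u, f t = ∑ t ∈ Finset.Ioc l (min u s), f₀ t +
      ∑ t ∈ Finset.Ioc (max l s) (min u r), f₁ t + ∑ t ∈ Finset.Ioc (max l r) u, f₂ t := by
  have e0 : Finset.Ioc l (min u s) = (Finset.Ioc l u).filter (· ≤ s) := by
    ext t; simp; omega
  have e1 : Finset.Ioc (max l s) (min u r) = (Finset.Ioc l u).filter (fun t => s < t ∧ t ≤ r) := by
    ext t; simp; omega
  have e2 : Finset.Ioc (max l r) u = (Finset.Ioc l u).filter (r < ·) := by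
    ext t; simp; omega
  rw [e0, e1, e2, Finset.sum_filter, Finset.sum_filter, Finset.sum_filter,
    ← Finset.sum_add_distrib, ← Finset.sum_add_distrib]
  refine Finset.sum_congr rfl fun t _ => ?_
  rcases le_or_gt t s with h | h
  · simp [h, h₀ t h, not_lt.2 h, not_lt.2 (h.trans hsr)]
  · rcases le_or_gt t r with h' | h'
    · simp [h', h, h₁ t h h', not_le.2 h, not_lt.2 h']
    · simp [h', h, h₂ t h', not_le.2 h, not_le.2 h']

variable {k : ℕ}

lemma vnorm_lagSum_transpose_le [Fintype ι] [Fintype κ] {n : ℕ} {z : ℤ → ι → ℝ} {w : ℤ → κ → ℝ}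
    {h : ℕ} {I : Finset ℤ} {D : ℝ} (hD : 0 ≤ D) (hI : ∀ a b, ∑ t ∈ I, |z t a * w (t + h) b| ≤ D)
    (v : ι → ℝ) :
    vnorm ((lagSum n z w h I)ᵀ *ᵥ v) ≤
      (Fintype.card ι * Fintype.card κ) * (D / n) * vnorm v := by
  refine vnorm_transpose_mulVec_le (by positivity)
    (vnorm_mulVec_le_of_abs_le (by positivity) fun a b => ?_) v
  rw [lagSum_apply, abs_mul, abs_of_nonneg (by positivity : 0 ≤ (n : ℝ)⁻¹), div_eq_inv_mul]
  exact mul_le_mul_of_nonneg_left ((Finset.abs_sum_le_sum_abs _ _).trans (hI a b)) (by positivity)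

/-- The sample matrix inherits the lower bound of its mean, up to the norm of the entrywise
deviation. The index sets `I` and `J` may differ because the mean may be known to be nonsingular
only over a slightly different stretch. -/
lemma le_vnorm_lagSum_transpose {n : ℕ} {z : ℤ → Fin k → ℝ} {m : ℤ → Fin k → Fin k → ℝ} {h : ℕ}
    {I J : Finset ℤ} {s D : ℝ} (hD : 0 ≤ D)
    (hI : ∀ a b, |∑ t ∈ I, z t a * z (t + h) b - ∑ t ∈ J, m t a b| ≤ D)
    (hP : ∀ v, s * vnorm v ≤
      vnorm ((Matrix.of fun a b => (n : ℝ)⁻¹ * ∑ t ∈ J, m t a b) *ᵥ v)) (v : Fin k → ℝ) :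
    (s - k * k * (D / n)) * vnorm v ≤ vnorm ((lagSum n z z h I)ᵀ *ᵥ v) := by
  rcases le_or_gt (s - k * k * (D / n)) 0 with h0 | h0
  · exact (mul_nonpos_of_nonpos_of_nonneg h0 (vnorm_nonneg _)).trans (vnorm_nonneg _)
  refine le_vnorm_transpose_mulVec h0 (fun v => ?_) v
  set P : Matrix (Fin k) (Fin k) ℝ := Matrix.of fun a b => (n : ℝ)⁻¹ * ∑ t ∈ J, m t a b with hPdef
  have h1 : vnorm ((P - lagSum n z z h I) *ᵥ v) ≤ k * k * (D / n) * vnorm v := by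
    have := vnorm_mulVec_le_of_abs_le (H := P - lagSum n z z h I) (b := D / n) (by positivity)
      (fun a b => by
        rw [Matrix.sub_apply, lagSum_apply, hPdef, Matrix.of_apply, ← mul_sub, abs_mul,
          abs_of_nonneg (by positivity : 0 ≤ (n : ℝ)⁻¹), div_eq_inv_mul, abs_sub_comm]
        exact mul_le_mul_of_nonneg_left (hI a b) (by positivity)) v
    simpa using this
  have h2 := vnorm_add_le ((P - lagSum n z z h I) *ᵥ v) (lagSum n z z h I *ᵥ v)
  rw [← Matrix.add_mulVec, sub_add_cancel] at h2
  linarith [hP v]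

/-- Sufficient conditions for the approximation of the autocovariances. -/
lemma factorApprox_of_intervalBound {p k k' h₀ n : ℕ} {A : Matrix (Fin p) (Fin k) ℝ}
    {A' : Matrix (Fin p) (Fin k') ℝ} {z : ℤ → Fin k → ℝ} {z' : ℤ → Fin k' → ℝ}
    {m : ℕ → ℤ → Fin k → Fin k → ℝ} {m' : ℕ → ℤ → Fin k' → Fin k' → ℝ}
    {l u l' u' : ℕ → ℤ} {S : ℕ → Matrix (Fin p) (Fin p) ℝ} {K c e N κ C D u₁ u₂ : ℝ}
    (hn : 0 < n) (hκ : 0 ≤ κ) (hC : 0 ≤ C) (hD : 0 ≤ D) (hN : 0 ≤ N)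
    (hS : ∀ h ∈ Finset.Icc 1 h₀, ∀ v,
      vnorm ((S h - A * lagSum n z z h (Finset.Ioc (l h) (u h)) * Aᵀ -
        A' * lagSum n z' z' h (Finset.Ioc (l' h) (u' h)) * A'ᵀ)ᵀ *ᵥ v) ≤ K * e * vnorm v)
    (hT : ∀ h ∈ Finset.Icc 1 h₀, ∀ a b,
      IntervalBound κ C (fun t => z t a * z (t + h) b) (fun t => m h t a b) (l h) (u h))
    (hT' : ∀ h ∈ Finset.Icc 1 h₀, ∀ a b,
      IntervalBound κ C (fun t => z' t a * z' (t + h) b) (fun t => m' h t a b) (l' h) (u' h))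
    (hlen : ∀ h ∈ Finset.Icc 1 h₀, (((u h - l h).toNat : ℕ) : ℝ) ≤ n)
    (hlen' : ∀ h ∈ Finset.Icc 1 h₀, (((u' h - l' h).toNat : ℕ) : ℝ) ≤ N)
    (hlow : ∃ h ∈ Finset.Icc 1 h₀, ∀ v, u₁ * vnorm v ≤
      vnorm ((Matrix.of fun a b => (n : ℝ)⁻¹ * ∑ t ∈ Finset.Ioc (l h) (u h), m h t a b) *ᵥ v))
    (hlow' : ∃ h ∈ Finset.Icc 1 h₀, ∃ J : Finset ℤ,
      (∀ a b, |∑ t ∈ Finset.Ioc (l' h) (u' h), m' h t a b - ∑ t ∈ J, m' h t a b| ≤ D) ∧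
      ∀ v, u₂ * (N - h₀) / n * vnorm v ≤
        vnorm ((Matrix.of fun a b => (n : ℝ)⁻¹ * ∑ t ∈ J, m' h t a b) *ᵥ v))
    (hc : c ≤ u₁ - k * k * (κ + C / n)) (hc' : c ≤ u₂ - k' * k' * κ)
    (hK : k * k * (2 * C) ≤ K) (hK' : k' * k' * C ≤ K) (hK'' : u₂ * h₀ + k' * k' * (C + D) ≤ K) :
    FactorApprox h₀ A A' K c e n N S := by
  have hn' : (1 : ℝ) ≤ n := by exact_mod_cast hn
  have hn0 : (0 : ℝ) < n := by linarith
  refine ⟨fun h => lagSum n z z h (Finset.Ioc (l h) (u h)),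
    fun h => lagSum n z' z' h (Finset.Ioc (l' h) (u' h)), hS, ?_, ?_, ?_, ?_⟩
  · obtain ⟨h, hh, hv⟩ := hlow
    refine ⟨h, hh, fun v => le_trans (mul_le_mul_of_nonneg_right ?_ (vnorm_nonneg _))
      (le_vnorm_lagSum_transpose (D := κ * n + C) (by positivity) (fun a b => ?_) hv v)⟩
    · rwa [add_div, mul_div_cancel_right₀ _ hn0.ne']
    · rw [← Finset.sum_sub_distrib]
      refine (hT h hh a b).1.trans ?_
      have := mul_le_mul_of_nonneg_left (hlen h hh) hκ
      linarith
  · intro h hh v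
    refine (vnorm_lagSum_transpose_le (D := C * (n + 1)) (by positivity)
      (fun a b => (hT h hh a b).2.trans (mul_le_mul_of_nonneg_left
        (by linarith [hlen h hh]) hC)) v).trans
      (mul_le_mul_of_nonneg_right (le_trans ?_ hK) (vnorm_nonneg _))
    simp only [Fintype.card_fin]
    refine mul_le_mul_of_nonneg_left ?_ (by positivity)
    rw [div_le_iff₀ hn0]
    nlinarith
  · intro h hh v
    refine (vnorm_lagSum_transpose_le (D := C * (N + 1)) (by positivity)
      (fun a b => (hT' h hh a b).2.trans (mul_le_mul_of_nonneg_left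
        (by linarith [hlen' h hh]) hC)) v).trans
      (mul_le_mul_of_nonneg_right ?_ (vnorm_nonneg _))
    simp only [Fintype.card_fin]
    rw [mul_div_assoc, ← mul_assoc]
    exact mul_le_mul_of_nonneg_right hK' (by positivity)
  -- Three losses add up: the slope `κ * N`, which lowers `u₂` to `c`, and the constants `C + D` and
  -- `u₂ * h₀`, which go into `K`.
  · obtain ⟨h, hh, J, hJ, hv⟩ := hlow'
    refine ⟨h, hh, fun v => le_trans (mul_le_mul_of_nonneg_right ?_ (vnorm_nonneg _))
      (le_vnorm_lagSum_transpose (D := κ * N + C + D) (by positivity) (fun a b => ?_) hv v)⟩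
    · rw [← mul_div_assoc, ← sub_div]
      refine div_le_div_of_nonneg_right ?_ hn0.le
      nlinarith [mul_le_mul_of_nonneg_right hc' hN]
    · have h1 := (hT' h hh a b).1
      rw [Finset.sum_sub_distrib] at h1
      have h2 := mul_le_mul_of_nonneg_left (hlen' h hh) hκ
      have h3 := hJ a b
      rw [abs_le] at h1 h3 ⊢
      constructor <;> linarith [h1.1, h1.2, h3.1, h3.2]

end LagSum


/-! ### Sample autocovariances in the factor model -/

section SampleCross

lemma sum_regime_zero (n h : ℕ) (γ : ℝ) (hg : ⌊γ * n⌋ ≤ n) (f : ℤ → ℝ) :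
    ∑ t ∈ Finset.Icc (1 : ℤ) n,
      (if t ∈ regime n γ 0 ∧ t + h ∈ regime n γ 0 then f t else 0) =
      ∑ t ∈ Finset.Ioc (0 : ℤ) (⌊γ * n⌋ - h), f t := by
  rw [← Finset.sum_filter]
  refine Finset.sum_congr ?_ fun _ _ => rfl
  ext t
  simp [regime]
  omega

lemma sum_regime_one (n h : ℕ) (γ : ℝ) (hg : 0 ≤ ⌊γ * n⌋) (f : ℤ → ℝ) :
    ∑ t ∈ Finset.Icc (1 : ℤ) n,
      (if t ∈ regime n γ 1 ∧ t + h ∈ regime n γ 1 then f t else 0) =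
      ∑ t ∈ Finset.Ioc ⌊γ * n⌋ ((n : ℤ) - h), f t := by
  rw [← Finset.sum_filter]
  refine Finset.sum_congr ?_ fun _ _ => rfl
  ext t
  simp [regime]
  omega

lemma sampleCross_zero {ι : Type*} {n : ℕ} {γ : ℝ} (hg : ⌊γ * n⌋ ≤ n) (z : ℤ → ι → ℝ) (h : ℕ) :
    sampleCross n z 0 h γ = lagSum n z z h (Finset.Ioc 0 (⌊γ * n⌋ - h)) := by
  ext a b
  rw [lagSum_apply, sampleCross, Matrix.of_apply, sum_regime_zero n h γ hg]

lemma sampleCross_one {ι : Type*} {n : ℕ} {γ : ℝ} (hg : 0 ≤ ⌊γ * n⌋) (z : ℤ → ι → ℝ) (h : ℕ) :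
    sampleCross n z 1 h γ = lagSum n z z h (Finset.Ioc ⌊γ * n⌋ (n - h)) := by
  ext a b
  rw [lagSum_apply, sampleCross, Matrix.of_apply, sum_regime_one n h γ hg]

lemma sum_Ioc_zero_natCast (f : ℤ → ℝ) (N : ℕ) :
    ∑ t ∈ Finset.Ioc (0 : ℤ) N, f t = ∑ j ∈ Finset.range N, f (1 + j) := by
  have := sum_Ioc_add f 0 N
  simpa using this

lemma sum_Ioc_eq_sub (f : ℤ → ℝ) {l u : ℤ} (hl : 0 ≤ l) (hlu : l ≤ u) :
    ∑ t ∈ Finset.Ioc l u, f t =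
      ∑ j ∈ Finset.range u.toNat, f (1 + j) - ∑ j ∈ Finset.range l.toNat, f (1 + j) := by
  rw [← sum_Ioc_zero_natCast, ← sum_Ioc_zero_natCast, Int.toNat_of_nonneg hl,
    Int.toNat_of_nonneg (hl.trans hlu),
    sum_Ioc_split f f f f 0 u l l le_rfl (fun _ _ => rfl) (fun _ _ _ => rfl) fun _ _ => rfl,
    min_eq_right hlu, max_eq_right hl, Finset.Ioc_self]
  simp

/-- An interval sum is the difference of two initial sums, so uniform control of initial sums
suffices, at the price of a factor four. -/
lemma sum_sq_Ioc_le {ι : Type*} [Fintype ι] (f : ι → ℤ → ℝ) {l u : ℤ} {n : ℕ} {B : ℝ}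
    (hB : 0 ≤ B) (hl : 0 ≤ l) (hu : u ≤ n)
    (hf : ∀ N ≤ n, ∑ c, (∑ j ∈ Finset.range N, f c (1 + j)) ^ 2 ≤ B) :
    ∑ c, (∑ t ∈ Finset.Ioc l u, f c t) ^ 2 ≤ 4 * B := by
  rcases le_or_gt l u with hlu | hlu
  · have h1 := hf u.toNat (by omega)
    have h2 := hf l.toNat (by omega)
    calc _ ≤ ∑ c, (2 * (∑ j ∈ Finset.range u.toNat, f c (1 + j)) ^ 2 +
          2 * (∑ j ∈ Finset.range l.toNat, f c (1 + j)) ^ 2) := by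
          refine Finset.sum_le_sum fun c _ => ?_
          rw [sum_Ioc_eq_sub _ hl hlu]
          nlinarith [sq_nonneg (∑ j ∈ Finset.range u.toNat, f c (1 + j) +
            ∑ j ∈ Finset.range l.toNat, f c (1 + j))]
      _ ≤ _ := by
          rw [Finset.sum_add_distrib, ← Finset.mul_sum, ← Finset.mul_sum]
          linarith
  · simp [Finset.Ioc_eq_empty_of_le hlu.le]
    exact hB

variable {Ω : Type*} {k : Fin 2 → ℕ} {p n r₀ h₀ : ℕ}
  {x : ∀ i, ℤ → Ω → Fin (k i) → ℝ} {A : ∀ i, Matrix (Fin p) (Fin (k i)) ℝ}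
  {ε : ℤ → Ω → Fin p → ℝ} {ω : Ω} {κ C B : ℝ} {L : Fin 2 → ℝ}

lemma lagSum_signal (n h : ℕ) (l u : ℤ) :
    lagSum n (fun t => signal A x r₀ t ω) (fun t => signal A x r₀ t ω) h (Finset.Ioc l u) =
      A 0 * lagSum n (fun t => x 0 t ω) (fun t => x 0 t ω) h (Finset.Ioc l (min u (r₀ - h))) *
          (A 0)ᵀ +
        A 0 * lagSum n (fun t => x 0 t ω) (fun t => x 1 t ω) h
          (Finset.Ioc (max l (r₀ - h)) (min u r₀)) * (A 1)ᵀ +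
        A 1 * lagSum n (fun t => x 1 t ω) (fun t => x 1 t ω) h (Finset.Ioc (max l r₀) u) *
          (A 1)ᵀ := by
  simp only [mul_lagSum_mul]
  ext a b
  simp only [Matrix.add_apply, lagSum_apply]
  rw [← mul_add, ← mul_add]
  congr 1
  refine sum_Ioc_split _ _ _ _ l u r₀ (r₀ - h) (by omega) (fun t ht => ?_) (fun t ht ht' => ?_)
    fun t ht => ?_
  · simp only [signal]
    rw [if_pos (by omega), if_pos (by omega)]
  · simp only [signal]
    rw [if_pos (by omega), if_neg (by omega)]
  · simp only [signal]
    rw [if_neg (by omega), if_neg (by omega)]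

/-- The realisations for which the noise and the partial sums of the products of factors behave. -/
structure IsRegularSample [MeasurableSpace Ω] (μ : Measure Ω) (x : ∀ i, ℤ → Ω → Fin (k i) → ℝ)
    (A : ∀ i, Matrix (Fin p) (Fin (k i)) ℝ) (ε : ℤ → Ω → Fin p → ℝ) (n r₀ h₀ : ℕ) (κ C : ℝ)
    (ω : Ω) : Prop where
  noise : ∀ h ∈ Finset.Icc 1 h₀, ∀ N ≤ n, ∑ c : Fin p × Fin p, (∑ j ∈ Finset.range N,
    (obs A x ε r₀ (1 + j) ω c.1 * obs A x ε r₀ (1 + j + h) ω c.2 -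
      signal A x r₀ (1 + j) ω c.1 * signal A x r₀ (1 + j + h) ω c.2)) ^ 2 ≤ C * ((p : ℝ) ^ 2 * n)
  forward : ∀ h ∈ Finset.Icc 1 h₀, ∀ i a b u, IntervalBound κ C
    (fun t => x i t ω a * x i (t + h) ω b) (fun t => ∫ ω, x i t ω a * x i (t + h) ω b ∂μ)
    (if i = 0 then 0 else r₀) u
  backward : ∀ h ∈ Finset.Icc 1 h₀, ∀ i a b l, 0 ≤ l → IntervalBound κ C
    (fun t => x i t ω a * x i (t + h) ω b) (fun t => ∫ ω, x i t ω a * x i (t + h) ω b ∂μ)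
    l ((if i = 0 then r₀ else n : ℕ) - h)
  mixed : ∀ h ∈ Finset.Icc 1 h₀, ∀ a b,
    ∑ t ∈ Finset.Ioc ((r₀ : ℤ) - h) r₀, |x 0 t ω a * x 1 (t + h) ω b| ≤ C

variable [MeasurableSpace Ω] {μ : Measure Ω}

/-- The spectral norm is bounded by the Frobenius norm, whose square is of order `p ^ 2 / n`
uniformly over intervals. The hypothesis `1 ≤ C` replaces `√C` by `C`. -/
lemma IsRegularSample.vnorm_noise_le (hR : IsRegularSample μ x A ε n r₀ h₀ κ C ω) (hn : 0 < n)
    (hC : 1 ≤ C) {h : ℕ} (hh : h ∈ Finset.Icc 1 h₀) {l u : ℤ} (hl : 0 ≤ l) (hu : u ≤ n)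
    (v : Fin p → ℝ) :
    vnorm ((lagSum n (fun t => obs A x ε r₀ t ω) (fun t => obs A x ε r₀ t ω) h (Finset.Ioc l u) -
      lagSum n (fun t => signal A x r₀ t ω) (fun t => signal A x r₀ t ω) h (Finset.Ioc l u))ᵀ *ᵥ v)
      ≤ 2 * C * (p / √n) * vnorm v := by
  have hn' : (0 : ℝ) < n := by exact_mod_cast hn
  refine vnorm_transpose_mulVec_le (by positivity)
    (vnorm_mulVec_le_of_sum_sq (by positivity) ?_) v
  have h1 := sum_sq_Ioc_le (n := n) (l := l) (u := u) (fun (c : Fin p × Fin p) t =>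
    obs A x ε r₀ t ω c.1 * obs A x ε r₀ (t + h) ω c.2 -
      signal A x r₀ t ω c.1 * signal A x r₀ (t + h) ω c.2) (by positivity) hl hu (hR.noise h hh)
  rw [Fintype.sum_prod_type] at h1
  have h2 : ∀ a b, (lagSum n (fun t => obs A x ε r₀ t ω) (fun t => obs A x ε r₀ t ω) h
      (Finset.Ioc l u) - lagSum n (fun t => signal A x r₀ t ω) (fun t => signal A x r₀ t ω) h
      (Finset.Ioc l u)) a b ^ 2 = ((n : ℝ) ^ 2)⁻¹ * (∑ t ∈ Finset.Ioc l u,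
      (obs A x ε r₀ t ω a * obs A x ε r₀ (t + h) ω b -
      signal A x r₀ t ω a * signal A x r₀ (t + h) ω b)) ^ 2 := fun a b => by
    rw [Matrix.sub_apply, lagSum_apply, lagSum_apply, Finset.sum_sub_distrib, ← mul_sub, mul_pow,
      inv_pow]
  simp only [h2, ← Finset.mul_sum]
  calc _ ≤ ((n : ℝ) ^ 2)⁻¹ * (4 * (C * ((p : ℝ) ^ 2 * n))) :=
        mul_le_mul_of_nonneg_left h1 (by positivity)
    _ = 4 * C * (p ^ 2 / n) := by field_simp
    _ ≤ 4 * (C * C) * (p ^ 2 / n) := by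
        refine mul_le_mul_of_nonneg_right ?_ (by positivity)
        nlinarith
    _ = _ := by
        rw [mul_pow, div_pow, Real.sq_sqrt hn'.le]; ring

/-- At most `h` products straddle the break and their absolute sum is bounded, so the term is of
order `L 0 * L 1 / n ≤ B * p / n`, below the noise level `p / √n`. -/
lemma IsRegularSample.vnorm_mixed_le (hR : IsRegularSample μ x A ε n r₀ h₀ κ C ω) (hn : 0 < n)
    (hC : 0 ≤ C) (hL0 : ∀ i, 0 ≤ L i) (hA : ∀ i v, vnorm (A i *ᵥ v) ≤ L i * vnorm v)
    (hL : ∀ i, L i ^ 2 ≤ B * p) {h : ℕ} (hh : h ∈ Finset.Icc 1 h₀) (l u : ℤ) (v : Fin p → ℝ) :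
    vnorm ((A 0 * lagSum n (fun t => x 0 t ω) (fun t => x 1 t ω) h
      (Finset.Ioc (max l (r₀ - h)) (min u r₀)) * (A 1)ᵀ)ᵀ *ᵥ v) ≤
      k 0 * k 1 * C * B * (p / √n) * vnorm v := by
  have hn' : (1 : ℝ) ≤ n := by exact_mod_cast hn
  have hsq : √(n : ℝ) ≤ n := by
    rw [Real.sqrt_le_left (by linarith)]; nlinarith
  have hLL : L 0 * L 1 ≤ B * p := by
    nlinarith [sq_nonneg (L 0 - L 1), hL 0, hL 1]
  have hB0 : 0 ≤ B * p := (sq_nonneg _).trans (hL 0)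
  rw [Matrix.transpose_mul, Matrix.transpose_mul, Matrix.transpose_transpose,
    ← Matrix.mulVec_mulVec, ← Matrix.mulVec_mulVec]
  have h1 := vnorm_lagSum_transpose_le (n := n) (z := fun t => x 0 t ω) (w := fun t => x 1 t ω)
    (h := h) (I := Finset.Ioc (max l (r₀ - h)) (min u r₀)) hC (fun a b =>
      (Finset.sum_le_sum_of_subset_of_nonneg
        (Finset.Ioc_subset_Ioc (le_max_right _ _) (min_le_right _ _))
        fun _ _ _ => abs_nonneg _).trans (hR.mixed h hh a b)) ((A 0)ᵀ *ᵥ v)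
  simp only [Fintype.card_fin] at h1
  calc _ ≤ L 1 * ((k 0 * k 1) * (C / n) * (L 0 * vnorm v)) :=
        (hA 1 _).trans (mul_le_mul_of_nonneg_left (h1.trans (mul_le_mul_of_nonneg_left
          (vnorm_transpose_mulVec_le (hL0 0) (hA 0) v) (by positivity))) (hL0 1))
    _ = (k 0 * k 1 * C) * (L 0 * L 1 / n) * vnorm v := by ring
    _ ≤ (k 0 * k 1 * C) * (B * p / √n) * vnorm v := by
        refine mul_le_mul_of_nonneg_right (mul_le_mul_of_nonneg_left ?_ (by positivity))
          (vnorm_nonneg _)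
        exact div_le_div₀ hB0 hLL (by positivity) hsq
    _ = _ := by ring

/-- The autocovariances over a stretch of time, up to errors of the order `p / √n`. -/
lemma IsRegularSample.vnorm_lagSum_sub_le (hR : IsRegularSample μ x A ε n r₀ h₀ κ C ω)
    (hn : 0 < n) (hC : 1 ≤ C) (hL0 : ∀ i, 0 ≤ L i)
    (hA : ∀ i v, vnorm (A i *ᵥ v) ≤ L i * vnorm v) (hL : ∀ i, L i ^ 2 ≤ B * p) {h : ℕ}
    (hh : h ∈ Finset.Icc 1 h₀) {l u : ℤ} (hl : 0 ≤ l) (hu : u ≤ n) (v : Fin p → ℝ) :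
    vnorm ((lagSum n (fun t => obs A x ε r₀ t ω) (fun t => obs A x ε r₀ t ω) h (Finset.Ioc l u) -
      A 0 * lagSum n (fun t => x 0 t ω) (fun t => x 0 t ω) h (Finset.Ioc l (min u (r₀ - h))) *
        (A 0)ᵀ -
      A 1 * lagSum n (fun t => x 1 t ω) (fun t => x 1 t ω) h (Finset.Ioc (max l r₀) u) *
        (A 1)ᵀ)ᵀ *ᵥ v) ≤ (2 * C + k 0 * k 1 * C * B) * (p / √n) * vnorm v := by
  have h1 := hR.vnorm_noise_le hn hC hh hl hu v
  have h2 := hR.vnorm_mixed_le hn (by linarith) hL0 hA hL hh l u v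
  have h3 := vnorm_add_le _ _ |>.trans (add_le_add h1 h2)
  rw [← Matrix.add_mulVec, ← Matrix.transpose_add, lagSum_signal] at h3
  rw [show (2 * C + k 0 * k 1 * C * B) * (p / √n) * vnorm v =
    2 * C * (p / √n) * vnorm v + k 0 * k 1 * C * B * (p / √n) * vnorm v by ring]
  refine le_of_eq_of_le (congrArg (fun M => vnorm (Matrix.transpose M *ᵥ v)) ?_) h3
  abel

end SampleCross


/-! ### Approximation of the sample autocovariances at a tentative break -/

section Design

variable {Ω : Type*} [MeasurableSpace Ω] {μ : Measure Ω} {k : Fin 2 → ℕ} {p n r₀ h₀ : ℕ}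
  {x : ∀ i, ℤ → Ω → Fin (k i) → ℝ} {A : ∀ i, Matrix (Fin p) (Fin (k i)) ℝ}
  {ε : ℤ → Ω → Fin p → ℝ} {ω : Ω} {κ C B K c u u₀ H γ : ℝ} {L η : Fin 2 → ℝ}

lemma popCross_zero {ι : Type*} {n : ℕ} {γ : ℝ} (hg : ⌊γ * n⌋ ≤ n) (z : ℤ → Ω → ι → ℝ) (h : ℕ) :
    popCross μ n z 0 h γ = Matrix.of fun a b => (n : ℝ)⁻¹ *
      ∑ t ∈ Finset.Ioc 0 (⌊γ * n⌋ - h), ∫ ω, z t ω a * z (t + h) ω b ∂μ := by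
  ext a b
  rw [popCross, Matrix.of_apply, sum_regime_zero n h γ hg, Matrix.of_apply]

lemma popCross_one {ι : Type*} {n : ℕ} {γ : ℝ} (hg : 0 ≤ ⌊γ * n⌋) (z : ℤ → Ω → ι → ℝ) (h : ℕ) :
    popCross μ n z 1 h γ = Matrix.of fun a b => (n : ℝ)⁻¹ *
      ∑ t ∈ Finset.Ioc ⌊γ * n⌋ (n - h), ∫ ω, z t ω a * z (t + h) ω b ∂μ := by
  ext a b
  rw [popCross, Matrix.of_apply, sum_regime_one n h γ hg, Matrix.of_apply]

/-- The nonrandom requirements on the sample size, the break and the moments of the factors. -/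
structure IsDesign (μ : Measure Ω) (x : ∀ i, ℤ → Ω → Fin (k i) → ℝ) (n r₀ h₀ : ℕ) (η : Fin 2 → ℝ)
    (u u₀ H : ℝ) : Prop where
  pos : 0 < n
  trim_pos : 0 < η 0
  trim_lt_one : η 1 < 1
  break_mem : (r₀ : ℝ) / n ∈ Set.Ioo (η 0) (η 1)
  nonsing : ∀ i, ∀ γ ∈ Set.Icc (η 0) (η 1), ∃ h ∈ Finset.Icc 1 h₀, ∀ v,
    u * vnorm v ≤ vnorm (popCross μ n (x i) i h γ *ᵥ v)
  stretch_left : ∀ γ ∈ Set.Ioo (η 0) ((r₀ : ℝ) / n), ⌊γ * n⌋ < (r₀ : ℤ) - h₀ →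
    ∃ h ∈ Finset.Icc 1 h₀, ∀ v, u₀ * vnorm v ≤
      vnorm (avgCross μ n (x 0) h γ ((r₀ : ℝ) / n - (h : ℝ) / n) *ᵥ v)
  stretch_right : ∀ γ ∈ Set.Ioo ((r₀ : ℝ) / n) (η 1), (r₀ : ℤ) < ⌊γ * n⌋ →
    ∃ h ∈ Finset.Icc 1 h₀, ∀ v, u₀ * vnorm v ≤
      vnorm (avgCross μ n (x 1) h ((r₀ : ℝ) / n) γ *ᵥ v)
  moment_le : ∀ i (h : ℕ) a b (t : ℤ), 1 ≤ t → |∫ ω, x i t ω a * x i (t + h) ω b ∂μ| ≤ H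

/-- The number of time points wrongly attributed to regime `i` by the tentative break `γ`. -/
def misclassified (n r₀ : ℕ) (γ : ℝ) (i : Fin 2) : ℕ :=
  if i = 0 then (⌊γ * n⌋ - r₀).toNat else (r₀ - ⌊γ * n⌋).toNat

lemma IsDesign.break_mul (hD : IsDesign μ x n r₀ h₀ η u u₀ H) : (r₀ : ℝ) / n * n = r₀ :=
  div_mul_cancel₀ _ (by exact_mod_cast hD.pos.ne')

lemma IsDesign.floor_break (hD : IsDesign μ x n r₀ h₀ η u u₀ H) : ⌊(r₀ : ℝ) / n * n⌋ = r₀ := by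
  rw [hD.break_mul]; simp

lemma IsDesign.floor_nonneg (hD : IsDesign μ x n r₀ h₀ η u u₀ H) (hγ : γ ∈ Set.Icc (η 0) (η 1)) :
    0 ≤ ⌊γ * n⌋ :=
  Int.floor_nonneg.2 (mul_nonneg (hD.trim_pos.le.trans hγ.1) (Nat.cast_nonneg _))

lemma IsDesign.floor_le (hD : IsDesign μ x n r₀ h₀ η u u₀ H) (hγ : γ ∈ Set.Icc (η 0) (η 1)) :
    ⌊γ * n⌋ ≤ n := by
  have h1 : γ * n ≤ n := mul_le_of_le_one_left (Nat.cast_nonneg _) (hγ.2.trans hD.trim_lt_one.le)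
  exact_mod_cast (Int.floor_le _).trans h1

lemma IsDesign.break_le (hD : IsDesign μ x n r₀ h₀ η u u₀ H) : (r₀ : ℤ) ≤ n := by
  rw [← hD.floor_break]
  exact hD.floor_le (Set.Ioo_subset_Icc_self hD.break_mem)

lemma IsDesign.floor_min (hD : IsDesign μ x n r₀ h₀ η u u₀ H) (γ : ℝ) :
    ⌊min γ ((r₀ : ℝ) / n) * n⌋ = min ⌊γ * n⌋ r₀ := by
  rw [min_mul_of_nonneg _ _ (Nat.cast_nonneg n), Int.floor_mono.map_min, hD.floor_break]

lemma IsDesign.floor_max (hD : IsDesign μ x n r₀ h₀ η u u₀ H) (γ : ℝ) :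
    ⌊max γ ((r₀ : ℝ) / n) * n⌋ = max ⌊γ * n⌋ r₀ := by
  rw [max_mul_of_nonneg _ _ (Nat.cast_nonneg n), Int.floor_mono.map_max, hD.floor_break]

lemma scaled_avgCross_mulVec {ι : Type*} [Fintype ι] (n : ℕ) (z : ℤ → Ω → ι → ℝ) (h : ℕ)
    {c₁ c₂ : ℝ} (hc : ⌊c₁ * n⌋ < ⌊c₂ * n⌋) (v : ι → ℝ) :
    (Matrix.of fun a b => (n : ℝ)⁻¹ *
      ∑ t ∈ Finset.Ioc ⌊c₁ * n⌋ ⌊c₂ * n⌋, ∫ ω, z t ω a * z (t + h) ω b ∂μ) *ᵥ v =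
      (((⌊c₂ * n⌋ - ⌊c₁ * n⌋ : ℤ) : ℝ) / n) • (avgCross μ n z h c₁ c₂ *ᵥ v) := by
  rw [← Matrix.smul_mulVec]
  congr 1
  ext a b
  have h1 : ((⌊c₂ * n⌋ - ⌊c₁ * n⌋ : ℤ) : ℝ) ≠ 0 := by
    exact_mod_cast (sub_pos.2 hc).ne'
  rw [Matrix.smul_apply, avgCross, Matrix.of_apply, Matrix.of_apply, smul_eq_mul, ← mul_assoc,
    div_mul_eq_mul_div, mul_inv_cancel₀ h1, one_div]

/-- Renormalising an average by `n` multiplies it by the relative length of the stretch, which makes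
the lower bound proportional to the number of misclassified times. -/
lemma le_vnorm_scaled_avgCross {ι : Type*} [Fintype ι] (z : ℤ → Ω → ι → ℝ) {h : ℕ}
    {c₁ c₂ : ℝ} (hc : ⌊c₁ * n⌋ < ⌊c₂ * n⌋) {N : ℝ} (hu : 0 ≤ u₀)
    (hN : N ≤ ((⌊c₂ * n⌋ - ⌊c₁ * n⌋ : ℤ) : ℝ))
    (hv : ∀ v, u₀ * vnorm v ≤ vnorm (avgCross μ n z h c₁ c₂ *ᵥ v)) (v : ι → ℝ) :
    u₀ * N / n * vnorm v ≤ vnorm ((Matrix.of fun a b => (n : ℝ)⁻¹ *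
      ∑ t ∈ Finset.Ioc ⌊c₁ * n⌋ ⌊c₂ * n⌋, ∫ ω, z t ω a * z (t + h) ω b ∂μ) *ᵥ v) := by
  have h1 : (0 : ℝ) ≤ ((⌊c₂ * n⌋ - ⌊c₁ * n⌋ : ℤ) : ℝ) := by exact_mod_cast (sub_pos.2 hc).le
  rw [scaled_avgCross_mulVec n z h hc, vnorm_smul, abs_of_nonneg (by positivity)]
  calc u₀ * N / n * vnorm v = N / n * (u₀ * vnorm v) := by ring
    _ ≤ ((⌊c₂ * n⌋ - ⌊c₁ * n⌋ : ℤ) : ℝ) / n * (u₀ * vnorm v) :=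
        mul_le_mul_of_nonneg_right (div_le_div_of_nonneg_right hN (Nat.cast_nonneg _))
          (mul_nonneg hu (vnorm_nonneg _))
    _ ≤ _ := mul_le_mul_of_nonneg_left (hv v) (by positivity)

/-- Shortening the range by the lag drops at most `h₀` terms, each bounded by `H`. -/
lemma abs_sum_Ioc_sub_le {f : ℤ → ℝ} {l g : ℤ} {h : ℕ} (hH : 0 ≤ H)
    (hf : ∀ t, l < t → |f t| ≤ H) (hh : h ≤ h₀) :
    |∑ t ∈ Finset.Ioc l (g - h), f t - ∑ t ∈ Finset.Ioc l g, f t| ≤ h₀ * H := by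
  have hsub : Finset.Ioc l (g - h) ⊆ Finset.Ioc l g := Finset.Ioc_subset_Ioc_right (by omega)
  rw [abs_sub_comm, ← Finset.sum_sdiff hsub, add_sub_cancel_right]
  refine (Finset.abs_sum_le_sum_abs _ _).trans ?_
  have h1 : ∀ t ∈ Finset.Ioc l g \ Finset.Ioc l (g - h), |f t| ≤ H := fun t ht =>
    hf t (Finset.mem_Ioc.1 (Finset.mem_sdiff.1 ht).1).1
  refine (Finset.sum_le_card_nsmul _ _ _ h1).trans ?_
  rw [nsmul_eq_mul]
  refine mul_le_mul_of_nonneg_right ?_ hH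
  have h2 : Finset.Ioc l g \ Finset.Ioc l (g - h) ⊆ Finset.Ioc (g - h) g := fun t ht => by
    simp only [Finset.mem_sdiff, Finset.mem_Ioc] at ht ⊢
    omega
  have h3 := Finset.card_le_card h2
  rw [Int.card_Ioc] at h3
  exact_mod_cast h3.trans (by omega)

/-- The constants of the approximation are large, respectively small, enough. -/
structure ApproxConstants (k : Fin 2 → ℕ) (n h₀ : ℕ) (κ C B K c u u₀ H : ℝ) : Prop where
  κ_nonneg : 0 ≤ κ
  one_le : 1 ≤ C
  B_nonneg : 0 ≤ B
  H_nonneg : 0 ≤ H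
  u₀_nonneg : 0 ≤ u₀
  le_nonsing : c ≤ u - ((k 0 : ℝ) + k 1) ^ 2 * (κ + C / n)
  le_stretch : c ≤ u₀ - ((k 0 : ℝ) + k 1) ^ 2 * κ
  le_upper : 2 * C + ((k 0 : ℝ) + k 1) ^ 2 * (C * B + 2 * C + h₀ * H) + u₀ * h₀ ≤ K

lemma ApproxConstants.derived (hc : ApproxConstants k n h₀ κ C B K c u u₀ H) :
    2 * C + k 0 * k 1 * C * B ≤ K ∧ ∀ i, c ≤ u - k i * k i * (κ + C / n) ∧
      c ≤ u₀ - k i * k i * κ ∧ k i * k i * (2 * C) ≤ K ∧ k i * k i * C ≤ K ∧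
      u₀ * h₀ + k i * k i * (C + h₀ * H) ≤ K := by
  obtain ⟨h1, h2, h3, h4, h5, h6, h7, h8⟩ := hc
  have hk0 : (0 : ℝ) ≤ k 0 := Nat.cast_nonneg _
  have hk1 : (0 : ℝ) ≤ k 1 := Nat.cast_nonneg _
  have hkk : ∀ i, (k i : ℝ) * k i ≤ ((k 0 : ℝ) + k 1) ^ 2 := by
    intro i
    fin_cases i <;> simp <;> nlinarith
  have h01 : (k 0 : ℝ) * k 1 ≤ ((k 0 : ℝ) + k 1) ^ 2 := by nlinarith
  set Q := ((k 0 : ℝ) + k 1) ^ 2 with hQ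
  have hQ0 : 0 ≤ Q := sq_nonneg _
  have a1 : 0 ≤ C * B := by positivity
  have a2 : (0 : ℝ) ≤ h₀ * H := by positivity
  have a3 : 0 ≤ u₀ * h₀ := by positivity
  have a4 : 0 ≤ C / n := by positivity
  have b1 := mul_nonneg hQ0 a1
  have b2 := mul_nonneg hQ0 a2
  have b3 : 0 ≤ Q * C := by positivity
  have e : Q * (C * B + 2 * C + h₀ * H) = Q * (C * B) + 2 * (Q * C) + Q * (h₀ * H) := by ring
  rw [e] at h8
  refine ⟨?_, fun i => ⟨?_, ?_, ?_, ?_, ?_⟩⟩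
  · have := mul_le_mul_of_nonneg_right h01 a1
    nlinarith
  · have := mul_le_mul_of_nonneg_right (hkk i) (by positivity : 0 ≤ κ + C / n)
    linarith
  · have := mul_le_mul_of_nonneg_right (hkk i) h1
    linarith
  · have := mul_le_mul_of_nonneg_right (hkk i) (by positivity : 0 ≤ 2 * C)
    linarith
  · have := mul_le_mul_of_nonneg_right (hkk i) (by positivity : 0 ≤ C)
    linarith
  · have := mul_le_mul_of_nonneg_right (hkk i) (by positivity : 0 ≤ C + h₀ * H)
    linarith

/-- With `g = ⌊γ n⌋`, the own pairs start in `(0, min g r₀ - h]` and the foreign ones in `(r₀, g -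
h]`. The left end `γ = η 0` is admitted because the projection is computed there; the right end is
excluded because nonsingularity over the stretch is available only for `γ < η 1`. -/
lemma factorApprox_sampleCross_zero (hD : IsDesign μ x n r₀ h₀ η u u₀ H)
    (hR : IsRegularSample μ x A ε n r₀ h₀ κ C ω) (hc : ApproxConstants k n h₀ κ C B K c u u₀ H)
    (hL0 : ∀ i, 0 ≤ L i) (hA : ∀ i v, vnorm (A i *ᵥ v) ≤ L i * vnorm v)
    (hL : ∀ i, L i ^ 2 ≤ B * p) (hγ : γ ∈ Set.Ico (η 0) (η 1)) :
    FactorApprox h₀ (A 0) (A 1) K c (p / √n) n (misclassified n r₀ γ 0)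
      (fun h => sampleCross n (fun t => obs A x ε r₀ t ω) 0 h γ) := by
  have hγ' : γ ∈ Set.Icc (η 0) (η 1) := Set.Ico_subset_Icc_self hγ
  have hg0 := hD.floor_nonneg hγ'
  have hgn := hD.floor_le hγ'
  have hrn := hD.break_le
  obtain ⟨k1, k2⟩ := hc.derived
  obtain ⟨c1, -, c3, -, -⟩ := k2 0
  obtain ⟨-, c2, -, c4, c5⟩ := k2 1
  set g := ⌊γ * n⌋ with hg
  -- The own part ends at the earlier of the tentative and the true break, so its mean is the
  -- regime's moment matrix at their minimum, which still lies in the trimming range.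
  have hmin : min γ ((r₀ : ℝ) / n) ∈ Set.Icc (η 0) (η 1) :=
    ⟨le_min hγ'.1 hD.break_mem.1.le, (min_le_left _ _).trans hγ'.2⟩
  refine factorApprox_of_intervalBound
    (m := fun h t a b => ∫ ω, x 0 t ω a * x 0 (t + h) ω b ∂μ)
    (m' := fun h t a b => ∫ ω, x 1 t ω a * x 1 (t + h) ω b ∂μ)
    (z := fun t => x 0 t ω) (z' := fun t => x 1 t ω)
    (l := fun _ => 0) (u := fun h => min g r₀ - h) (l' := fun _ => r₀) (u' := fun h => g - h)
    (u₁ := u) (u₂ := u₀) (D := h₀ * H) hD.pos hc.κ_nonneg (zero_le_one.trans hc.one_le)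
    (mul_nonneg (Nat.cast_nonneg _) hc.H_nonneg) (Nat.cast_nonneg _) (fun h hh v => ?_)
    (fun h hh a b => by simpa using hR.forward h hh 0 a b (min g r₀ - h))
    (fun h hh a b => by simpa using hR.forward h hh 1 a b (g - h)) (fun h hh => ?_)
    (fun h hh => ?_) ?_ ?_ c1 c2 c3 c4 c5
  · have h1 := hR.vnorm_lagSum_sub_le hD.pos hc.one_le hL0 hA hL hh (le_refl 0)
      (by omega : g - h ≤ n) v
    rw [max_eq_right (by omega), min_sub_sub_right] at h1
    rw [sampleCross_zero hgn]
    exact h1.trans (mul_le_mul_of_nonneg_right (mul_le_mul_of_nonneg_right k1 (by positivity))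
      (vnorm_nonneg _))
  · exact_mod_cast (by omega : (min g r₀ - h - 0).toNat ≤ n)
  · simp only [misclassified, if_pos]
    exact_mod_cast (by omega : (g - h - r₀).toNat ≤ (g - r₀).toNat)
  · obtain ⟨h, hh, hv⟩ := hD.nonsing 0 _ hmin
    refine ⟨h, hh, ?_⟩
    rwa [popCross_zero (hD.floor_le hmin), hD.floor_min] at hv
  -- If the tentative break is not late, no time is misclassified and the required lower bound is
  -- nonpositive. Otherwise nonsingularity holds on average over `(r₀, g]`, which exceeds the
  -- foreign range by at most `h₀` points.
  · rcases le_or_gt g r₀ with hle | hlt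
    · obtain ⟨h, hh, -⟩ := hD.nonsing 0 γ hγ'
      refine ⟨h, hh, Finset.Ioc r₀ (g - h), fun a b => ?_, fun v => le_trans ?_ (vnorm_nonneg _)⟩
      · rw [sub_self, abs_zero]; exact mul_nonneg (Nat.cast_nonneg _) hc.H_nonneg
      · have : (g - r₀).toNat = 0 := by omega
        simp only [misclassified, if_pos, ← hg, this, Nat.cast_zero, zero_sub]
        refine mul_nonpos_of_nonpos_of_nonneg (div_nonpos_of_nonpos_of_nonneg ?_
          (Nat.cast_nonneg _)) (vnorm_nonneg _)
        have := mul_nonneg hc.u₀_nonneg (Nat.cast_nonneg (α := ℝ) h₀)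
        linarith
    · have hγ0 : (r₀ : ℝ) / n < γ := by
        rw [div_lt_iff₀ (by exact_mod_cast hD.pos)]
        have : (r₀ : ℝ) < g := by exact_mod_cast hlt
        exact this.trans_le (Int.floor_le _)
      obtain ⟨h, hh, hv⟩ := hD.stretch_right γ ⟨hγ0, hγ.2⟩ hlt
      refine ⟨h, hh, Finset.Ioc r₀ g, fun a b => abs_sum_Ioc_sub_le hc.H_nonneg
        (fun t ht => hD.moment_le 1 h a b t (by omega)) (Finset.mem_Icc.1 hh).2, ?_⟩
      have := le_vnorm_scaled_avgCross (μ := μ) (x 1) (h := h) (n := n) (c₁ := (r₀ : ℝ) / n)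
        (c₂ := γ) (N := (misclassified n r₀ γ 0 : ℝ) - h₀) (u₀ := u₀)
        (by rw [hD.floor_break]; exact hlt) hc.u₀_nonneg ?_ hv
      · rwa [hD.floor_break] at this
      · rw [hD.floor_break]
        simp only [misclassified, if_pos]
        exact_mod_cast (by omega : ((g - r₀).toNat : ℤ) - h₀ ≤ g - r₀)

/-- Mirror image of the first regime: own pairs start in `(max g r₀, n - h]`, foreign ones in `(g,
r₀ - h]`, and now the right end `γ = η 1` is admitted. -/
lemma factorApprox_sampleCross_one (hD : IsDesign μ x n r₀ h₀ η u u₀ H)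
    (hR : IsRegularSample μ x A ε n r₀ h₀ κ C ω) (hc : ApproxConstants k n h₀ κ C B K c u u₀ H)
    (hL0 : ∀ i, 0 ≤ L i) (hA : ∀ i v, vnorm (A i *ᵥ v) ≤ L i * vnorm v)
    (hL : ∀ i, L i ^ 2 ≤ B * p) (hγ : γ ∈ Set.Ioc (η 0) (η 1)) :
    FactorApprox h₀ (A 1) (A 0) K c (p / √n) n (misclassified n r₀ γ 1)
      (fun h => sampleCross n (fun t => obs A x ε r₀ t ω) 1 h γ) := by
  have hγ' : γ ∈ Set.Icc (η 0) (η 1) := Set.Ioc_subset_Icc_self hγ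
  have hg0 := hD.floor_nonneg hγ'
  have hgn := hD.floor_le hγ'
  have hrn := hD.break_le
  have hn0 : (n : ℝ) ≠ 0 := by exact_mod_cast hD.pos.ne'
  obtain ⟨k1, k2⟩ := hc.derived
  obtain ⟨c1, -, c3, -, -⟩ := k2 1
  obtain ⟨-, c2, -, c4, c5⟩ := k2 0
  set g := ⌊γ * n⌋ with hg
  have hmax : max γ ((r₀ : ℝ) / n) ∈ Set.Icc (η 0) (η 1) :=
    ⟨hγ'.1.trans (le_max_left _ _), max_le hγ'.2 hD.break_mem.2.le⟩
  refine factorApprox_of_intervalBound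
    (m := fun h t a b => ∫ ω, x 1 t ω a * x 1 (t + h) ω b ∂μ)
    (m' := fun h t a b => ∫ ω, x 0 t ω a * x 0 (t + h) ω b ∂μ)
    (z := fun t => x 1 t ω) (z' := fun t => x 0 t ω)
    (l := fun _ => max g r₀) (u := fun h => n - h) (l' := fun _ => g) (u' := fun h => r₀ - h)
    (u₁ := u) (u₂ := u₀) (D := h₀ * H) hD.pos hc.κ_nonneg (zero_le_one.trans hc.one_le)
    (mul_nonneg (Nat.cast_nonneg _) hc.H_nonneg) (Nat.cast_nonneg _) (fun h hh v => ?_)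
    (fun h hh a b => by simpa using hR.backward h hh 1 a b (max g r₀) (le_max_of_le_left hg0))
    (fun h hh a b => by simpa using hR.backward h hh 0 a b g hg0) (fun h hh => ?_)
    (fun h hh => ?_) ?_ ?_ c1 c2 c3 c4 c5
  · have h1 := hR.vnorm_lagSum_sub_le hD.pos hc.one_le hL0 hA hL hh hg0
      (by omega : (n : ℤ) - h ≤ n) v
    rw [min_sub_sub_right, min_eq_right hrn, sub_right_comm] at h1
    rw [sampleCross_one hg0]
    exact h1.trans (mul_le_mul_of_nonneg_right (mul_le_mul_of_nonneg_right k1 (by positivity))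
      (vnorm_nonneg _))
  · exact_mod_cast (by omega : (n - h - max g r₀).toNat ≤ n)
  · simp only [misclassified, one_ne_zero, if_false]
    exact_mod_cast (by omega : (r₀ - h - g).toNat ≤ (r₀ - g).toNat)
  · obtain ⟨h, hh, hv⟩ := hD.nonsing 1 _ hmax
    refine ⟨h, hh, ?_⟩
    rwa [popCross_one (hD.floor_nonneg hmax), hD.floor_max] at hv
  -- A stretch of at most `h₀` times needs no information, since the bound to be proved is
  -- proportional to `N - h₀`. For longer stretches the average runs over exactly the foreign range.
  · rcases le_or_gt ((r₀ : ℤ) - h₀) g with hle | hlt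
    · obtain ⟨h, hh, -⟩ := hD.nonsing 1 γ hγ'
      refine ⟨h, hh, Finset.Ioc g (r₀ - h), fun a b => ?_, fun v => le_trans ?_ (vnorm_nonneg _)⟩
      · rw [sub_self, abs_zero]; exact mul_nonneg (Nat.cast_nonneg _) hc.H_nonneg
      · refine mul_nonpos_of_nonpos_of_nonneg (div_nonpos_of_nonpos_of_nonneg
          (mul_nonpos_of_nonneg_of_nonpos hc.u₀_nonneg ?_) (Nat.cast_nonneg _)) (vnorm_nonneg _)
        simp only [misclassified, one_ne_zero, if_false, sub_nonpos]
        exact_mod_cast (by omega : (r₀ - g).toNat ≤ h₀)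
    · have hγ0 : γ < (r₀ : ℝ) / n := by
        by_contra! hcon
        have h1 := Int.floor_mono (mul_le_mul_of_nonneg_right hcon (Nat.cast_nonneg (α := ℝ) n))
        rw [hD.floor_break] at h1
        omega
      obtain ⟨h, hh, hv⟩ := hD.stretch_left γ ⟨hγ.1, hγ0⟩ hlt
      have hh' := (Finset.mem_Icc.1 hh).2
      have hfl : ⌊((r₀ : ℝ) / n - (h : ℝ) / n) * n⌋ = (r₀ : ℤ) - h := by
        rw [← sub_div, div_mul_cancel₀ _ hn0]
        exact_mod_cast Int.floor_intCast (R := ℝ) ((r₀ : ℤ) - h)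
      refine ⟨h, hh, Finset.Ioc g (r₀ - h), fun a b => ?_, ?_⟩
      · rw [sub_self, abs_zero]; exact mul_nonneg (Nat.cast_nonneg _) hc.H_nonneg
      have := le_vnorm_scaled_avgCross (μ := μ) (x 0) (h := h) (n := n) (c₁ := γ)
        (c₂ := (r₀ : ℝ) / n - (h : ℝ) / n)
        (N := (misclassified n r₀ γ 1 : ℝ) - h₀) (u₀ := u₀)
        (by rw [hfl]; omega) hc.u₀_nonneg ?_ hv
      · rwa [hfl] at this
      · rw [hfl]
        simp only [misclassified, one_ne_zero, if_false]
        exact_mod_cast (by omega : ((r₀ - g).toNat : ℤ) - h₀ ≤ r₀ - h - g)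

end Design


/-! ### The rate on the regular realisations -/

section Rate

lemma LoadingBounds.mono {p k : ℕ} {A : Matrix (Fin p) (Fin k) ℝ} {a L K K' q : ℝ}
    (h : LoadingBounds A a L K q) (hq : 0 ≤ q) (hK : K ≤ K') : LoadingBounds A a L K' q where
  pos := h.pos
  nonneg := h.nonneg
  lower := h.lower
  upper := h.upper
  le_lower := h.le_lower.trans (mul_le_mul_of_nonneg_right hK (sq_nonneg _))
  upper_le := h.upper_le.trans (mul_le_mul_of_nonneg_right hK hq)

variable {Ω : Type*} [MeasurableSpace Ω] {μ : Measure Ω} {k : Fin 2 → ℕ} {h₀ : ℕ}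
  {x : ∀ i, ℤ → Ω → Fin (k i) → ℝ} {κ C B K c d u u₀ H : ℝ}

lemma factorApprox_sampleCross {p n r₀ : ℕ} {A : ∀ i, Matrix (Fin p) (Fin (k i)) ℝ}
    {ε : ℤ → Ω → Fin p → ℝ} {ω : Ω} {η L : Fin 2 → ℝ} (hD : IsDesign μ x n r₀ h₀ η u u₀ H)
    (hR : IsRegularSample μ x A ε n r₀ h₀ κ C ω) (hc : ApproxConstants k n h₀ κ C B K c u u₀ H)
    (hL0 : ∀ i, 0 ≤ L i) (hA : ∀ i v, vnorm (A i *ᵥ v) ≤ L i * vnorm v)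
    (hL : ∀ i, L i ^ 2 ≤ B * p) {γ : Fin 2 → ℝ} (h0 : γ 0 ∈ Set.Ico (η 0) (η 1))
    (h1 : γ 1 ∈ Set.Ioc (η 0) (η 1)) (i j : Fin 2) (hij : i ≠ j) :
    FactorApprox h₀ (A i) (A j) K c (p / √n) n (misclassified n r₀ (γ i) i)
      (fun h => sampleCross n (fun t => obs A x ε r₀ t ω) i h (γ i)) := by
  fin_cases i <;> fin_cases j
  · exact absurd rfl hij
  · exact factorApprox_sampleCross_zero hD hR hc hL0 hA hL h0
  · exact factorApprox_sampleCross_one hD hR hc hL0 hA hL h1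
  · exact absurd rfl hij

/-- The rates of both estimators, on the event that the sample is regular. -/
lemma exists_rate_bound (hk : ∀ i, 0 < k i) (hκ : 0 ≤ κ) (hC : 1 ≤ C) (hB : 0 ≤ B) (hH : 0 ≤ H)
    (hu₀ : 0 ≤ u₀) (hc : 0 < c) (hd : 0 < d) (hcu₀ : c ≤ u₀ - ((k 0 : ℝ) + k 1) ^ 2 * κ) :
    ∃ D r : ℝ, 0 < r ∧ ∀ {p n r₀ : ℕ} {A : ∀ i, Matrix (Fin p) (Fin (k i)) ℝ}
      {ε : ℤ → Ω → Fin p → ℝ} {ω : Ω} {η a L q : Fin 2 → ℝ}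
      {V : Fin 2 → ℝ → Matrix (Fin p) (Fin p) ℝ} {γ : ℝ},
      0 < p → IsDesign μ x n r₀ h₀ η u u₀ H → IsRegularSample μ x A ε n r₀ h₀ κ C ω →
      c ≤ u - ((k 0 : ℝ) + k 1) ^ 2 * (κ + C / n) →
      (∀ i, LoadingBounds (A i) (a i) (L i) B (q i)) → (∀ i, 0 < q i) → (∀ i, q i ≤ p) →
      (∀ i, p / √n ≤ r * q i) →
      (∀ i γ, IsEigenSystem (sampleM n h₀ (fun t => obs A x ε r₀ t ω) i γ) (V i γ)) →
      d < spaceDist (colSpace (A 0)) (colSpace (A 1)) →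
      IsBreakEstimate n h₀ k η (fun t => obs A x ε r₀ t ω) (fun i => V i (η i)) γ →
      ∀ i, spaceDist (colSpace (firstCols (k i) (V i γ))) (colSpace (A i)) ≤
          D * (p / √n / q i) ∧
        spaceDist (colSpace (firstCols (k i) (V i ((r₀ : ℝ) / n)))) (colSpace (A i)) ≤
          D * (p / √n / q i) := by
  -- One constant dominates the error, upper-moment and contamination constants; the last summand
  -- makes it serve for the loading bounds as well.
  set K := 2 * C + ((k 0 : ℝ) + k 1) ^ 2 * (C * B + 2 * C + h₀ * H) + u₀ * h₀ + B with hKdef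
  have hK0 : 0 ≤ ((k 0 : ℝ) + k 1) ^ 2 * (C * B + 2 * C + h₀ * H) := by positivity
  have hK1 : 0 ≤ u₀ * h₀ := by positivity
  have hK : 1 ≤ K := by linarith
  have hBK : B ≤ K := by linarith
  obtain ⟨X, hX0, r, hr, hX⟩ := exists_contamination_bound h₀ hk hK hc hd
  refine ⟨(h₀ + 1) * (K + K ^ 2 * (X + 1)) * K / c, r, hr, ?_⟩
  intro p n r₀ A ε ω η a L q V γ hp hD hR hcu hA hq0 hqp hqr hV hdist hγ
  have hn0 : (0 : ℝ) < n := by exact_mod_cast hD.pos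
  have hn1 : (1 : ℝ) ≤ n := by exact_mod_cast hD.pos
  have hp0 : (0 : ℝ) < p := by exact_mod_cast hp
  have hs : 1 ≤ √(n : ℝ) := Real.one_le_sqrt.2 hn1
  set e := (p : ℝ) / √n with he
  have he0 : 0 < e := by positivity
  -- Indeed `n * e = √n * p`, which is at least `p`.
  have hne : ∀ i, q i ≤ n * e := fun i => by
    have h1 : n * e = √n * p := by
      rw [he, mul_div_assoc', eq_comm, eq_div_iff (by positivity)]
      nlinarith [Real.mul_self_sqrt hn0.le]
    rw [h1]
    nlinarith [hqp i]
  have hAK : ∀ i, LoadingBounds (A i) (a i) (L i) K (q i) := fun i => (hA i).mono (hq0 i).le hBK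
  have hconst : ApproxConstants k n h₀ κ C B K c u u₀ H :=
    ⟨hκ, hC, hB, hH, hu₀, hcu, hcu₀, by linarith⟩
  have happrox := @factorApprox_sampleCross Ω _ μ k h₀ x κ C B K c u u₀ H p n r₀ A ε ω η L hD hR
    hconst (fun i => (hA i).nonneg) (fun i => (hA i).upper)
    (fun i => (hA i).upper_le.trans (mul_le_mul_of_nonneg_left (hqp i) hB))
  have hη : η 0 < η 1 := hD.break_mem.1.trans hD.break_mem.2
  have hgrid : (r₀ : ℝ) / n ∈ grid n η :=
    ⟨⟨r₀, by exact_mod_cast hD.break_le, rfl⟩, hD.break_mem⟩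
  have hγmem := hγ.1.2
  have hS := happrox (γ := fun _ => γ) (Set.Ioo_subset_Ico_self hγmem)
    (Set.Ioo_subset_Ioc_self hγmem)
  have hS₀ : ∀ i j, i ≠ j → FactorApprox h₀ (A i) (A j) K c e n 0
      (fun h => sampleCross n (fun t => obs A x ε r₀ t ω) i h ((r₀ : ℝ) / n)) := by
    intro i j hij
    have := happrox (γ := fun _ => (r₀ : ℝ) / n) (Set.Ioo_subset_Ico_self hD.break_mem)
      (Set.Ioo_subset_Ioc_self hD.break_mem) i j hij
    have h0 : misclassified n r₀ ((r₀ : ℝ) / n) i = 0 := by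
      simp [misclassified, hD.floor_break]
    simpa only [h0, Nat.cast_zero] using this
  have hR₀ : ∀ i j, i ≠ j → FactorApprox h₀ (A i) (A j) K c e n 0
      (fun h => sampleCross n (fun t => obs A x ε r₀ t ω) i h (η i)) := by
    intro i j hij
    have := happrox (γ := η) ⟨le_rfl, hη⟩ ⟨hη, le_rfl⟩ i j hij
    -- The true break lies between `η 0` and `η 1`, so the times up to `η 0` and those after `η 1`
    -- belong wholly to their regime.
    have h0 : misclassified n r₀ (η i) i = 0 := by
      have hf : ∀ a b : ℝ, a ≤ b → ⌊a * n⌋ ≤ ⌊b * n⌋ := fun a b hab =>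
        Int.floor_mono (mul_le_mul_of_nonneg_right hab hn0.le)
      have h1 := hf _ _ hD.break_mem.1.le
      have h2 := hf _ _ hD.break_mem.2.le
      rw [hD.floor_break] at h1 h2
      fin_cases i <;> simp [misclassified] <;> omega
    simpa only [h0, Nat.cast_zero] using this
  have hcont := hX (N := fun i => misclassified n r₀ γ i) (V := fun i => V i (η i)) he0 hn0
    (fun i => Nat.cast_nonneg _) hq0 hAK hne hqr (fun i => hV i (η i)) hR₀ hS₀ hS hdist
    (hγ.2 _ hgrid)
  intro i
  obtain ⟨j, hij⟩ : ∃ j, i ≠ j := by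
    fin_cases i
    exacts [⟨1, by simp⟩, ⟨0, by simp⟩]
  refine ⟨(hS i j hij).spaceDist_le (hV i γ) rfl (hk i) hK hc he0.le hn0 (Nat.cast_nonneg _) hX0
    (hq0 i) (hAK i) (hAK j) (hne j) (hcont i j hij), (hS₀ i j hij).spaceDist_le (hV i _) rfl (hk i)
    hK hc he0.le hn0 le_rfl hX0 (hq0 i) (hAK i) (hAK j) (hne j) (by rw [zero_mul]; positivity)⟩

end Rate


/-! ### Properties that hold with probability close to one -/

section Tight

variable {Ω : Type*} [MeasurableSpace Ω] {μ : Measure Ω}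

/-- A property that becomes weaker as the constant grows, and holds eventually with probability
as close to one as desired if the constant is large. -/
def HoldsTightly (μ : Measure Ω) (Q : ℝ → ℕ → Ω → Prop) : Prop :=
  (∀ ⦃C C'⦄, C ≤ C' → ∀ m ω, Q C m ω → Q C' m ω) ∧
    ∀ e : ℝ, 0 < e → ∃ C, ∀ᶠ m in atTop, μ {ω | ¬ Q C m ω} ≤ ENNReal.ofReal e

lemma HoldsTightly.forall {ι : Type*} [Finite ι] {Q : ι → ℝ → ℕ → Ω → Prop}
    (h : ∀ i, HoldsTightly μ (Q i)) : HoldsTightly μ fun C m ω => ∀ i, Q i C m ω := by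
  cases nonempty_fintype ι
  refine ⟨fun C C' hC m ω hQ i => (h i).1 hC m ω (hQ i), fun e he => ?_⟩
  have hpos : (0 : ℝ) < Fintype.card ι + 1 := by positivity
  choose C hC using fun i => (h i).2 (e / (Fintype.card ι + 1)) (div_pos he hpos)
  -- This sum dominates every single `C i`, and the properties become weaker as the constant grows.
  refine ⟨∑ i, |C i|, ?_⟩
  filter_upwards [eventually_all.2 hC] with m hm
  calc μ {ω | ¬ ∀ i, Q i (∑ i, |C i|) m ω} ≤ μ (⋃ i, {ω | ¬ Q i (C i) m ω}) := by
        refine measure_mono fun ω hω => ?_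
        simp only [Set.mem_ofPred_eq, not_forall] at hω
        obtain ⟨i, hi⟩ := hω
        exact Set.mem_iUnion.2 ⟨i, fun hQ => hi ((h i).1 ((le_abs_self _).trans
          (Finset.single_le_sum (f := fun i => |C i|) (fun _ _ => abs_nonneg _)
            (Finset.mem_univ i))) m ω hQ)⟩
    _ ≤ ∑ i, μ {ω | ¬ Q i (C i) m ω} := measure_iUnion_fintype_le _ _
    _ ≤ ∑ _i : ι, ENNReal.ofReal (e / (Fintype.card ι + 1)) := Finset.sum_le_sum fun i _ => hm i
    _ = ENNReal.ofReal (Fintype.card ι * (e / (Fintype.card ι + 1))) := by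
        rw [Finset.sum_const, Finset.card_univ, nsmul_eq_mul, ENNReal.ofReal_mul (by positivity),
          ENNReal.ofReal_natCast]
    _ ≤ ENNReal.ofReal e := by
        refine ENNReal.ofReal_le_ofReal ?_
        rw [mul_div_assoc', div_le_iff₀ hpos]
        nlinarith

lemma HoldsTightly.congr {Q Q' : ℝ → ℕ → Ω → Prop} (h : HoldsTightly μ Q)
    (hQ : ∀ C m ω, Q C m ω ↔ Q' C m ω) : HoldsTightly μ Q' := by
  rwa [show Q' = Q from funext fun C => funext fun m => funext fun ω => propext (hQ C m ω).symm]

lemma HoldsTightly.and {Q Q' : ℝ → ℕ → Ω → Prop} (h : HoldsTightly μ Q) (h' : HoldsTightly μ Q') :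
    HoldsTightly μ fun C m ω => Q C m ω ∧ Q' C m ω := by
  have := HoldsTightly.forall (μ := μ) (Q := fun b : Bool => if b then Q else Q')
    (by intro b; cases b <;> simpa)
  simpa [and_comm] using this

variable [IsProbabilityMeasure μ] {k : Fin 2 → ℕ} {x : ∀ i, ℤ → Ω → Fin (k i) → ℝ}
  {ζ σx σ κ : ℝ}

/-- The constant for interval sums does not depend on the fixed endpoint, so the endpoints may move
with the experiment. -/
lemma holdsTightly_intervalBound (hx : ∀ i t, Measurable (x i t)) (hζ : 2 < ζ) (hσx : 0 < σx)
    (h_mixing : Summable fun t : ℕ => alphaMix μ x (t + 1) ^ (1 - 2 / ζ))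
    (hm : MomentBound μ x ζ σx) (hκ : 0 < κ) (h : ℕ) (i : Fin 2) (a b : Fin (k i)) (l u : ℕ → ℤ)
    (hl : ∀ m, 0 ≤ l m) :
    HoldsTightly μ fun C m ω =>
      (∀ v, IntervalBound κ C (fun t => x i t ω a * x i (t + h) ω b)
        (fun t => ∫ ω, x i t ω a * x i (t + h) ω b ∂μ) (l m) v) ∧
      (∀ v, 0 ≤ v → IntervalBound κ C (fun t => x i t ω a * x i (t + h) ω b)
        (fun t => ∫ ω, x i t ω a * x i (t + h) ω b ∂μ) v (u m)) := by
  refine HoldsTightly.and ⟨fun C C' hC m ω hQ v => (hQ v).mono hC, fun e he => ?_⟩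
    ⟨fun C C' hC m ω hQ v hv => (hQ v hv).mono hC, fun e he => ?_⟩
  all_goals
    obtain ⟨C, -, hC⟩ := exists_intervalBound (μ := μ) hx hζ h_mixing
      (Real.rpow_nonneg hσx.le (4 * ζ)) h hκ he
    have := hC (fun t ω => x i t ω a * x i (t + h) ω b)
      (fun t => by
        have h1 := (measurable_pi_apply a).comp
          (measurable_sigmaX x (T := Set.Icc t (t + h)) (t := t) ⟨le_rfl, by omega⟩ i)
        have h2 := (measurable_pi_apply b).comp
          (measurable_sigmaX x (T := Set.Icc t (t + h)) (t := t + h) ⟨by omega, le_rfl⟩ i)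
        exact h1.mul h2)
      (fun t ht => hm.mul hx a b ht (by omega))
    refine ⟨C, Eventually.of_forall fun m => ?_⟩
  · simpa only [not_forall] using this.1 (l m) (hl m)
  · simpa only [not_forall, exists_prop] using this.2 (u m)

lemma MomentBound.integral_abs_mul_le (hm : MomentBound μ x ζ σx) (hx : ∀ i t, Measurable (x i t))
    (hζ : 2 < ζ) {i i' : Fin 2} (a : Fin (k i)) (b : Fin (k i')) {s t : ℤ} (hs : 1 ≤ s)
    (ht : 1 ≤ t) : ∫ ω, |x i s ω a * x i' t ω b| ∂μ ≤ 1 + σx ^ (4 * ζ) := by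
  obtain ⟨h1, h2⟩ := hm.mul hx a b hs ht
  exact integral_abs_le_of_rpow hζ h1 h2

lemma MomentBound.integrable_mul (hm : MomentBound μ x ζ σx) (hx : ∀ i t, Measurable (x i t))
    (hζ : 2 < ζ) {i i' : Fin 2} (a : Fin (k i)) (b : Fin (k i')) {s t : ℤ} (hs : 1 ≤ s)
    (ht : 1 ≤ t) : Integrable (fun ω => x i s ω a * x i' t ω b) μ :=
  (hm.memLp hx hζ i a hs).integrable_mul (hm.memLp hx hζ i' b ht)

lemma measure_lt_le_of_integral_le {X : Ω → ℝ} {b s e : ℝ} (h0 : ∀ ω, 0 ≤ X ω)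
    (hX : Integrable X μ) (hb : ∫ ω, X ω ∂μ ≤ b) (hs : 0 < s) (he : b ≤ s * e) :
    μ {ω | s < X ω} ≤ ENNReal.ofReal e := by
  have h1 := mul_meas_ge_le_integral_of_nonneg (μ := μ) (Eventually.of_forall h0) hX s
  have h2 : μ.real {ω | s ≤ X ω} ≤ e :=
    le_of_mul_le_mul_left ((h1.trans hb).trans he) hs
  calc μ {ω | s < X ω} ≤ μ {ω | s ≤ X ω} := measure_mono fun ω (hω : s < X ω) => hω.le
    _ = ENNReal.ofReal (μ.real {ω | s ≤ X ω}) := (ofReal_measureReal (measure_ne_top _ _)).symm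
    _ ≤ ENNReal.ofReal e := ENNReal.ofReal_le_ofReal h2

/-- Markov's inequality for a sum of `h` terms with bounded mean. The condition `h ≤ r₀ m` keeps all
times at least one, where the moments are bounded. -/
lemma holdsTightly_mixed (hx : ∀ i t, Measurable (x i t)) (hζ : 2 < ζ) (hσx : 0 < σx)
    (hm : MomentBound μ x ζ σx) (h : ℕ) (a : Fin (k 0)) (b : Fin (k 1)) {r₀ : ℕ → ℕ}
    (hr : ∀ᶠ m in atTop, h ≤ r₀ m) :
    HoldsTightly μ fun C m ω =>
      ∑ t ∈ Finset.Ioc ((r₀ m : ℤ) - h) (r₀ m), |x 0 t ω a * x 1 (t + h) ω b| ≤ C := by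
  refine ⟨fun C C' hC m ω hQ => hQ.trans hC, fun e he => ?_⟩
  have hσ : 0 ≤ 1 + σx ^ (4 * ζ) := by positivity
  refine ⟨h * (1 + σx ^ (4 * ζ)) / e + 1, ?_⟩
  filter_upwards [hr] with m hm'
  have hi : ∀ t ∈ Finset.Ioc ((r₀ m : ℤ) - h) (r₀ m),
      Integrable (fun ω => |x 0 t ω a * x 1 (t + h) ω b|) μ := fun t ht => by
    rw [Finset.mem_Ioc] at ht
    exact (hm.integrable_mul hx hζ a b (by omega) (by omega)).abs
  have hint : ∫ ω, ∑ t ∈ Finset.Ioc ((r₀ m : ℤ) - h) (r₀ m), |x 0 t ω a * x 1 (t + h) ω b| ∂μ ≤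
      h * (1 + σx ^ (4 * ζ)) := by
    rw [integral_finsetSum _ hi]
    refine (Finset.sum_le_card_nsmul _ _ (1 + σx ^ (4 * ζ)) fun t ht => ?_).trans ?_
    · rw [Finset.mem_Ioc] at ht
      exact hm.integral_abs_mul_le hx hζ a b (by omega) (by omega)
    · rw [Int.card_Ioc, sub_sub_cancel, Int.toNat_natCast, nsmul_eq_mul]
  have hC0 : 0 < h * (1 + σx ^ (4 * ζ)) / e + 1 := by positivity
  simp only [not_le]
  refine measure_lt_le_of_integral_le (fun ω => Finset.sum_nonneg fun _ _ => abs_nonneg _)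
    (integrable_finsetSum _ hi) hint hC0 ?_
  rw [add_mul, div_mul_cancel₀ _ he.ne']
  linarith

lemma holdsTightly_noise (hx : ∀ i t, Measurable (x i t)) (hζ : 2 < ζ) (hσx : 0 < σx)
    (hm : MomentBound μ x ζ σx) {B : ℝ} (hB : 0 ≤ B) {h : ℕ} (hh : 1 ≤ h) {n p r₀ : ℕ → ℕ}
    {A : ∀ m i, Matrix (Fin (p m)) (Fin (k i)) ℝ} {ε : ∀ m, ℤ → Ω → Fin (p m) → ℝ}
    {L : ℕ → Fin 2 → ℝ} (hε : ∀ m, IsWhiteNoise μ x (ε m) σ)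
    (hev : ∀ᶠ m in atTop, 0 < p m ∧ 0 < n m ∧ (∀ i v, vnorm (A m i *ᵥ v) ≤ L m i * vnorm v) ∧
      ∀ i, L m i ^ 2 ≤ B * p m) :
    HoldsTightly μ fun C m ω => ∀ N ≤ n m, ∑ c : Fin (p m) × Fin (p m), (∑ j ∈ Finset.range N,
      (obs (A m) x (ε m) (r₀ m) (1 + j) ω c.1 * obs (A m) x (ε m) (r₀ m) (1 + j + h) ω c.2 -
        signal (A m) x (r₀ m) (1 + j) ω c.1 * signal (A m) x (r₀ m) (1 + j + h) ω c.2)) ^ 2 ≤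
      C * ((p m : ℝ) ^ 2 * n m) := by
  refine ⟨fun C C' hC m ω hQ N hN => (hQ N hN).trans
    (mul_le_mul_of_nonneg_right hC (by positivity)), fun e he => ?_⟩
  obtain ⟨C, -, hC⟩ := exists_noise_bound hm hx hζ hσx B σ hB he
  refine ⟨C, ?_⟩
  filter_upwards [hev] with m ⟨hp, hn, hA, hL⟩
  simpa only [not_forall, exists_prop, not_le] using
    hC (p m) (n m) (r₀ m) (A m) (ε m) (L m) h hp hn hh (hε m) hA hL

lemma holdsTightly_isRegularSample (hx : ∀ i t, Measurable (x i t)) (hζ : 2 < ζ) (hσx : 0 < σx)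
    (h_mixing : Summable fun t : ℕ => alphaMix μ x (t + 1) ^ (1 - 2 / ζ))
    (hm : MomentBound μ x ζ σx) (hκ : 0 < κ) {B : ℝ} (hB : 0 ≤ B) {h₀ : ℕ} {n p r₀ : ℕ → ℕ}
    {A : ∀ m i, Matrix (Fin (p m)) (Fin (k i)) ℝ} {ε : ∀ m, ℤ → Ω → Fin (p m) → ℝ}
    {L : ℕ → Fin 2 → ℝ} (hε : ∀ m, IsWhiteNoise μ x (ε m) σ)
    (hev : ∀ᶠ m in atTop, 0 < p m ∧ 0 < n m ∧ (∀ i v, vnorm (A m i *ᵥ v) ≤ L m i * vnorm v) ∧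
      ∀ i, L m i ^ 2 ≤ B * p m) (hr : ∀ᶠ m in atTop, h₀ ≤ r₀ m) :
    HoldsTightly μ fun C m ω => IsRegularSample μ x (A m) (ε m) (n m) (r₀ m) h₀ κ C ω := by
  have h1 := HoldsTightly.forall (μ := μ) fun h : Finset.Icc 1 h₀ =>
    ((holdsTightly_noise (r₀ := r₀) hx hζ hσx hm hB (Finset.mem_Icc.1 h.2).1 hε hev).and
      (HoldsTightly.forall fun i => HoldsTightly.forall fun a => HoldsTightly.forall fun b =>
        holdsTightly_intervalBound hx hζ hσx h_mixing hm hκ h i a b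
          (fun m => if i = 0 then 0 else r₀ m)
          (fun m => (if i = 0 then r₀ m else n m : ℕ) - (h : ℕ)) fun m => by
            split_ifs <;> positivity)).and
      (HoldsTightly.forall fun a => HoldsTightly.forall fun b =>
        holdsTightly_mixed hx hζ hσx hm h a b
          (hr.mono fun m hm => (Finset.mem_Icc.1 h.2).2.trans hm))
  exact h1.congr fun C m ω => ⟨fun hQ => ⟨fun h hh => (hQ ⟨h, hh⟩).1.1,
      fun h hh i a b => ((hQ ⟨h, hh⟩).1.2 i a b).1, fun h hh i a b => ((hQ ⟨h, hh⟩).1.2 i a b).2,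
      fun h hh => (hQ ⟨h, hh⟩).2⟩,
    fun hR h => ⟨⟨hR.noise h h.2, fun i a b => ⟨hR.forward h h.2 i a b, hR.backward h h.2 i a b⟩⟩,
      hR.mixed h h.2⟩⟩

end Tight


/-! ### The population autocovariances at the true break -/

section Population

/-- Eigenvectors of `A * N` for nonzero eigenvalues lie in the range of `A`. Distinct eigenvalues
give `k` independent ones, so `A` has full column rank. -/
lemma mulVec_injective_of_eigenvalues {p k : ℕ} {A : Matrix (Fin p) (Fin k) ℝ}
    {N : Matrix (Fin k) (Fin p) ℝ} {S : Finset ℝ} (hS : S.card = k)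
    (h : ∀ l ∈ S, 0 < l ∧ Module.End.HasEigenvalue (Matrix.toLin' (A * N)) l) (v : Fin k → ℝ)
    (hv : A *ᵥ v = 0) : v = 0 := by
  choose f hf using fun l : S => (h l l.2).2.exists_hasEigenvector
  have hli : LinearIndependent ℝ f :=
    Module.End.eigenvectors_linearIndependent' _ (fun l : S => (l : ℝ)) Subtype.val_injective f hf
  have hmem : Set.range f ⊆ LinearMap.range A.mulVecLin := by
    rintro _ ⟨l, rfl⟩
    have h1 := (hf l).apply_eq_smul
    rw [Matrix.toLin'_apply, ← Matrix.mulVec_mulVec] at h1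
    refine ⟨(l : ℝ)⁻¹ • (N *ᵥ f l), ?_⟩
    rw [map_smul, Matrix.mulVecLin_apply, h1, inv_smul_smul₀ (h l l.2).1.ne']
  have h1 := finrank_span_eq_card hli
  have h2 := Submodule.finrank_mono (Submodule.span_le.2 hmem)
  have h3 := LinearMap.finrank_range_add_finrank_ker A.mulVecLin
  rw [h1, Fintype.card_coe, hS] at h2
  rw [Module.finrank_fin_fun] at h3
  have h4 : LinearMap.ker A.mulVecLin = ⊥ := Submodule.finrank_eq_zero.1 (by omega)
  exact LinearMap.ker_eq_bot'.1 h4 v hv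

variable {Ω : Type*} [MeasurableSpace Ω] {μ : Measure Ω} [IsProbabilityMeasure μ]
  {k : Fin 2 → ℕ} {p n r₀ h₀ : ℕ} {x : ∀ i, ℤ → Ω → Fin (k i) → ℝ}
  {A : ∀ i, Matrix (Fin p) (Fin (k i)) ℝ} {ε : ℤ → Ω → Fin p → ℝ} {ζ σx σ γ : ℝ}

lemma integral_mulVec_mul_mulVec (hx : ∀ i t, Measurable (x i t)) (hζ : 2 < ζ)
    (hm : MomentBound μ x ζ σx) (i : Fin 2) {s t : ℤ} (hs : 1 ≤ s) (ht : 1 ≤ t) (a b : Fin p) :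
    ∫ ω, (A i *ᵥ x i s ω) a * (A i *ᵥ x i t ω) b ∂μ =
      (A i * (Matrix.of fun j l => ∫ ω, x i s ω j * x i t ω l ∂μ) * (A i)ᵀ) a b := by
  have h1 : ∀ ω, (A i *ᵥ x i s ω) a * (A i *ᵥ x i t ω) b =
      ∑ l, ∑ j, A i a j * (x i s ω j * x i t ω l) * A i b l := fun ω => by
    simp only [Matrix.mulVec, dotProduct, Finset.sum_mul_sum]
    rw [Finset.sum_comm]
    exact Finset.sum_congr rfl fun _ _ => Finset.sum_congr rfl fun _ _ => by ring
  have hi : ∀ j l, Integrable (fun ω => A i a j * (x i s ω j * x i t ω l) * A i b l) μ :=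
    fun j l => ((hm.integrable_mul hx hζ j l hs ht).const_mul _).mul_const _
  simp only [h1, Matrix.mul_apply, Matrix.of_apply, Matrix.transpose_apply]
  rw [integral_finsetSum _ fun l _ => integrable_finsetSum _ fun j _ => hi j l]
  refine Finset.sum_congr rfl fun l _ => ?_
  rw [integral_finsetSum _ fun j _ => hi j l, Finset.sum_mul]
  refine Finset.sum_congr rfl fun j _ => ?_
  rw [integral_mul_const, integral_const_mul]

lemma scaled_sum_of {ι : Type*} (n : ℕ) (I : Finset ℤ) (f : ℤ → ι → ι → ℝ) :
    (Matrix.of fun a b => (n : ℝ)⁻¹ * ∑ t ∈ I, f t a b) =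
      (n : ℝ)⁻¹ • ∑ t ∈ I, Matrix.of (f t) := by
  ext a b
  simp [Matrix.sum_apply]

/-- At the true break every attributed pair of times lies wholly in one regime, so no products
straddle the break, and at positive lags the noise does not contribute to the mean. -/
lemma popCross_obs (hx : ∀ i t, Measurable (x i t)) (hζ : 2 < ζ) (hm : MomentBound μ x ζ σx)
    (hε : IsWhiteNoise μ x ε σ) (hγ : ⌊γ * n⌋ = r₀) (hr : r₀ ≤ n) {h : ℕ} (hh : 1 ≤ h)
    (i : Fin 2) :
    popCross μ n (obs A x ε r₀) i h γ = A i * popCross μ n (x i) i h γ * (A i)ᵀ := by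
  have key : ∀ (i : Fin 2) (I : Finset ℤ), (∀ t ∈ I, 1 ≤ t ∧
      ∀ ω, signal A x r₀ t ω = A i *ᵥ x i t ω ∧ signal A x r₀ (t + h) ω = A i *ᵥ x i (t + h) ω) →
      (Matrix.of fun a b => (n : ℝ)⁻¹ *
        ∑ t ∈ I, ∫ ω, obs A x ε r₀ t ω a * obs A x ε r₀ (t + h) ω b ∂μ) =
      A i * (Matrix.of fun a b => (n : ℝ)⁻¹ * ∑ t ∈ I, ∫ ω, x i t ω a * x i (t + h) ω b ∂μ) *
        (A i)ᵀ := by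
    intro i I hI
    rw [scaled_sum_of n I fun t a b => ∫ ω, obs A x ε r₀ t ω a * obs A x ε r₀ (t + h) ω b ∂μ,
      scaled_sum_of n I fun t a b => ∫ ω, x i t ω a * x i (t + h) ω b ∂μ]
    simp only [Matrix.mul_smul, Matrix.smul_mul, Matrix.mul_sum, Matrix.sum_mul]
    congr 1
    refine Finset.sum_congr rfl fun t ht => ?_
    obtain ⟨h1, h2⟩ := hI t ht
    ext a b
    rw [← integral_mulVec_mul_mulVec hx hζ hm i h1 (by omega), Matrix.of_apply,
      integral_obs_mul_obs hm hx hζ hε h1 (by omega)]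
    simp only [(h2 _).1, (h2 _).2]
  fin_cases i
  · have hg : ⌊γ * n⌋ ≤ n := by omega
    simp only [Fin.zero_eta]
    rw [popCross_zero hg, popCross_zero hg]
    refine key 0 _ fun t ht => ?_
    rw [Finset.mem_Ioc] at ht
    refine ⟨by omega, fun ω => ⟨?_, ?_⟩⟩ <;> rw [signal, if_pos (by omega)]
  · have hg : 0 ≤ ⌊γ * n⌋ := by omega
    simp only [Fin.mk_one]
    rw [popCross_one hg, popCross_one hg]
    refine key 1 _ fun t ht => ?_
    rw [Finset.mem_Ioc] at ht
    refine ⟨by omega, fun ω => ⟨?_, ?_⟩⟩ <;> rw [signal, if_neg (by omega)]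

/-- At the true break, the leading eigenvectors span the loading space. -/
lemma colSpace_firstCols_popM (hx : ∀ i t, Measurable (x i t)) (hζ : 2 < ζ)
    (hm : MomentBound μ x ζ σx) (hε : IsWhiteNoise μ x ε σ) (hγ : ⌊γ * n⌋ = r₀) (hr : r₀ ≤ n)
    {i : Fin 2} {a c : ℝ} (ha : 0 < a) (hA : ∀ v, a * vnorm v ≤ vnorm (A i *ᵥ v)) (hc : 0 < c)
    (hT : ∃ h ∈ Finset.Icc 1 h₀, ∀ v, c * vnorm v ≤ vnorm (popCross μ n (x i) i h γ *ᵥ v))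
    {V : Matrix (Fin p) (Fin p) ℝ} (hV : IsEigenSystem (popM μ n h₀ (obs A x ε r₀) i γ) V) :
    colSpace (firstCols (k i) V) = colSpace (A i) := by
  refine colSpace_firstCols_eq hV ha hA fun w hw => ?_
  obtain ⟨h, hh, hv⟩ := hT
  have := vnorm_transpose_le_on_trailing (S := fun h => popCross μ n (obs A x ε r₀) i h γ)
    (T := fun h => popCross μ n (x i) i h γ) hV rfl ha.le le_rfl hA
    ⟨h, hh, fun v => le_vnorm_transpose_mulVec hc hv v⟩ (fun h hh v => by
      rw [popCross_obs hx hζ hm hε hγ hr (Finset.mem_Icc.1 hh).1, sub_self]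
      simp [vnorm_zero]) hw
  rw [mul_zero, zero_mul] at this
  exact vnorm_eq_zero.1 (le_antisymm (nonpos_of_mul_nonpos_right this (mul_pos ha hc))
    (vnorm_nonneg _))

/-- The strength condition alone does not exclude a kernel, because `minNorm` sees only nonzero
eigenvalues. Full column rank comes from the distinct positive eigenvalues of the population matrix,
which factors through `A i`. -/
lemma mulVec_injective_of_popM (hx : ∀ i t, Measurable (x i t)) (hζ : 2 < ζ)
    (hm : MomentBound μ x ζ σx) (hε : IsWhiteNoise μ x ε σ) (hγ : ⌊γ * n⌋ = r₀) (hr : r₀ ≤ n)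
    {i : Fin 2} (hS : ∃ S : Finset ℝ, S.card = k i ∧ ∀ l ∈ S, 0 < l ∧
      Module.End.HasEigenvalue (Matrix.toLin' (popM μ n h₀ (obs A x ε r₀) i γ)) l)
    (v : Fin (k i) → ℝ) (hv : A i *ᵥ v = 0) : v = 0 := by
  obtain ⟨S, hcard, hS⟩ := hS
  have hM : popM μ n h₀ (obs A x ε r₀) i γ = A i * ∑ h ∈ Finset.Icc 1 h₀,
      popCross μ n (x i) i h γ * (A i)ᵀ * (popCross μ n (obs A x ε r₀) i h γ)ᵀ := by
    rw [popM, Matrix.mul_sum]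
    refine Finset.sum_congr rfl fun h hh => ?_
    conv_lhs => enter [1]; rw [popCross_obs hx hζ hm hε hγ hr (Finset.mem_Icc.1 hh).1]
    simp only [Matrix.mul_assoc]
  rw [hM] at hS
  exact mulVec_injective_of_eigenvalues hcard hS v hv

end Population


/-! ### Asymptotics -/

section Asymptotic

/-- Of the four one-sided comparisons two are needed, the upper one for the spectral norm and the
lower one for `minNorm`; two regimes allow a common constant. -/
lemma exists_strength_constant {k : Fin 2 → ℕ} {p : ℕ → ℕ}
    {A : ∀ m i, Matrix (Fin (p m)) (Fin (k i)) ℝ} {q : ℕ → Fin 2 → ℝ} (hq : ∀ m i, 0 ≤ q m i)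
    (h : ∀ i, ((fun m => l2norm (A m i) ^ 2) =Θ[atTop] fun m => q m i) ∧
      ((fun m => minNorm (A m i) ^ 2) =Θ[atTop] fun m => q m i)) :
    ∃ K : ℝ, 0 ≤ K ∧ ∀ᶠ m in atTop, ∀ i, l2norm (A m i) ^ 2 ≤ K * q m i ∧
      q m i ≤ K * minNorm (A m i) ^ 2 := by
  choose c hc using fun i => (h i).1.1.bound
  choose c' hc' using fun i => (h i).2.2.bound
  have hle : ∀ (f : Fin 2 → ℝ) i, f i ≤ ∑ i, |f i| := fun f i => (le_abs_self _).trans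
    (Finset.single_le_sum (f := fun i => |f i|) (fun _ _ => abs_nonneg _) (Finset.mem_univ i))
  have h1 : 0 ≤ ∑ i, |c i| := Finset.sum_nonneg fun _ _ => abs_nonneg _
  have h2 : 0 ≤ ∑ i, |c' i| := Finset.sum_nonneg fun _ _ => abs_nonneg _
  refine ⟨∑ i, |c i| + ∑ i, |c' i|, by positivity, ?_⟩
  filter_upwards [eventually_all.2 hc, eventually_all.2 hc'] with m hm hm' i
  have e1 := hm i
  have e2 := hm' i
  rw [Real.norm_of_nonneg (sq_nonneg _), Real.norm_of_nonneg (hq m i)] at e1 e2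
  exact ⟨e1.trans (mul_le_mul_of_nonneg_right (by linarith [hle c i]) (hq m i)),
    e2.trans (mul_le_mul_of_nonneg_right (by linarith [hle c' i]) (sq_nonneg _))⟩

lemma div_sqrt_div_rpow {p n : ℝ} (hp : 0 < p) (hn : 0 < n) (δ : ℝ) :
    p / √n / p ^ (1 - δ) = p ^ δ * n ^ (-1 / 2 : ℝ) := by
  rw [show (-1 / 2 : ℝ) = -(1 / 2) by ring, Real.rpow_neg hn.le, ← Real.sqrt_eq_rpow,
    Real.rpow_sub hp, Real.rpow_one]
  have := Real.rpow_pos_of_pos hp δ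
  have := Real.sqrt_pos.2 hn
  field_simp

/-- The probability level fixes the tightness constant `C`, and only then is the rate constant `D`
chosen, so `D` may depend on `C`. -/
lemma isBigOP_of_holdsTightly {Ω : Type*} [MeasurableSpace Ω] {μ : Measure Ω}
    {Q : ℝ → ℕ → Ω → Prop} (hQ : HoldsTightly μ Q) {X : ℕ → Ω → ℝ} {a : ℕ → ℝ}
    (h : ∀ C, 1 ≤ C → ∃ D, ∀ᶠ m in atTop, ∀ ω, Q C m ω → |X m ω| ≤ D * a m) :
    IsBigOP μ X a := by
  intro e he
  obtain ⟨C, hC⟩ := hQ.2 e he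
  obtain ⟨D, hD⟩ := h (max C 1) (le_max_right _ _)
  refine ⟨D, ?_⟩
  filter_upwards [hC, hD] with m hm hm'
  refine le_trans (measure_mono fun ω (hω : D * a m < |X m ω|) => ?_) hm
  exact fun hQω => absurd (hm' ω (hQ.1 (le_max_left _ _) m ω hQω)) (not_le.2 hω)

end Asymptotic

end CPFactor

end

/-! ### The theorem: choice of constants and assembly. -/

theorem theorem2
    {Ω : Type*} [MeasurableSpace Ω] (μ : Measure Ω) [IsProbabilityMeasure μ]
    -- fixed parameters: numbers of factors, number of lags, trimming, factor strengths, constants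
    (k : Fin 2 → ℕ) (hk : ∀ i, 0 < k i) (h₀ : ℕ)
    (η : Fin 2 → ℝ) (hη0 : 0 < η 0) (hη01 : η 0 < η 1) (hη1 : η 1 < 1)
    (δ : Fin 2 → ℝ) (hδ : ∀ i, δ i ∈ Set.Icc (0 : ℝ) 1)
    (ζ σx σε d u u₀ : ℝ) (hζ : 2 < ζ) (hσx : 0 < σx) (hσε : 0 < σε)
    (hd : 0 < d) (hu : 0 < u) (hu₀ : 0 < u₀)
    -- sample sizes, dimensions, break dates, along an arbitrary sequence of experiments
    (n p r₀ : ℕ → ℕ) (hn : Tendsto n atTop atTop) (hp : Tendsto p atTop atTop)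
    (hnp : Tendsto (fun m => (p m : ℝ) ^ max (δ 0) (δ 1) * (n m : ℝ) ^ (-1 / 2 : ℝ))
      atTop (𝓝 0))
    (γ₀ : ℕ → ℝ) (hγ₀ : ∀ m, γ₀ m = (r₀ m : ℝ) / n m)
    -- factors, loading matrices, noise, observations
    (x : ∀ i, ℤ → Ω → Fin (k i) → ℝ) (hx : ∀ i t, Measurable (x i t))
    (A : ∀ m i, Matrix (Fin (p m)) (Fin (k i)) ℝ)
    (ε : ∀ m, ℤ → Ω → Fin (p m) → ℝ)
    (y : ∀ m, ℤ → Ω → Fin (p m) → ℝ) (hy : ∀ m, y m = CPFactor.obs (A m) x (ε m) (r₀ m))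
    -- eigenvectors of `M_i(γ₀)` (their first `k i` columns form `Q_i`) and of the sample `M̂_i(γ)`
    (V : ∀ m, Fin 2 → Matrix (Fin (p m)) (Fin (p m)) ℝ)
    (hV : ∀ m i, CPFactor.IsEigenSystem (CPFactor.popM μ (n m) h₀ (y m) i (γ₀ m)) (V m i))
    (Vhat : ∀ m, Fin 2 → ℝ → Ω → Matrix (Fin (p m)) (Fin (p m)) ℝ)
    (hVhat : ∀ m i γ ω, CPFactor.IsEigenSystem
      (CPFactor.sampleM (n m) h₀ (fun t => y m t ω) i γ) (Vhat m i γ ω))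
    -- the estimated break fraction
    (γhat : ℕ → Ω → ℝ)
    (hγhat : ∀ᶠ m in atTop, ∀ ω, CPFactor.IsBreakEstimate (n m) h₀ k η (fun t => y m t ω)
      (fun i => Vhat m i (η i) ω) (γhat m ω))
    -- the factor process is strongly mixing
    (h_mixing : Summable fun t : ℕ => CPFactor.alphaMix μ x (t + 1) ^ (1 - 2 / ζ))
    -- bounded moments of the factors
    (h_moments : ∀ i (j : Fin (k i)) (t : ℤ), 1 ≤ t →
      Integrable (fun ω => |x i t ω j| ^ (4 * ζ)) μ ∧
        ∫ ω, |x i t ω j| ^ (4 * ζ) ∂μ < σx ^ (4 * ζ))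
    -- the noise
    (h_noise : ∀ m, CPFactor.IsWhiteNoise μ x (ε m) σε)
    -- factor strength
    (h_strength : ∀ i,
      ((fun m => CPFactor.l2norm (A m i) ^ 2) =Θ[atTop] fun m => (p m : ℝ) ^ (1 - δ i)) ∧
      ((fun m => CPFactor.minNorm (A m i) ^ 2) =Θ[atTop] fun m => (p m : ℝ) ^ (1 - δ i)))
    -- the break is in the interior; lagged moment matrices of the factors are nonsingular
    (h_nonsing : ∀ᶠ m in atTop, γ₀ m ∈ Set.Ioo (η 0) (η 1) ∧
      ∀ i, ∀ γ ∈ Set.Icc (η 0) (η 1), ∃ h ∈ Finset.Icc 1 h₀,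
        (CPFactor.popCross μ (n m) (x i) i h γ).rank = k i ∧
          u ≤ CPFactor.minNorm (CPFactor.popCross μ (n m) (x i) i h γ))
    -- distinct positive eigenvalues
    (h_eig : ∀ᶠ m in atTop, ∀ i, ∀ γ ∈ Set.Icc (η 0) (η 1), ∃ S : Finset ℝ, S.card = k i ∧
      ∀ l ∈ S, 0 < l ∧ Module.End.HasEigenvalue
        (Matrix.toLin' (CPFactor.popM μ (n m) h₀ (y m) i γ)) l)
    -- the two loading spaces stay apart
    (h_apart : ∀ᶠ m in atTop, d < CPFactor.spaceDist
      (CPFactor.colSpace (CPFactor.firstCols (k 0) (V m 0)))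
      (CPFactor.colSpace (CPFactor.firstCols (k 1) (V m 1))))
    -- nonsingular moment matrices over the misclassified stretch (for those `γ` for which the averages are over nonempty ranges)
    (h_stretch : ∀ᶠ m in atTop,
      (∀ γ ∈ Set.Ioo (η 0) (γ₀ m), ⌊γ * n m⌋ < (r₀ m : ℤ) - h₀ → ∃ h ∈ Finset.Icc 1 h₀,
        (CPFactor.avgCross μ (n m) (x 0) h γ (γ₀ m - (h : ℝ) / n m)).rank = k 0 ∧
          u₀ ≤ CPFactor.minNorm
            (CPFactor.avgCross μ (n m) (x 0) h γ (γ₀ m - (h : ℝ) / n m))) ∧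
      (∀ γ ∈ Set.Ioo (γ₀ m) (η 1), (r₀ m : ℤ) < ⌊γ * n m⌋ → ∃ h ∈ Finset.Icc 1 h₀,
        (CPFactor.avgCross μ (n m) (x 1) h (γ₀ m) γ).rank = k 1 ∧
          u₀ ≤ CPFactor.minNorm (CPFactor.avgCross μ (n m) (x 1) h (γ₀ m) γ))) :
    ∀ i,
      -- the rate with the estimated break
      CPFactor.IsBigOP μ
        (fun m ω => CPFactor.spaceDist
          (CPFactor.colSpace (CPFactor.firstCols (k i) (Vhat m i (γhat m ω) ω)))
          (CPFactor.colSpace (CPFactor.firstCols (k i) (V m i))))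
        (fun m => (p m : ℝ) ^ δ i * (n m : ℝ) ^ (-1 / 2 : ℝ)) ∧
      -- the same rate holds when the break is known
      CPFactor.IsBigOP μ
        (fun m ω => CPFactor.spaceDist
          (CPFactor.colSpace (CPFactor.firstCols (k i) (Vhat m i (γ₀ m) ω)))
          (CPFactor.colSpace (CPFactor.firstCols (k i) (V m i))))
        (fun m => (p m : ℝ) ^ δ i * (n m : ℝ) ^ (-1 / 2 : ℝ)) := by
  obtain rfl : y = fun m => CPFactor.obs (A m) x (ε m) (r₀ m) := funext hy
  obtain rfl : γ₀ = fun m => (r₀ m : ℝ) / n m := funext hγ₀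
  have hm : CPFactor.MomentBound μ x ζ σx := h_moments
  set H : ℝ := 1 + σx ^ (4 * ζ) with hH
  have hH0 : 0 ≤ H := by positivity
  set Q : ℝ := ((k 0 : ℝ) + k 1) ^ 2 with hQ
  have hQ0 : 0 < Q := by
    have h0 : (0 : ℝ) < k 0 := by exact_mod_cast hk 0
    positivity
  -- Half of the nonsingularity constants is kept and the other half pays for random deviations.
  set c : ℝ := min u u₀ / 2 with hc
  have hc0 : 0 < c := half_pos (lt_min hu hu₀)
  have hcu : 2 * c ≤ u := by rw [hc, mul_div_cancel₀ _ two_ne_zero]; exact min_le_left _ _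
  have hcu₀ : 2 * c ≤ u₀ := by rw [hc, mul_div_cancel₀ _ two_ne_zero]; exact min_le_right _ _
  -- The slope has to be fixed before the tightness constant `C`. It costs `Q * κ = c / 2`; the cost
  -- `Q * C / n` of the constant falls below `c / 2` for large `n`.
  set κ : ℝ := c / (2 * Q) with hκdef
  have hκ : 0 < κ := by positivity
  have hQκ : Q * κ = c / 2 := by rw [hκdef]; field_simp
  set q : ℕ → Fin 2 → ℝ := fun m i => (p m : ℝ) ^ (1 - δ i) with hq
  have hqnn : ∀ m i, 0 ≤ q m i := fun m i => Real.rpow_nonneg (Nat.cast_nonneg _) _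
  obtain ⟨B, hB, hAB⟩ := CPFactor.exists_strength_constant hqnn h_strength
  have hp1 : ∀ᶠ m in atTop, 1 ≤ p m := hp.eventually_ge_atTop 1
  have hn1 : ∀ᶠ m in atTop, 1 ≤ n m := hn.eventually_ge_atTop 1
  -- The break date exceeds `η 0 * n`, which tends to infinity.
  have hr : ∀ᶠ m in atTop, h₀ ≤ r₀ m := by
    filter_upwards [hn1, h_nonsing, (tendsto_natCast_atTop_atTop.comp hn).eventually_ge_atTop
      ((h₀ : ℝ) / η 0)] with m h1 h2 h3
    have hn0 : (0 : ℝ) < n m := by exact_mod_cast h1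
    have h4 := (lt_div_iff₀ hn0).1 h2.1.1
    have h5 : (h₀ : ℝ) ≤ n m * η 0 := (div_le_iff₀ hη0).1 h3
    exact_mod_cast (by linarith : (h₀ : ℝ) ≤ r₀ m)
  have hdesign : ∀ᶠ m in atTop, CPFactor.IsDesign μ x (n m) (r₀ m) h₀ η u u₀ H := by
    have hmin : ∀ {K : ℕ} {S : Matrix (Fin K) (Fin K) ℝ} {w : ℝ}, S.rank = K →
        w ≤ CPFactor.minNorm S → ∀ v, w * CPFactor.vnorm v ≤ CPFactor.vnorm (S *ᵥ v) :=
      fun hS hw v => (mul_le_mul_of_nonneg_right hw (CPFactor.vnorm_nonneg v)).trans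
        (CPFactor.minNorm_mul_vnorm_le_of_rank hS v)
    filter_upwards [hn1, h_nonsing, h_stretch] with m h1 h2 h3
    exact
      { pos := h1
        trim_pos := hη0
        trim_lt_one := hη1
        break_mem := h2.1
        nonsing := fun i γ hγ => by
          obtain ⟨h, hh, ha, hb⟩ := h2.2 i γ hγ
          exact ⟨h, hh, hmin ha hb⟩
        stretch_left := fun γ hγ hlt => by
          obtain ⟨h, hh, ha, hb⟩ := h3.1 γ hγ hlt
          exact ⟨h, hh, hmin ha hb⟩
        stretch_right := fun γ hγ hlt => by
          obtain ⟨h, hh, ha, hb⟩ := h3.2 γ hγ hlt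
          exact ⟨h, hh, hmin ha hb⟩
        moment_le := fun i h a b t ht => (abs_integral_le_integral_abs).trans
          (hm.integral_abs_mul_le hx hζ a b ht (by omega)) }
  have hload : ∀ᶠ m in atTop, ∀ i, CPFactor.LoadingBounds (A m i) (CPFactor.minNorm (A m i))
      (CPFactor.l2norm (A m i)) B (q m i) := by
    filter_upwards [hp1, hdesign, h_eig, hAB] with m h1 h2 h3 h4 i
    have hq0 : 0 < q m i := Real.rpow_pos_of_pos (by exact_mod_cast h1) _
    have hinj := CPFactor.mulVec_injective_of_popM hx hζ hm (h_noise m) h2.floor_break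
      (by exact_mod_cast h2.break_le) (h3 i _ (Set.Ioo_subset_Icc_self h2.break_mem))
    refine ⟨(CPFactor.minNorm_nonneg _).lt_of_ne fun h0 => ?_, CPFactor.l2norm_nonneg _,
      CPFactor.minNorm_mul_vnorm_le hinj, CPFactor.vnorm_mulVec_le_l2norm _, (h4 i).2, (h4 i).1⟩
    have := (h4 i).2
    rw [← h0] at this
    linarith
  have hqp : ∀ᶠ m in atTop, ∀ i, q m i ≤ p m := by
    filter_upwards [hp1] with m h1 i
    calc q m i ≤ (p m : ℝ) ^ (1 : ℝ) := Real.rpow_le_rpow_of_exponent_le (by exact_mod_cast h1)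
          (by linarith [(hδ i).1])
      _ = p m := Real.rpow_one _
  -- From here on the leading population eigenspaces are replaced by the loading spaces, both in the
  -- distances and in the separation condition.
  have hspace : ∀ᶠ m in atTop, ∀ i, CPFactor.colSpace (CPFactor.firstCols (k i) (V m i)) =
      CPFactor.colSpace (A m i) := by
    filter_upwards [hdesign, hload] with m h1 h2 i
    exact CPFactor.colSpace_firstCols_popM hx hζ hm (h_noise m) h1.floor_break
      (by exact_mod_cast h1.break_le) (h2 i).pos (h2 i).lower hu
      (h1.nonsing i _ (Set.Ioo_subset_Icc_self h1.break_mem)) (hV m i)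
  have htight := CPFactor.holdsTightly_isRegularSample (n := n) (r₀ := r₀) (h₀ := h₀)
    (L := fun m i => CPFactor.l2norm (A m i)) hx hζ hσx h_mixing hm hκ hB h_noise
    (by
      filter_upwards [hp1, hn1, hload, hqp] with m h1 h2 h3 h4
      exact ⟨h1, h2, fun i => (h3 i).upper,
        fun i => (h3 i).upper_le.trans (mul_le_mul_of_nonneg_left (h4 i) hB)⟩) hr
  -- On regular realisations the bound is deterministic: `D` and the threshold for `m` do not depend
  -- on `ω`.
  have main : ∀ C, 1 ≤ C → ∃ D, ∀ᶠ m in atTop, ∀ ω,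
      CPFactor.IsRegularSample μ x (A m) (ε m) (n m) (r₀ m) h₀ κ C ω → ∀ i,
      CPFactor.spaceDist (CPFactor.colSpace (CPFactor.firstCols (k i) (Vhat m i (γhat m ω) ω)))
          (CPFactor.colSpace (CPFactor.firstCols (k i) (V m i))) ≤
        D * ((p m : ℝ) ^ δ i * (n m : ℝ) ^ (-1 / 2 : ℝ)) ∧
      CPFactor.spaceDist
          (CPFactor.colSpace (CPFactor.firstCols (k i) (Vhat m i ((r₀ m : ℝ) / n m) ω)))
          (CPFactor.colSpace (CPFactor.firstCols (k i) (V m i))) ≤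
        D * ((p m : ℝ) ^ δ i * (n m : ℝ) ^ (-1 / 2 : ℝ)) := by
    intro C hC
    obtain ⟨D, r, hr0, hD⟩ := CPFactor.exists_rate_bound (μ := μ) (x := x) (h₀ := h₀) (u := u) hk
      hκ.le hC hB hH0 hu₀.le hc0 hd (by linarith : c ≤ u₀ - Q * κ)
    refine ⟨D, ?_⟩
    filter_upwards [hp1, hn1, hdesign, hload, hqp, hspace, h_apart, hγhat,
      hnp.eventually_lt_const hr0, (tendsto_natCast_atTop_atTop.comp hn).eventually_ge_atTop
        (2 * (Q * C) / c)] with m h1 h2 h3 h4 h5 h6 h7 h8 h9 h10 ω hω i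
    have hp0 : (0 : ℝ) < p m := by exact_mod_cast h1
    have hn0 : (0 : ℝ) < n m := by exact_mod_cast h2
    have hq0 : ∀ i, 0 < q m i := fun i => Real.rpow_pos_of_pos hp0 _
    have hn2 : Q * (C / n m) ≤ c / 2 := by
      have h11 : 2 * (Q * C) ≤ n m * c := (div_le_iff₀ hc0).1 h10
      rw [← mul_div_assoc, div_le_iff₀ hn0]
      linarith
    have hrate : ∀ i, (p m : ℝ) / √(n m : ℝ) / q m i =
        (p m : ℝ) ^ δ i * (n m : ℝ) ^ (-1 / 2 : ℝ) := fun i =>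
      CPFactor.div_sqrt_div_rpow hp0 hn0 (δ i)
    -- This is where the limit hypothesis enters: `p ≥ 1` and `δ i ≤ max (δ 0) (δ 1)` bring the
    -- relative error below `r` in both regimes.
    have hsmall : ∀ i, (p m : ℝ) / √(n m : ℝ) ≤ r * q m i := fun i => by
      rw [← div_le_iff₀ (hq0 i), hrate i]
      refine le_trans (mul_le_mul_of_nonneg_right (Real.rpow_le_rpow_of_exponent_le
        (by exact_mod_cast h1) ?_) (by positivity)) h9.le
      fin_cases i
      exacts [le_max_left _ _, le_max_right _ _]
    have h7' := h7
    rw [h6 0, h6 1] at h7'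
    have := hD (V := fun i γ => Vhat m i γ ω) h1 h3 hω (by linarith) h4 hq0 h5 hsmall
      (fun i γ => hVhat m i γ ω) h7' (h8 ω) i
    rwa [hrate i, ← h6 i] at this
  intro i
  constructor <;> refine CPFactor.isBigOP_of_holdsTightly htight fun C hC => ?_
  all_goals
    obtain ⟨D, hD⟩ := main C hC
    refine ⟨D, ?_⟩
    filter_upwards [hD] with m h1 ω hω
    rw [abs_of_nonneg (CPFactor.spaceDist_nonneg _ _)]
  exacts [(h1 ω hω i).1, (h1 ω hω i).2]
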